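/- Let $m(\xi)=\sqrt{\tanh(\xi)/\xi}$ (with $m(0)=1$), let $K(x)=\frac1{2\pi}\int_{\mathbb R}m(\xi)e^{ix\xi}\,d\xi$ (a conditionally convergent integral for $x\neq 0$) and let $Lf=K*f$. For $0<P<\infty$ and $\mu\in\mathbb R$, a ($P$-periodic) solution of the steady Whitham equation $$-\mu\varphi+L\varphi+\varphi^2=0 \tag{1}$$ is a real-valued, continuous, bounded, $P$-periodic function $\varphi$ on $\mathbb R$ that satisfies (1) pointwise. **(a)** Let $0<P<\infty$. There is a constant $\lambda_{K,P}>0$, depending only on $K$ and $P$, such that for every $\mu\in\mathbb R$ and every even, nonconstant solution $\varphi$ of (1) that is nondecreasing on $(-P/2,0)$ and satisfies $\varphi\le\frac{\mu}{2}$, $$\tfrac{\mu}{2}-\varphi(\tfrac P2)\ \ge\ \lambda_{K,P}.$$ **(b)** More generally, there is a constant $C_{K,P}>0$, depending only on $K$ and $P$, such that for all $\mu$ and $\varphi$ as in (a), all $x_0<0$ and all $x\in[-P/2,x_0]$, $$\tfrac{\mu}{2}-\varphi(x)\ \ge\ C_{K,P}\,|x_0|^{1/2}.$$ **(c)** For $\alpha\in(\frac12,1)$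 let $C^\alpha_{\mathrm{even}}(\mathbb S_P)$ be the space of even, $P$-periodic, $\alpha$-Hölder continuous real functions on $\mathbb R$, with norm $\sup_x|f(x)|+\sup_{x\ne y}|f(x)-f(y)|/|x-y|^\alpha$, and let $$S=\{(\varphi,\mu)\in C^\alpha_{\mathrm{even}}(\mathbb S_P)\times\mathbb R:\ \varphi<\tfrac{\mu}{2}\text{ everywhere and }\varphi\text{ solves (1)}\}.$$ A *local bifurcation curve* is a real-analytic curve $s\mapsto(\varphi_1(s),\mu_1(s))\in C^\alpha_{\mathrm{even}}(\mathbb S_P)\times\mathbb R$, $|s|<\varepsilon$, of solutions of (1), with $\varphi_1(s)\neq0$ for $s\ne0$, $(\varphi_1(0),\mu_1(0))=(0,m(2\pi/P))$ and $\varphi_1'(0)=\cos(2\pi\,\cdot/P)$. A *global bifurcation curve* is a continuous curve $s\mapsto(\varphi(s),\mu(s))\in S$, $s\ge0$, that coincides with a local bifurcation curve for small $s\ge0$ and has a local real-analytic reparametrisation around each $s_0>0$: there is a continuous injective $\rho\colon(-1,1)\to(0,\infty)$ with $\rho(0)=s_0$ such that $t\mapsto(\varphi(\rho(t)),\mu(\rho(t)))$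 is real-analytic on $(-1,1)$. Then for each $P\in(0,\infty)$ there is a constant $c_P>0$ such that, for every $\alpha\in(\frac12,1)$, the wave speed along every global bifurcation curve satisfies $\mu(s)\ge c_P$ for all $s\ge0$. -/

import Mathlib

open Set Filter Topology

/-! ### The Whitham symbol, the kernel and the convolution operator -/

/-- The Whitham symbol `m(ξ) = √(tanh ξ / ξ)`, extended continuously by `m(0) = 1`. -/
noncomputable def whithamSymbol (ξ : ℝ) : ℝ :=
  if ξ = 0 then 1 else Real.sqrt (Real.tanh ξ / ξ)

/-- The Whitham kernel `K(x) = (1 / 2π) ∫_ℝ m(ξ) exp(i x ξ) dξ`, the inverse Fourier transform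
of `m`. The integral is conditionally convergent for `x ≠ 0` and is read as
the limit of the integrals over `[-R, R]`; it is real because `m` is even. At the single point
`x = 0` the kernel is infinite and the value chosen here plays no role. -/
noncomputable def whithamKernel (x : ℝ) : ℝ :=
  (limUnder atTop (fun R : ℝ =>
    (1 / (2 * (Real.pi : ℂ))) *
      ∫ ξ in (-R)..R, (whithamSymbol ξ : ℂ) * Complex.exp (Complex.I * x * ξ))).re

/-- The operator `L f = K * f`, for bounded continuous `f`. -/
noncomputable def whithamL (f : ℝ → ℝ) (x : ℝ) : ℝ :=
  ∫ y, whithamKernel (x - y) * f y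

/-- `P`-periodic solutions of the steady Whitham equation `-μ φ + L φ + φ² = 0`: continuous,
bounded, `P`-periodic functions satisfying the equation pointwise. -/
structure IsWhithamSolution (P μ : ℝ) (φ : ℝ → ℝ) : Prop where
  continuous : Continuous φ
  bounded : ∃ C : ℝ, ∀ x, |φ x| ≤ C
  periodic : Function.Periodic φ P
  equation : ∀ x, -μ * φ x + whithamL φ x + φ x ^ 2 = 0

/-- Even, nonconstant `P`-periodic solutions of the steady Whitham equation that are
nondecreasing on the half-period `(-P/2, 0)` and do not exceed `μ / 2`. -/
structure IsMonotoneWave (P μ : ℝ) (φ : ℝ → ℝ) : Prop where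
  solution : IsWhithamSolution P μ φ
  even : Function.Even φ
  nonconstant : ¬ ∃ c : ℝ, ∀ x, φ x = c
  monotone : MonotoneOn φ (Ioo (-(P / 2)) 0)
  le_half : ∀ x, φ x ≤ μ / 2

/-! ### The space of even, `P`-periodic, `α`-Hölder continuous functions -/

/-- The vector space of bounded continuous functions on `ℝ` that are even, `P`-periodic and
(globally) `α`-Hölder continuous. -/
def holderEvenSubmodule (P α : ℝ) : Submodule ℝ (ℝ → ℝ) where
  carrier := {f | Continuous f ∧ (∃ C : ℝ, ∀ x, |f x| ≤ C) ∧ Function.Periodic f P ∧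
    Function.Even f ∧ ∃ C : ℝ, ∀ x y, |f x - f y| ≤ C * |x - y| ^ α}
  zero_mem' := ⟨continuous_const, ⟨0, by simp⟩, by intro x; simp, by intro x; simp,
    ⟨0, by simp⟩⟩
  add_mem' := by
    rintro f g ⟨hf, ⟨A, hA⟩, pf, ef, ⟨C, hC⟩⟩ ⟨hg, ⟨B, hB⟩, pg, eg, ⟨D, hD⟩⟩
    refine ⟨hf.add hg, ⟨A + B, fun x => ?_⟩, pf.add pg, ef.add eg, ⟨C + D, fun x y => ?_⟩⟩
    · exact (abs_add_le _ _).trans (add_le_add (hA x) (hB x))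
    · have h : (f + g) x - (f + g) y = (f x - f y) + (g x - g y) := by
        simp only [Pi.add_apply]; ring
      rw [h, add_mul]
      exact (abs_add_le _ _).trans (add_le_add (hC x y) (hD x y))
  smul_mem' := by
    rintro c f ⟨hf, ⟨A, hA⟩, pf, ef, ⟨C, hC⟩⟩
    refine ⟨hf.const_smul c, ⟨|c| * A, fun x => ?_⟩, pf.smul c, ?_, ⟨|c| * C, fun x y => ?_⟩⟩
    · simp only [Pi.smul_apply, smul_eq_mul, abs_mul]
      exact mul_le_mul_of_nonneg_left (hA x) (abs_nonneg c)
    · intro x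
      simp only [Pi.smul_apply, ef x]
    · simp only [Pi.smul_apply, smul_eq_mul]
      rw [← mul_sub, abs_mul, mul_assoc]
      exact mul_le_mul_of_nonneg_left (hC x y) (abs_nonneg c)

/-- The Hölder space `C^α_even(𝕊_P)`, with its own type so that it carries the Hölder norm. -/
def HolderEven (P α : ℝ) : Type := ↥(holderEvenSubmodule P α)

namespace HolderEven

variable {P α : ℝ}

noncomputable instance : AddCommGroup (HolderEven P α) :=
  inferInstanceAs (AddCommGroup ↥(holderEvenSubmodule P α))

noncomputable instance : Module ℝ (HolderEven P α) :=
  inferInstanceAs (Module ℝ ↥(holderEvenSubmodule P α))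

/-- The underlying function on the real line. -/
def toFun (f : HolderEven P α) : ℝ → ℝ := Subtype.val f

instance : CoeFun (HolderEven P α) (fun _ => ℝ → ℝ) := ⟨toFun⟩

theorem ext_fun {f g : HolderEven P α} (h : ∀ x, f x = g x) : f = g :=
  Subtype.ext (funext h)

theorem zero_apply (x : ℝ) : (0 : HolderEven P α) x = 0 := rfl

theorem add_apply (f g : HolderEven P α) (x : ℝ) : (f + g) x = f x + g x := rfl

theorem smul_apply (c : ℝ) (f : HolderEven P α) (x : ℝ) : (c • f) x = c * f x := rfl

/-- The Hölder norm `sup_x |f x| + sup_{x ≠ y} |f x - f y| / |x - y| ^ α`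
(the quotient is `0` for `x = y`). -/
noncomputable instance : Norm (HolderEven P α) :=
  ⟨fun f => (⨆ x : ℝ, |f x|) + ⨆ p : ℝ × ℝ, |f p.1 - f p.2| / |p.1 - p.2| ^ α⟩

theorem norm_def (f : HolderEven P α) :
    ‖f‖ = (⨆ x : ℝ, |f x|) + ⨆ p : ℝ × ℝ, |f p.1 - f p.2| / |p.1 - p.2| ^ α := rfl

theorem bddAbove_abs (f : HolderEven P α) : BddAbove (range fun x : ℝ => |f x|) := by
  obtain ⟨C, hC⟩ := f.2.2.1
  exact ⟨C, by rintro _ ⟨x, rfl⟩; exact hC x⟩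

theorem bddAbove_quot (f : HolderEven P α) :
    BddAbove (range fun p : ℝ × ℝ => |f p.1 - f p.2| / |p.1 - p.2| ^ α) := by
  obtain ⟨C, hC⟩ := f.2.2.2.2.2
  refine ⟨|C|, ?_⟩
  rintro _ ⟨⟨x, y⟩, rfl⟩
  refine div_le_of_le_mul₀ (Real.rpow_nonneg (abs_nonneg _) _) (abs_nonneg _) ?_
  exact (hC x y).trans
    (mul_le_mul_of_nonneg_right (le_abs_self C) (Real.rpow_nonneg (abs_nonneg _) _))

theorem quot_nonneg (f : HolderEven P α) (p : ℝ × ℝ) :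
    0 ≤ |f p.1 - f p.2| / |p.1 - p.2| ^ α :=
  div_nonneg (abs_nonneg _) (Real.rpow_nonneg (abs_nonneg _) _)

theorem normedSpaceCore : NormedSpace.Core ℝ (HolderEven P α) where
  norm_nonneg f :=
    add_nonneg (Real.iSup_nonneg fun _ => abs_nonneg _) (Real.iSup_nonneg (quot_nonneg f))
  norm_smul c f := by
    simp only [norm_def, smul_apply, Real.norm_eq_abs, mul_add]
    rw [Real.mul_iSup_of_nonneg (abs_nonneg c), Real.mul_iSup_of_nonneg (abs_nonneg c)]
    congr 1
    · simp only [abs_mul]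
    · congr 1
      funext p
      rw [← mul_sub, abs_mul, mul_div_assoc]
  norm_triangle f g := by
    have h1 : (⨆ x : ℝ, |(f + g) x|) ≤ (⨆ x : ℝ, |f x|) + ⨆ x : ℝ, |g x| :=
      ciSup_le fun x => (abs_add_le _ _).trans
        (add_le_add (le_ciSup (bddAbove_abs f) x) (le_ciSup (bddAbove_abs g) x))
    have h2 : (⨆ p : ℝ × ℝ, |(f + g) p.1 - (f + g) p.2| / |p.1 - p.2| ^ α) ≤
        (⨆ p : ℝ × ℝ, |f p.1 - f p.2| / |p.1 - p.2| ^ α) +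
          ⨆ p : ℝ × ℝ, |g p.1 - g p.2| / |p.1 - p.2| ^ α := by
      refine ciSup_le fun p => ?_
      refine le_trans ?_ (add_le_add (le_ciSup (bddAbove_quot f) p) (le_ciSup (bddAbove_quot g) p))
      rw [← add_div]
      refine div_le_div_of_nonneg_right ?_ (Real.rpow_nonneg (abs_nonneg _) _)
      have h : (f + g) p.1 - (f + g) p.2 = (f p.1 - f p.2) + (g p.1 - g p.2) := by
        simp only [add_apply]; ring
      rw [h]
      exact abs_add_le _ _
    simp only [norm_def]
    linarith
  norm_eq_zero_iff f := by
    constructor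
    · intro h
      have h1 : (0 : ℝ) ≤ ⨆ x : ℝ, |f x| := Real.iSup_nonneg fun _ => abs_nonneg _
      have h2 := Real.iSup_nonneg (quot_nonneg f)
      rw [norm_def] at h
      refine ext_fun fun x => ?_
      have h3 := le_ciSup (bddAbove_abs f) x
      have h4 : |f x| ≤ 0 := by linarith
      rw [zero_apply]
      exact abs_nonpos_iff.mp h4
    · rintro rfl
      simp [norm_def, zero_apply]

noncomputable instance : NormedAddCommGroup (HolderEven P α) :=
  NormedAddCommGroup.ofCore normedSpaceCore

noncomputable instance : NormedSpace ℝ (HolderEven P α) :=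
  NormedSpace.ofCore normedSpaceCore

end HolderEven

/-! ### The bifurcation curves -/

/-- The solution set `S`: pairs `(φ, μ)` in `C^α_even(𝕊_P) × ℝ` with `φ < μ / 2` that solve the
steady Whitham equation. -/
def whithamSolutionSet (P α : ℝ) : Set (HolderEven P α × ℝ) :=
  {q | (∀ x, q.1 x < q.2 / 2) ∧ IsWhithamSolution P q.2 q.1}

/-- A local analytic curve of nontrivial solutions, with parameter in `(-ε, ε)`, that bifurcates
from the trivial solutions at `(0, m(2π / P))` in the direction `cos(2π · / P)`. -/
structure IsLocalBifurcationCurve (P α ε : ℝ) (l : ℝ → HolderEven P α × ℝ) : Prop where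
  pos : 0 < ε
  analytic : AnalyticOnNhd ℝ l (Ioo (-ε) ε)
  start : l 0 = (0, whithamSymbol (2 * Real.pi / P))
  direction : ∃ v : HolderEven P α, (∀ x, v x = Real.cos (2 * Real.pi * x / P)) ∧
    HasDerivAt (fun s => (l s).1) v 0
  solution : ∀ s ∈ Ioo (-ε) ε, IsWhithamSolution P (l s).2 (l s).1
  nontrivial : ∀ s ∈ Ioo (-ε) ε, s ≠ 0 → (l s).1 ≠ 0

/-- A global bifurcation curve `s ↦ (φ(s), μ(s))`, `s ≥ 0`: a continuous curve in the solution
set that extends the local bifurcation curve from `(0, m(2π / P))` and that has a local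
real-analytic reparametrisation around each `s > 0` (values at `s < 0` are irrelevant). -/
structure IsGlobalBifurcationCurve (P α : ℝ) (γ : ℝ → HolderEven P α × ℝ) : Prop where
  continuousOn : ContinuousOn γ (Ici 0)
  mem : ∀ s, 0 ≤ s → γ s ∈ whithamSolutionSet P α
  extends_local : ∃ (ε : ℝ) (l : ℝ → HolderEven P α × ℝ),
    IsLocalBifurcationCurve P α ε l ∧ ∀ s ∈ Ico 0 ε, γ s = l s
  reparam : ∀ s₀, 0 < s₀ → ∃ ρ : ℝ → ℝ,
    ContinuousOn ρ (Ioo (-1) 1) ∧ InjOn ρ (Ioo (-1) 1) ∧ ρ 0 = s₀ ∧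
    MapsTo ρ (Ioo (-1) 1) (Ioi 0) ∧ AnalyticOnNhd ℝ (fun t => γ (ρ t)) (Ioo (-1) 1)

/-! Rotating the Fourier integral of $m$ onto the imaginary axis shows that $K$ is completely
monotone on the half-line: $K(x)=\frac1\pi\int_0^\infty e^{-|x|\eta}w(\eta)\,d\eta$ with $w\ge0$
(`whithamKernel_of_pos`). Hence $L$ is a positive superposition of convolutions with $e^{-\eta|x|}$.
On odd $2H$-periodic functions, $H=P/2$, each of these is an integral over $(0,H)$ against an
explicit nonnegative Dirichlet Green function (`expConv_eq_integral_green`). Three estimates for $L$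
on odd periodic functions follow, where $W$ is the normalised distance to $H\mathbb Z$: strict
positivity, $Lf\ge cW\int_0^H Wf$ for $f\ge0$ on $[0,H]$ (`exists_whithamL_ge_latticeDist`); a trace
of the kernel singularity, $Lf\ge\frac{c}{\sqrt a}\int_{a/2}^a f$ on $[a/2,a]$
(`exists_whithamL_ge_near_zero`); and the gain $f=O(W^\beta)\Rightarrow Lf=O(W)$ for $\beta>1/2$
(`abs_whithamL_le_latticeDist`).

The wave is studied through $F(a,h)=\varphi(a-h)-\varphi(a+h)$. It is symmetric, odd and periodic in
each variable, nonnegative on $[0,H]^2$ exactly when $\varphi$ decreases on $[0,H]$, and subtracting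
the equation at two points gives the linear relation $(\mu-\varphi(a-h)-\varphi(a+h))F=LF$.
Inserting the singular lower bound, integrating over $[a/2,a]$, cancelling $\int F>0$ and letting
$h\to0$ gives $\mu/2-\varphi(a)\ge C\sqrt a$ (`exists_sqrt_le_half_sub`), hence (a) and (b).

For (c), the equation at crest and trough bounds $\varphi(0)-\varphi(P/4)$ by a multiple of $\mu$
when $\mu<\int K$; together with the square root bound this keeps $\mu$ away from zero on monotone
waves (`exists_le_speed`). It remains to see that the curve consists of monotone waves up to
isolated parameters. Positivity gives $F\ge cW(a)W(h)$ for monotone profiles (`exists_reflDiff_ge`),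
and a bootstrap shows that a small perturbation changes $F$ by at most $\epsilon W(a)W(h)$
(`exists_reflDiff_le`), so monotonicity is stable. Constant solutions on the curve are handled by
analyticity: modulo constants the curve is $t^n g(t)$ with $g(0)$ nonconstant, and stability is
applied to $g$. Connectedness of $(0,\infty)$ and continuity of $\mu$ finish the argument. -/

/-! ### The spectral weight and its integrability -/

/-- The density of the Whitham kernel as a mixture of the exponentials `exp (-η |x|)`. -/
noncomputable def kernelWeight (η : ℝ) : ℝ := √(-Real.tan η / η)

theorem kernelWeight_nonneg (η : ℝ) : 0 ≤ kernelWeight η := Real.sqrt_nonneg _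

theorem measurable_tan : Measurable Real.tan := by
  have h : Real.tan = fun x => Real.sin x / Real.cos x := funext Real.tan_eq_sin_div_cos
  rw [h]
  exact Real.measurable_sin.div Real.measurable_cos

theorem measurable_kernelWeight : Measurable kernelWeight :=
  ((measurable_tan.neg).div measurable_id).sqrt

/-- Since `√` is `0` on negative reals, the weight lives only where the tangent is negative. This
gap next to the origin is what makes negative powers of `η` harmless there. -/
theorem kernelWeight_eq_zero {η : ℝ} (h0 : 0 < η) (h1 : η ≤ Real.pi / 2) :
    kernelWeight η = 0 := by
  refine Real.sqrt_eq_zero_of_nonpos ?_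
  refine div_nonpos_of_nonpos_of_nonneg (neg_nonpos.2 ?_) h0.le
  exact Real.tan_nonneg_of_nonneg_of_le_pi_div_two h0.le h1

theorem kernelWeight_le {η : ℝ} (h0 : 0 < η) :
    kernelWeight η ≤ √|Real.tan η| * η ^ (-(1 / 2) : ℝ) := by
  rw [Real.rpow_neg h0.le, ← Real.sqrt_eq_rpow, ← Real.sqrt_inv, ← Real.sqrt_mul (abs_nonneg _)]
  refine Real.sqrt_le_sqrt ?_
  rw [div_eq_mul_inv]
  exact mul_le_mul_of_nonneg_right (neg_le_abs _) (inv_nonneg.2 h0.le)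

theorem periodic_sqrt_abs_tan : Function.Periodic (fun η => √|Real.tan η|) Real.pi := by
  intro η
  simp only [Real.tan_add_pi]

/-- Jordan's inequality bounds the cosine below by a multiple of $\pi/2-x$, so the singularity at
$\pi/2$ is at worst an inverse square root. -/
theorem intervalIntegrable_sqrt_abs_tan_zero_pi_div_two :
    IntervalIntegrable (fun η => √|Real.tan η|) MeasureTheory.volume 0 (Real.pi / 2) := by
  have h1 : IntervalIntegrable (fun x : ℝ => √(Real.pi / 2) * (Real.pi / 2 - x) ^ (-(1 / 2) : ℝ))
      MeasureTheory.volume 0 (Real.pi / 2) := by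
    have h := (intervalIntegral.intervalIntegrable_rpow' (a := Real.pi / 2) (b := 0)
      (r := -(1 / 2)) (by norm_num)).comp_sub_left (Real.pi / 2)
    simp only [sub_self, sub_zero] at h
    exact h.const_mul _
  refine h1.mono_fun (measurable_tan.abs.sqrt).aestronglyMeasurable ?_
  refine (MeasureTheory.ae_restrict_iff' measurableSet_uIoc).2 ?_
  refine Eventually.of_forall fun x hx => ?_
  rw [uIoc_of_le (by positivity)] at hx
  beta_reduce
  rcases hx.2.eq_or_lt with h | h
  · rw [h, Real.tan_pi_div_two]
    simp
  have hpos : 0 < Real.pi / 2 - x := by linarith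
  rw [Real.norm_of_nonneg (Real.sqrt_nonneg _), Real.norm_of_nonneg (by positivity),
    Real.rpow_neg hpos.le, ← Real.sqrt_eq_rpow, ← Real.sqrt_inv, ← Real.sqrt_mul (by positivity)]
  refine Real.sqrt_le_sqrt ?_
  have hc : 2 / Real.pi * (Real.pi / 2 - x) ≤ Real.cos x := by
    rw [← Real.sin_pi_div_two_sub]
    exact Real.mul_le_sin hpos.le (by linarith [hx.1])
  have hc0 : 0 < 2 / Real.pi * (Real.pi / 2 - x) := by positivity
  rw [Real.tan_eq_sin_div_cos, abs_div, abs_of_pos (hc0.trans_le hc)]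
  calc |Real.sin x| / Real.cos x ≤ 1 / (2 / Real.pi * (Real.pi / 2 - x)) :=
        div_le_div₀ zero_le_one (Real.abs_sin_le_one x) hc0 hc
    _ = Real.pi / 2 * (Real.pi / 2 - x)⁻¹ := by
        have := Real.pi_pos
        field_simp

theorem intervalIntegrable_sqrt_abs_tan (a b : ℝ) :
    IntervalIntegrable (fun η => √|Real.tan η|) MeasureTheory.volume a b := by
  refine periodic_sqrt_abs_tan.intervalIntegrable (t := 0) Real.pi_ne_zero ?_ a b
  rw [zero_add]
  refine intervalIntegrable_sqrt_abs_tan_zero_pi_div_two.trans ?_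
  have h := intervalIntegrable_sqrt_abs_tan_zero_pi_div_two.symm.comp_sub_left Real.pi
  have e : Real.pi - Real.pi / 2 = Real.pi / 2 := by ring
  rw [e, sub_zero] at h
  refine h.congr (fun x _ => ?_)
  simp only [Real.tan_pi_sub, abs_neg]

/-- On each period `f` is at most its value at the left endpoint, and `T` times that value is at
most the integral of `f` over the preceding period. Hence the shift by one period between the two
sides. -/
theorem integral_periodic_mul_antitone_le {h f : ℝ → ℝ} {T : ℝ} (hT : 0 < T)
    (hper : Function.Periodic h T) (h0 : ∀ x, 0 ≤ h x)
    (hint : ∀ a b, IntervalIntegrable h MeasureTheory.volume a b)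
    (hf : ContinuousOn f (Ici 0)) (hanti : AntitoneOn f (Ici 0)) (n : ℕ) :
    ∫ x in T..((n + 1 : ℕ) * T), h x * f x ≤
      (∫ x in (0 : ℝ)..T, h x) / T * ∫ x in (0 : ℝ)..(n * T), f x := by
  have hsub : ∀ a b : ℝ, 0 ≤ a → 0 ≤ b → uIcc a b ⊆ Ici 0 := by
    intro a b ha hb x hx
    exact (le_min ha hb).trans hx.1
  have hfi : ∀ a b : ℝ, 0 ≤ a → 0 ≤ b → IntervalIntegrable f MeasureTheory.volume a b :=
    fun a b ha hb => (hf.mono (hsub a b ha hb)).intervalIntegrable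
  have hhf : ∀ a b : ℝ, 0 ≤ a → 0 ≤ b →
      IntervalIntegrable (fun x => h x * f x) MeasureTheory.volume a b :=
    fun a b ha hb => (hint a b).mul_continuousOn (hf.mono (hsub a b ha hb))
  have hh0 : 0 ≤ ∫ x in (0 : ℝ)..T, h x :=
    intervalIntegral.integral_nonneg hT.le fun x _ => h0 x
  induction n with
  | zero => simp
  | succ n ih =>
    have p0 : (0 : ℝ) ≤ n * T := by positivity
    have p1 : (0 : ℝ) ≤ (n + 1 : ℕ) * T := by positivity
    have p2 : (0 : ℝ) ≤ (n + 1 + 1 : ℕ) * T := by positivity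
    rw [← intervalIntegral.integral_add_adjacent_intervals (hhf T _ hT.le p1) (hhf _ _ p1 p2),
      ← intervalIntegral.integral_add_adjacent_intervals (hfi 0 _ le_rfl p0) (hfi _ _ p0 p1),
      mul_add]
    refine add_le_add ih ?_
    set c := f ((n + 1 : ℕ) * T) with hc
    have e1 : ∫ x in ((n + 1 : ℕ) * T)..((n + 1 + 1 : ℕ) * T), h x * f x ≤
        ∫ x in ((n + 1 : ℕ) * T)..((n + 1 + 1 : ℕ) * T), h x * c := by
      refine intervalIntegral.integral_mono_on ?_ (hhf _ _ p1 p2) ((hint _ _).mul_const _) ?_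
      · push_cast; nlinarith
      · intro x hx
        exact mul_le_mul_of_nonneg_left (hanti p1 (p1.trans hx.1) hx.1) (h0 x)
    have e2 : ∫ x in ((n + 1 : ℕ) * T)..((n + 1 + 1 : ℕ) * T), h x * c =
        (∫ x in (0 : ℝ)..T, h x) * c := by
      rw [intervalIntegral.integral_mul_const]
      congr 1
      have h1 := hper.intervalIntegral_add_eq ((n + 1 : ℕ) * T) 0
      rw [zero_add] at h1
      rw [← h1]
      congr 1
      push_cast; ring
    have e3 : T * c ≤ ∫ x in (n * T)..((n + 1 : ℕ) * T), f x := by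
      have h1 : ∫ x in (n * T)..((n + 1 : ℕ) * T), c ≤ ∫ x in (n * T)..((n + 1 : ℕ) * T), f x := by
        refine intervalIntegral.integral_mono_on ?_ intervalIntegrable_const (hfi _ _ p0 p1) ?_
        · push_cast; nlinarith
        · intro x hx
          exact hanti (p0.trans hx.1) p1 hx.2
      rw [intervalIntegral.integral_const, smul_eq_mul] at h1
      refine le_trans (le_of_eq ?_) h1
      push_cast; ring
    rw [e2] at e1
    refine e1.trans ?_
    rw [div_mul_eq_mul_div, le_div_iff₀ hT]
    nlinarith

theorem integrableOn_sqrt_abs_tan_mul {s : ℝ} (hs : 1 < s) :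
    MeasureTheory.IntegrableOn (fun η => √|Real.tan η| * (η + 1) ^ (-s)) (Ioi 0) := by
  have hcont : ContinuousOn (fun η : ℝ => (η + 1) ^ (-s)) (Ici 0) := by
    refine ContinuousOn.rpow_const (by fun_prop) fun x hx => Or.inl ?_
    have : (0 : ℝ) ≤ x := hx
    positivity
  have hanti : AntitoneOn (fun η : ℝ => (η + 1) ^ (-s)) (Ici 0) := by
    intro x hx y hy hxy
    have : (0 : ℝ) ≤ x := hx
    exact Real.rpow_le_rpow_of_nonpos (by positivity) (by linarith) (by linarith)
  have hI : MeasureTheory.IntegrableOn (fun η : ℝ => (η + 1) ^ (-s)) (Ioi 0) :=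
    integrableOn_add_rpow_Ioi_of_lt (by linarith) (by norm_num)
  have hpi := Real.pi_pos
  have hloc : ∀ b : ℝ, 0 ≤ b → IntervalIntegrable (fun η => √|Real.tan η| * (η + 1) ^ (-s))
      MeasureTheory.volume 0 b := by
    intro b hb
    refine (intervalIntegrable_sqrt_abs_tan 0 b).mul_continuousOn (hcont.mono ?_)
    rw [uIcc_of_le hb]
    exact fun x hx => hx.1
  rw [← Ioc_union_Ioi_eq_Ioi hpi.le]
  refine MeasureTheory.IntegrableOn.union ?_ ?_
  · exact (intervalIntegrable_iff_integrableOn_Ioc_of_le hpi.le).1 (hloc _ hpi.le)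
  refine MeasureTheory.integrableOn_Ioi_of_intervalIntegral_norm_bounded (ι := ℕ) (l := atTop)
    (b := fun n => (n + 1 : ℕ) * Real.pi)
    ((∫ x in (0 : ℝ)..Real.pi, √|Real.tan x|) / Real.pi * ∫ x in Ioi (0 : ℝ), (x + 1) ^ (-s))
    Real.pi ?_ ?_ ?_
  · intro n
    have hn : (0 : ℝ) ≤ (n + 1 : ℕ) * Real.pi := by positivity
    refine ((intervalIntegrable_iff_integrableOn_Ioc_of_le hn).1 (hloc _ hn)).mono_set ?_
    exact Ioc_subset_Ioc_left hpi.le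
  · refine Tendsto.atTop_mul_const hpi ?_
    exact tendsto_natCast_atTop_atTop.comp (tendsto_add_atTop_nat 1)
  · refine Eventually.of_forall fun n => ?_
    have hle : Real.pi ≤ (n + 1 : ℕ) * Real.pi := by
      push_cast
      nlinarith [(Nat.cast_nonneg n : (0 : ℝ) ≤ n)]
    have e : ∫ x in Real.pi..((n + 1 : ℕ) * Real.pi), ‖√|Real.tan x| * (x + 1) ^ (-s)‖ =
        ∫ x in Real.pi..((n + 1 : ℕ) * Real.pi), √|Real.tan x| * (x + 1) ^ (-s) := by
      refine intervalIntegral.integral_congr fun x hx => ?_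
      rw [uIcc_of_le hle] at hx
      have : 0 ≤ x := hpi.le.trans hx.1
      exact Real.norm_of_nonneg (by positivity)
    rw [e]
    refine (integral_periodic_mul_antitone_le hpi periodic_sqrt_abs_tan
      (fun x => Real.sqrt_nonneg _) intervalIntegrable_sqrt_abs_tan hcont hanti n).trans ?_
    refine mul_le_mul_of_nonneg_left ?_ ?_
    · rw [intervalIntegral.integral_of_le (by positivity)]
      refine MeasureTheory.setIntegral_mono_set hI ?_ (Ioc_subset_Ioi_self.eventuallyLE)
      refine (MeasureTheory.ae_restrict_iff' measurableSet_Ioi).2 ?_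
      refine Eventually.of_forall fun x hx => ?_
      have : (0 : ℝ) < x := hx
      exact Real.rpow_nonneg (by linarith) _
    · refine div_nonneg (intervalIntegral.integral_nonneg hpi.le fun x _ => ?_) hpi.le
      exact Real.sqrt_nonneg _

/-- The weight contributes another $\eta^{-1/2}$, so the total decay exponent $1/2+\beta$ exceeds
$1$. Only $\eta>\pi/2$ matters, where $\eta\ge(\eta+1)/2$ allows the comparison with powers of
$\eta+1$. -/
theorem integrableOn_kernelWeight_mul_rpow {β : ℝ} (hβ : 1 / 2 < β) :
    MeasureTheory.IntegrableOn (fun η => kernelWeight η * η ^ (-β)) (Ioi 0) := by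
  have h := (integrableOn_sqrt_abs_tan_mul (s := 1 / 2 + β) (by linarith)).const_mul
    ((2 : ℝ) ^ (1 / 2 + β))
  refine MeasureTheory.Integrable.mono' h ?_ ?_
  · exact (measurable_kernelWeight.mul (measurable_id.pow_const _)).aestronglyMeasurable
  refine (MeasureTheory.ae_restrict_iff' measurableSet_Ioi).2 (Eventually.of_forall fun x hx => ?_)
  have hx0 : (0 : ℝ) < x := hx
  rw [Real.norm_of_nonneg (mul_nonneg (kernelWeight_nonneg _) (Real.rpow_nonneg hx0.le _))]
  rcases le_or_gt x (Real.pi / 2) with h1 | h1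
  · rw [kernelWeight_eq_zero hx0 h1, zero_mul]
    positivity
  have hx1 : 1 ≤ x := by linarith [Real.two_le_pi]
  calc kernelWeight x * x ^ (-β) ≤ (√|Real.tan x| * x ^ (-(1 / 2) : ℝ)) * x ^ (-β) :=
        mul_le_mul_of_nonneg_right (kernelWeight_le hx0) (Real.rpow_nonneg hx0.le _)
    _ = √|Real.tan x| * x ^ (-(1 / 2 + β)) := by
        rw [mul_assoc, ← Real.rpow_add hx0]
        congr 2
        ring
    _ ≤ √|Real.tan x| * (((x + 1) / 2) ^ (-(1 / 2 + β))) := by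
        refine mul_le_mul_of_nonneg_left ?_ (Real.sqrt_nonneg _)
        exact Real.rpow_le_rpow_of_nonpos (by linarith) (by linarith) (by linarith)
    _ = 2 ^ (1 / 2 + β) * (√|Real.tan x| * (x + 1) ^ (-(1 / 2 + β))) := by
        rw [Real.div_rpow (by linarith) (by norm_num), Real.rpow_neg (by norm_num : (0 : ℝ) ≤ 2),
          div_inv_eq_mul]
        ring

/-! ### The hyperbolic tangent and the symbol on the right half-plane -/

theorem sqrt_div_eq_rpow_mul_rpow {a b : ℝ} (ha : 0 ≤ a) (hb : 0 ≤ b) :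
    √(a / b) = a ^ (1 / 2 : ℝ) * b ^ (-(1 / 2) : ℝ) := by
  rw [Real.rpow_neg hb, ← Real.sqrt_eq_rpow, ← Real.sqrt_eq_rpow, Real.sqrt_div ha,
    div_eq_mul_inv]

theorem sinh_add_mul_I (x y : ℝ) : Complex.sinh (x + y * Complex.I) =
    ⟨Real.sinh x * Real.cos y, Real.cosh x * Real.sin y⟩ := by
  rw [Complex.sinh_add, Complex.sinh_mul_I, Complex.cosh_mul_I, ← Complex.ofReal_sinh,
    ← Complex.ofReal_cosh, ← Complex.ofReal_cos, ← Complex.ofReal_sin]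
  apply Complex.ext <;> simp [-Complex.ofReal_sinh, -Complex.ofReal_cosh, -Complex.ofReal_cos,
    -Complex.ofReal_sin]

theorem cosh_add_mul_I (x y : ℝ) : Complex.cosh (x + y * Complex.I) =
    ⟨Real.cosh x * Real.cos y, Real.sinh x * Real.sin y⟩ := by
  rw [Complex.cosh_add, Complex.sinh_mul_I, Complex.cosh_mul_I, ← Complex.ofReal_sinh,
    ← Complex.ofReal_cosh, ← Complex.ofReal_cos, ← Complex.ofReal_sin]
  apply Complex.ext <;> simp [-Complex.ofReal_sinh, -Complex.ofReal_cosh, -Complex.ofReal_cos,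
    -Complex.ofReal_sin]

theorem normSq_sinh_add_mul_I (x y : ℝ) :
    Complex.normSq (Complex.sinh (x + y * Complex.I)) = Real.sinh x ^ 2 + Real.sin y ^ 2 := by
  rw [sinh_add_mul_I, Complex.normSq_mk]
  nlinarith [Real.cosh_sq x, Real.sin_sq_add_cos_sq y]

theorem normSq_cosh_add_mul_I (x y : ℝ) :
    Complex.normSq (Complex.cosh (x + y * Complex.I)) = Real.sinh x ^ 2 + Real.cos y ^ 2 := by
  rw [cosh_add_mul_I, Complex.normSq_mk]
  nlinarith [Real.cosh_sq x, Real.sin_sq_add_cos_sq y]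

theorem cosh_ne_zero_of_re_pos {z : ℂ} (hz : 0 < z.re) : Complex.cosh z ≠ 0 := by
  rw [← Complex.normSq_pos, ← Complex.re_add_im z, normSq_cosh_add_mul_I]
  have := Real.sinh_pos_iff.2 hz
  positivity

/-- The real part of $\sinh z\,\overline{\cosh z}$ is $\sinh x\cosh x$ with $x=\operatorname{Re}z$.
This keeps $\tanh z$ off the cut of the principal square root. -/
theorem tanh_re_pos {z : ℂ} (hz : 0 < z.re) : 0 < (Complex.tanh z).re := by
  have h0 : 0 < Complex.normSq (Complex.cosh z) :=
    Complex.normSq_pos.2 (cosh_ne_zero_of_re_pos hz)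
  rw [Complex.tanh_eq_sinh_div_cosh, Complex.div_re, ← add_div]
  refine div_pos ?_ h0
  rw [← Complex.re_add_im z, sinh_add_mul_I, cosh_add_mul_I]
  have h1 := Real.sinh_pos_iff.2 hz
  have h2 := Real.cosh_pos z.re
  have e : Real.sinh z.re * Real.cos z.im * (Real.cosh z.re * Real.cos z.im) +
      Real.cosh z.re * Real.sin z.im * (Real.sinh z.re * Real.sin z.im) =
      Real.sinh z.re * Real.cosh z.re := by
    linear_combination Real.sinh z.re * Real.cosh z.re * Real.sin_sq_add_cos_sq z.im
  dsimp only
  rw [e]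
  positivity

theorem norm_tanh_le_of {x y c : ℝ} (hx : 0 < x) (hc : 0 ≤ c)
    (h : Real.sinh x ^ 2 + Real.sin y ^ 2 ≤ c ^ 2 * (Real.sinh x ^ 2 + Real.cos y ^ 2)) :
    ‖Complex.tanh (x + y * Complex.I)‖ ≤ c := by
  refine abs_le_of_sq_le_sq' ?_ hc |>.2
  rw [← Complex.normSq_eq_norm_sq, Complex.tanh_eq_sinh_div_cosh, Complex.normSq_div,
    normSq_sinh_add_mul_I, normSq_cosh_add_mul_I]
  have := Real.sinh_pos_iff.2 hx
  exact div_le_of_le_mul₀ (by positivity) (by positivity) h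

/-- Uniform in `x`: this supplies the dominating function as the left edge of the contour approaches
the imaginary axis. -/
theorem norm_tanh_le_one_add_abs_tan {x y : ℝ} (hx : 0 < x) (hy : Real.cos y ≠ 0) :
    ‖Complex.tanh (x + y * Complex.I)‖ ≤ 1 + |Real.tan y| := by
  refine norm_tanh_le_of hx (by positivity) ?_
  have h1 : Real.sin y ^ 2 = |Real.tan y| ^ 2 * Real.cos y ^ 2 := by
    rw [sq_abs, ← mul_pow, Real.tan_mul_cos hy]
  rw [h1]
  nlinarith [abs_nonneg (Real.tan y), mul_nonneg (abs_nonneg (Real.tan y)) (sq_nonneg (Real.sinh x)),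
    mul_nonneg (sq_nonneg (|Real.tan y|)) (sq_nonneg (Real.sinh x)),
    mul_nonneg (abs_nonneg (Real.tan y)) (sq_nonneg (Real.cos y)), sq_nonneg (Real.cos y)]

theorem norm_tanh_le_two {x : ℝ} (hx : 1 ≤ x) (y : ℝ) :
    ‖Complex.tanh (x + y * Complex.I)‖ ≤ 2 := by
  refine norm_tanh_le_of (by linarith) (by norm_num) ?_
  have h1 : 1 ≤ Real.sinh x := hx.trans (Real.self_le_sinh_iff.2 (by linarith))
  nlinarith [Real.sin_sq_add_cos_sq y, sq_nonneg (Real.cos y)]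

theorem norm_tanh_le_one_of_sin_eq_zero {x y : ℝ} (hx : 0 < x) (hy : Real.sin y = 0) :
    ‖Complex.tanh (x + y * Complex.I)‖ ≤ 1 := by
  refine norm_tanh_le_of hx zero_le_one ?_
  rw [hy]
  nlinarith [sq_nonneg (Real.cos y)]

/-- The holomorphic extension of `ξ ↦ m(ξ) exp (i x ξ)`, `ξ > 0`, to the right half-plane. -/
noncomputable def symbolExt (x : ℝ) (z : ℂ) : ℂ :=
  Complex.tanh z ^ ((1 / 2 : ℝ) : ℂ) * z ^ ((-(1 / 2) : ℝ) : ℂ) * Complex.exp (Complex.I * x * z)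

theorem norm_symbolExt (x : ℝ) (z : ℂ) : ‖symbolExt x z‖ =
    ‖Complex.tanh z‖ ^ (1 / 2 : ℝ) * ‖z‖ ^ (-(1 / 2) : ℝ) * Real.exp (-x * z.im) := by
  rw [symbolExt, norm_mul, norm_mul, Complex.norm_cpow_real, Complex.norm_cpow_real,
    Complex.norm_exp]
  congr 2
  simp

theorem differentiableAt_symbolExt (x : ℝ) {z : ℂ} (hc : Complex.cosh z ≠ 0)
    (ht : Complex.tanh z ∈ Complex.slitPlane) (hz : z ∈ Complex.slitPlane) :
    DifferentiableAt ℂ (symbolExt x) z := by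
  have h1 : DifferentiableAt ℂ Complex.tanh z := by
    have e : Complex.tanh = fun z => Complex.sinh z / Complex.cosh z :=
      funext Complex.tanh_eq_sinh_div_cosh
    rw [e]
    exact Complex.differentiable_sinh.differentiableAt.div
      Complex.differentiable_cosh.differentiableAt hc
  unfold symbolExt
  refine DifferentiableAt.mul (DifferentiableAt.mul (h1.cpow_const ht)
    (differentiableAt_id.cpow_const hz)) ?_
  fun_prop

theorem differentiableAt_symbolExt_of_re_pos (x : ℝ) {z : ℂ} (hz : 0 < z.re) :
    DifferentiableAt ℂ (symbolExt x) z :=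
  differentiableAt_symbolExt x (cosh_ne_zero_of_re_pos hz)
    (Complex.mem_slitPlane_iff.2 (Or.inl (tanh_re_pos hz)))
    (Complex.mem_slitPlane_iff.2 (Or.inl hz))

theorem symbolExt_ofReal (x : ℝ) {ξ : ℝ} (hξ : 0 < ξ) :
    symbolExt x ξ = (whithamSymbol ξ : ℂ) * Complex.exp (Complex.I * x * ξ) := by
  have ht : 0 < Real.tanh ξ := by
    rw [Real.tanh_eq_sinh_div_cosh]
    exact div_pos (Real.sinh_pos_iff.2 hξ) (Real.cosh_pos _)
  rw [symbolExt, ← Complex.ofReal_tanh, ← Complex.ofReal_cpow ht.le, ← Complex.ofReal_cpow hξ.le,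
    ← Complex.ofReal_mul, whithamSymbol, if_neg hξ.ne',
    sqrt_div_eq_rpow_mul_rpow ht.le hξ.le]

theorem tanh_ofReal_mul_I (η : ℝ) :
    Complex.tanh (η * Complex.I) = (Real.tan η : ℂ) * Complex.I := by
  rw [Complex.tanh_mul_I, Complex.ofReal_tan]

theorem continuousAt_symbolExt_mul_I (x : ℝ) {η : ℝ} (hη : 0 < η) (hc : Real.cos η ≠ 0)
    (hs : Real.sin η ≠ 0) : ContinuousAt (symbolExt x) (η * Complex.I) := by
  refine (differentiableAt_symbolExt x ?_ ?_ ?_).continuousAt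
  · rw [Complex.cosh_mul_I, ← Complex.ofReal_cos]
    exact_mod_cast hc
  · rw [tanh_ofReal_mul_I, Complex.mem_slitPlane_iff]
    right
    have ht0 : Real.tan η ≠ 0 := by
      rw [Real.tan_eq_sin_div_cos]
      exact div_ne_zero hs hc
    simpa [-Complex.ofReal_tan] using ht0
  · rw [Complex.mem_slitPlane_iff]
    right
    simpa using hη.ne'

/-- Here $\tanh(i\eta)=i\tan\eta$, and $(i\eta)^{-1/2}$ has phase $e^{-i\pi/4}$. If $\tan\eta<0$,
the principal root contributes another $e^{-i\pi/4}$; the product $-i$ cancels the prefactor $i$. If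
$\tan\eta>0$, the phases cancel, the expression is purely imaginary, and the weight vanishes as
well. -/
theorem re_I_mul_symbolExt_mul_I (x : ℝ) {η : ℝ} (hη : 0 < η) (hc : Real.cos η ≠ 0)
    (hs : Real.sin η ≠ 0) :
    (Complex.I * symbolExt x (η * Complex.I)).re = Real.exp (-x * η) * kernelWeight η := by
  have ht0 : Real.tan η ≠ 0 := by
    rw [Real.tan_eq_sin_div_cos]
    exact div_ne_zero hs hc
  have hexp : Complex.exp (Complex.I * x * (η * Complex.I)) = ((Real.exp (-x * η) : ℝ) : ℂ) := by
    rw [Complex.ofReal_exp]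
    congr 1
    push_cast
    linear_combination (x * η : ℂ) * Complex.I_mul_I
  have hη' : (η * Complex.I : ℂ) ^ ((-(1 / 2) : ℝ) : ℂ) =
      ((η ^ (-(1 / 2) : ℝ) : ℝ) : ℂ) * Complex.exp (-(Real.pi / 4) * Complex.I) := by
    rw [Complex.cpow_def_of_ne_zero (by simp [hη.ne']), Complex.log_ofReal_mul hη Complex.I_ne_zero,
      Complex.log_I, add_mul, Complex.exp_add, ← Complex.ofReal_mul, ← Complex.ofReal_exp,
      ← Real.rpow_def_of_pos hη]
    congr 2
    push_cast
    ring
  rw [symbolExt, hexp, hη', tanh_ofReal_mul_I]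
  rcases lt_or_gt_of_ne ht0 with ht | ht
  · have e : ((Real.tan η : ℂ) * Complex.I) = ((-Real.tan η : ℝ) : ℂ) * (-Complex.I) := by
      push_cast; ring
    have ht' : 0 < -Real.tan η := by linarith
    rw [e, Complex.cpow_def_of_ne_zero (by simp [-Complex.ofReal_tan, ht0]),
      Complex.log_ofReal_mul ht' (by simp), Complex.log_neg_I, add_mul, Complex.exp_add,
      ← Complex.ofReal_mul, ← Complex.ofReal_exp, ← Real.rpow_def_of_pos ht']
    have e2 : Complex.exp (-(Real.pi / 2) * Complex.I * ((1 / 2 : ℝ) : ℂ)) *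
        Complex.exp (-(Real.pi / 4) * Complex.I) = -Complex.I := by
      rw [← Complex.exp_add]
      have : (-(Real.pi / 2) * Complex.I * ((1 / 2 : ℝ) : ℂ) + -(Real.pi / 4) * Complex.I : ℂ) =
          Complex.log (-Complex.I) := by
        rw [Complex.log_neg_I]; push_cast; ring
      rw [this, Complex.exp_log (by simp)]
    have e3 : Complex.I * (((-Real.tan η) ^ (1 / 2 : ℝ) : ℝ) *
        Complex.exp (-(Real.pi / 2) * Complex.I * ((1 / 2 : ℝ) : ℂ)) *
        (((η ^ (-(1 / 2) : ℝ) : ℝ) : ℂ) * Complex.exp (-(Real.pi / 4) * Complex.I)) *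
        ((Real.exp (-x * η) : ℝ) : ℂ)) =
        (((Real.exp (-x * η)) * ((-Real.tan η) ^ (1 / 2 : ℝ) * η ^ (-(1 / 2) : ℝ)) : ℝ) : ℂ) := by
      simp only [Complex.ofReal_mul]
      linear_combination (Complex.I * ((((-Real.tan η) ^ (1 / 2 : ℝ) : ℝ) : ℂ)) *
        (((η ^ (-(1 / 2) : ℝ) : ℝ) : ℂ)) * (((Real.exp (-x * η) : ℝ) : ℂ))) * e2 -
        (((((-Real.tan η) ^ (1 / 2 : ℝ) : ℝ) : ℂ)) * (((η ^ (-(1 / 2) : ℝ) : ℝ) : ℂ)) *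
        (((Real.exp (-x * η) : ℝ) : ℂ))) * Complex.I_mul_I
    rw [e3, Complex.ofReal_re, kernelWeight, sqrt_div_eq_rpow_mul_rpow ht'.le hη.le]
  · rw [Complex.cpow_def_of_ne_zero (by simp [-Complex.ofReal_tan, ht0]),
      Complex.log_ofReal_mul ht (by simp), Complex.log_I, add_mul, Complex.exp_add,
      ← Complex.ofReal_mul, ← Complex.ofReal_exp, ← Real.rpow_def_of_pos ht]
    have hq : kernelWeight η = 0 := by
      refine Real.sqrt_eq_zero_of_nonpos (div_nonpos_of_nonpos_of_nonneg (by linarith) hη.le)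
    have e2 : Complex.exp (Real.pi / 2 * Complex.I * ((1 / 2 : ℝ) : ℂ)) *
        Complex.exp (-(Real.pi / 4) * Complex.I) = 1 := by
      rw [← Complex.exp_add]
      have : (Real.pi / 2 * Complex.I * ((1 / 2 : ℝ) : ℂ) + -(Real.pi / 4) * Complex.I : ℂ) = 0 := by
        push_cast; ring
      rw [this, Complex.exp_zero]
    have e3 : Complex.I * (((Real.tan η) ^ (1 / 2 : ℝ) : ℝ) *
        Complex.exp (Real.pi / 2 * Complex.I * ((1 / 2 : ℝ) : ℂ)) *
        (((η ^ (-(1 / 2) : ℝ) : ℝ) : ℂ) * Complex.exp (-(Real.pi / 4) * Complex.I)) *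
        ((Real.exp (-x * η) : ℝ) : ℂ)) =
        (((Real.exp (-x * η)) * ((Real.tan η) ^ (1 / 2 : ℝ) * η ^ (-(1 / 2) : ℝ)) : ℝ) : ℂ) *
          Complex.I := by
      simp only [Complex.ofReal_mul]
      linear_combination (Complex.I * ((((Real.tan η) ^ (1 / 2 : ℝ) : ℝ) : ℂ)) *
        (((η ^ (-(1 / 2) : ℝ) : ℝ) : ℂ)) * (((Real.exp (-x * η) : ℝ) : ℂ))) * e2
    rw [e3, Complex.re_ofReal_mul, hq]
    simp

/-! ### Rotation of the contour onto the imaginary axis -/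

theorem measurable_whithamSymbol : Measurable whithamSymbol := by
  have e : Real.tanh = fun x => Real.sinh x / Real.cosh x := funext Real.tanh_eq_sinh_div_cosh
  refine Measurable.ite (measurableSet_singleton 0) measurable_const ?_
  rw [e]
  exact ((Real.measurable_sinh.div Real.measurable_cosh).div measurable_id).sqrt

theorem whithamSymbol_neg (ξ : ℝ) : whithamSymbol (-ξ) = whithamSymbol ξ := by
  simp [whithamSymbol, Real.tanh_neg, neg_div_neg_eq]

theorem whithamSymbol_le_one {ξ : ℝ} (hξ : 0 ≤ ξ) : whithamSymbol ξ ≤ 1 := by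
  rcases hξ.eq_or_lt with h | h
  · rw [← h, whithamSymbol, if_pos rfl]
  rw [whithamSymbol, if_neg h.ne']
  refine Real.sqrt_le_one.2 ?_
  rw [div_le_one h, Real.tanh_eq_sinh_div_cosh, div_le_iff₀ (Real.cosh_pos _)]
  -- $\tanh\xi\le\xi$ amounts to $\xi\cosh\xi-\sinh\xi\ge0$; this function vanishes at $0$ and has
  -- derivative $\xi\sinh\xi$.
  have hmono : MonotoneOn (fun y : ℝ => y * Real.cosh y - Real.sinh y) (Ici 0) := by
    refine monotoneOn_of_deriv_nonneg (convex_Ici 0) (by fun_prop) (by fun_prop) ?_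
    intro y hy
    rw [interior_Ici] at hy
    have hd : HasDerivAt (fun y : ℝ => y * Real.cosh y - Real.sinh y)
        (1 * Real.cosh y + y * Real.sinh y - Real.cosh y) y :=
      ((hasDerivAt_id y).mul (Real.hasDerivAt_cosh y)).sub (Real.hasDerivAt_sinh y)
    rw [hd.deriv]
    have := Real.sinh_pos_iff.2 hy
    have : (0 : ℝ) < y := hy
    nlinarith [mul_pos this ‹0 < Real.sinh y›]
  have := hmono self_mem_Ici hξ hξ
  simp at this
  linarith

theorem norm_symbol_mul_exp_le (x : ℝ) {ξ : ℝ} (hξ : 0 ≤ ξ) :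
    ‖(whithamSymbol ξ : ℂ) * Complex.exp (Complex.I * x * ξ)‖ ≤ 1 := by
  have e : Complex.I * x * ξ = ((x * ξ : ℝ) : ℂ) * Complex.I := by push_cast; ring
  rw [norm_mul, e, Complex.norm_exp_ofReal_mul_I, mul_one, Complex.norm_real, Real.norm_of_nonneg]
  · exact whithamSymbol_le_one hξ
  · rw [whithamSymbol]
    split_ifs
    · exact zero_le_one
    · exact Real.sqrt_nonneg _

theorem integrableOn_symbol_mul_exp (x : ℝ) {R : ℝ} (hR : 0 ≤ R) :
    IntervalIntegrable (fun ξ : ℝ => (whithamSymbol ξ : ℂ) * Complex.exp (Complex.I * x * ξ))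
      MeasureTheory.volume 0 R := by
  rw [intervalIntegrable_iff_integrableOn_Ioc_of_le hR]
  refine MeasureTheory.Measure.integrableOn_of_bounded (M := 1) (by simp) ?_ ?_
  · refine (Measurable.mul (Complex.measurable_ofReal.comp measurable_whithamSymbol)
      (Continuous.measurable ?_)).aestronglyMeasurable
    fun_prop
  · refine (MeasureTheory.ae_restrict_iff' measurableSet_Ioc).2 (Eventually.of_forall ?_)
    exact fun ξ hξ => norm_symbol_mul_exp_le x hξ.1.le

theorem tendsto_integral_symbolExt_horizontal (x : ℝ) {R : ℝ} (hR : 0 < R) :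
    Tendsto (fun δ : ℝ => ∫ ξ in δ..R, symbolExt x ξ) (𝓝[>] 0)
      (𝓝 (∫ ξ in (0 : ℝ)..R, (whithamSymbol ξ : ℂ) * Complex.exp (Complex.I * x * ξ))) := by
  have hi := integrableOn_symbol_mul_exp x hR.le
  have hc := intervalIntegral.continuousOn_primitive_interval_left
    ((intervalIntegrable_iff' (by exact enorm_ne_top)).1 hi)
  have h0 := (hc 0 left_mem_uIcc).mono_left (nhdsWithin_mono 0 (s := Ioc 0 R) (by
    rw [uIcc_of_le hR.le]; exact Ioc_subset_Icc_self))
  rw [nhdsWithin_Ioc_eq_nhdsGT hR] at h0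
  refine h0.congr' ?_
  filter_upwards [Ioo_mem_nhdsGT hR] with δ hδ
  refine intervalIntegral.integral_congr fun ξ hξ => ?_
  rw [uIcc_of_le hδ.2.le] at hξ
  exact (symbolExt_ofReal x (hδ.1.trans_le hξ.1)).symm

/-- The two singular factors never meet: on $[0,1]$ the tangent is continuous, and beyond $1$ the
power is. -/
theorem intervalIntegrable_boundary_bound {b : ℝ} (hb : 0 ≤ b) :
    IntervalIntegrable (fun η : ℝ => (1 + √|Real.tan η|) * η ^ (-(1 / 2) : ℝ))
      MeasureTheory.volume 0 b := by
  have h1 : IntervalIntegrable (fun η : ℝ => (1 + √|Real.tan η|) * η ^ (-(1 / 2) : ℝ))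
      MeasureTheory.volume 0 1 := by
    refine IntervalIntegrable.continuousOn_mul
      (intervalIntegral.intervalIntegrable_rpow' (by norm_num)) ?_
    refine continuousOn_const.add (ContinuousOn.sqrt (ContinuousOn.abs ?_))
    refine Real.continuousOn_tan_Ioo.mono fun y hy => ?_
    rw [uIcc_of_le zero_le_one] at hy
    have := Real.pi_gt_three
    exact ⟨by linarith [hy.1], by linarith [hy.2]⟩
  refine h1.trans (b := 1) (c := max b 1) ?_ |>.mono_set ?_
  · refine IntervalIntegrable.mul_continuousOn
      (intervalIntegrable_const.add (intervalIntegrable_sqrt_abs_tan _ _)) ?_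
    refine ContinuousOn.rpow_const continuousOn_id fun y hy => Or.inl ?_
    rw [uIcc_of_le (le_max_right _ _)] at hy
    have : 1 ≤ y := hy.1
    exact (by linarith : (0 : ℝ) < y).ne'
  · rw [uIcc_of_le hb, uIcc_of_le (hb.trans (le_max_left _ _))]
    exact Icc_subset_Icc_right (le_max_left _ _)

theorem ae_cos_sin_ne_zero : ∀ᵐ η : ℝ, Real.cos η ≠ 0 ∧ Real.sin η ≠ 0 := by
  have hc : (range fun n : ℤ => (n : ℝ) * Real.pi / 2).Countable := countable_range _
  filter_upwards [hc.ae_notMem MeasureTheory.volume] with η hη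
  have h2 : Real.sin (2 * η) ≠ 0 := by
    intro h
    obtain ⟨n, hn⟩ := Real.sin_eq_zero_iff.1 h
    exact hη ⟨n, by simp only; linarith⟩
  rw [Real.sin_two_mul] at h2
  exact ⟨right_ne_zero_of_mul h2, right_ne_zero_of_mul (left_ne_zero_of_mul h2)⟩

theorem norm_symbolExt_vertical_le {x δ η : ℝ} (hx : 0 ≤ x) (hδ : 0 < δ) (hη : 0 < η)
    (hc : Real.cos η ≠ 0) :
    ‖symbolExt x (δ + η * Complex.I)‖ ≤ (1 + √|Real.tan η|) * η ^ (-(1 / 2) : ℝ) := by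
  have him : (δ + η * Complex.I : ℂ).im = η := by simp
  rw [norm_symbolExt, him]
  have hz : η ≤ ‖(δ + η * Complex.I : ℂ)‖ := by
    have := Complex.abs_im_le_norm (δ + η * Complex.I : ℂ)
    rw [him] at this
    exact (le_abs_self η).trans this
  have h1 : ‖Complex.tanh (δ + η * Complex.I)‖ ^ (1 / 2 : ℝ) ≤ 1 + √|Real.tan η| := by
    rw [← Real.sqrt_eq_rpow]
    refine Real.sqrt_le_iff.2 ⟨by positivity, (norm_tanh_le_one_add_abs_tan hδ hc).trans ?_⟩
    nlinarith [Real.sq_sqrt (abs_nonneg (Real.tan η)), Real.sqrt_nonneg |Real.tan η|]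
  have h2 : ‖(δ + η * Complex.I : ℂ)‖ ^ (-(1 / 2) : ℝ) ≤ η ^ (-(1 / 2) : ℝ) :=
    Real.rpow_le_rpow_of_nonpos hη hz (by norm_num)
  have h3 : Real.exp (-x * η) ≤ 1 := Real.exp_le_one_iff.2 (by nlinarith)
  calc _ ≤ ((1 + √|Real.tan η|) * η ^ (-(1 / 2) : ℝ)) * 1 := by gcongr
    _ = _ := mul_one _

theorem continuous_symbolExt_vertical (x : ℝ) {δ : ℝ} (hδ : 0 < δ) :
    Continuous fun η : ℝ => symbolExt x (δ + η * Complex.I) := by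
  refine continuous_iff_continuousAt.2 fun η => ?_
  refine ContinuousAt.comp (f := fun η : ℝ => (δ + η * Complex.I : ℂ))
    (differentiableAt_symbolExt_of_re_pos x ?_).continuousAt (by fun_prop)
  simpa using hδ

theorem tendsto_integral_symbolExt_vertical {x b : ℝ} (hx : 0 ≤ x) (hb : 0 ≤ b) :
    Tendsto (fun δ : ℝ => ∫ η in (0 : ℝ)..b, symbolExt x (δ + η * Complex.I)) (𝓝[>] 0)
      (𝓝 (∫ η in (0 : ℝ)..b, symbolExt x (η * Complex.I))) := by
  refine intervalIntegral.tendsto_integral_filter_of_dominated_convergence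
    (fun η => (1 + √|Real.tan η|) * η ^ (-(1 / 2) : ℝ)) ?_ ?_
    (intervalIntegrable_boundary_bound hb) ?_
  · filter_upwards [self_mem_nhdsWithin] with δ hδ
    exact (continuous_symbolExt_vertical x hδ).aestronglyMeasurable
  · filter_upwards [self_mem_nhdsWithin] with δ hδ
    filter_upwards [ae_cos_sin_ne_zero] with η hη hη0
    rw [uIoc_of_le hb] at hη0
    exact norm_symbolExt_vertical_le hx hδ hη0.1 hη.1
  · filter_upwards [ae_cos_sin_ne_zero] with η hη hη0
    rw [uIoc_of_le hb] at hη0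
    have hc := continuousAt_symbolExt_mul_I x hη0.1 hη.1 hη.2
    have hlim : Tendsto (fun δ : ℝ => (δ + η * Complex.I : ℂ)) (𝓝[>] 0) (𝓝 (η * Complex.I)) := by
      have : Continuous (fun δ : ℝ => (δ + η * Complex.I : ℂ)) := by fun_prop
      have h := (this.tendsto 0).mono_left (nhdsWithin_le_nhds (s := Ioi 0))
      simpa using h
    exact hc.tendsto.comp hlim

theorem measurable_symbolExt (x : ℝ) : Measurable (symbolExt x) := by
  have e : Complex.tanh = fun z => Complex.sinh z / Complex.cosh z :=
    funext Complex.tanh_eq_sinh_div_cosh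
  unfold symbolExt
  rw [e]
  refine Measurable.mul (Measurable.mul (Measurable.pow_const ?_ _)
    (measurable_id.pow_const _)) (Continuous.measurable (by fun_prop))
  exact Complex.measurable_sinh.div Complex.measurable_cosh

theorem intervalIntegrable_symbolExt_mul_I {x b : ℝ} (hx : 0 ≤ x) (hb : 0 ≤ b) :
    IntervalIntegrable (fun η : ℝ => symbolExt x (η * Complex.I)) MeasureTheory.volume 0 b := by
  refine (intervalIntegrable_boundary_bound hb).mono_fun ?_ ?_
  · refine ((measurable_symbolExt x).comp (Continuous.measurable ?_)).aestronglyMeasurable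
    fun_prop
  refine (MeasureTheory.ae_restrict_iff' measurableSet_uIoc).2 ?_
  filter_upwards [ae_cos_sin_ne_zero] with η hη hη0
  rw [uIoc_of_le hb] at hη0
  have hc := continuousAt_symbolExt_mul_I x hη0.1 hη.1 hη.2
  have hlim : Tendsto (fun δ : ℝ => (δ + η * Complex.I : ℂ)) (𝓝[>] 0) (𝓝 (η * Complex.I)) := by
    have : Continuous (fun δ : ℝ => (δ + η * Complex.I : ℂ)) := by fun_prop
    have h := (this.tendsto 0).mono_left (nhdsWithin_le_nhds (s := Ioi 0))
    simpa using h
  -- The bound on the axis is the limit of the uniform bounds on nearby vertical lines.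
  refine le_trans (le_of_tendsto (hc.tendsto.comp hlim).norm ?_) (le_abs_self _)
  filter_upwards [self_mem_nhdsWithin] with δ hδ
  exact norm_symbolExt_vertical_le hx hδ hη0.1 hη.1

theorem re_I_mul_integral_symbolExt {x b : ℝ} (hx : 0 ≤ x) (hb : 0 ≤ b) :
    (Complex.I • ∫ η in (0 : ℝ)..b, symbolExt x (η * Complex.I)).re =
      ∫ η in (0 : ℝ)..b, Real.exp (-x * η) * kernelWeight η := by
  rw [← intervalIntegral.integral_smul]
  have h := Complex.reCLM.intervalIntegral_comp_comm
    ((intervalIntegrable_symbolExt_mul_I hx hb).smul Complex.I)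
  simp only [Complex.reCLM_apply, Pi.smul_apply] at h
  rw [← h]
  refine intervalIntegral.integral_congr_ae ?_
  filter_upwards [ae_cos_sin_ne_zero] with η hη hη0
  rw [uIoc_of_le hb] at hη0
  rw [smul_eq_mul]
  exact re_I_mul_symbolExt_mul_I x hη0.1 hη.1 hη.2

/-- At heights $n\pi$ the sine vanishes, so $|\tanh|\le1$ along the whole edge and no pole is close.
For $x>0$ and fixed `R` the edge disappears as $n\to\infty$. -/
theorem norm_integral_symbolExt_top_le {x δ R : ℝ} (hδ : 0 < δ) (hR : δ ≤ R) {n : ℕ}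
    (hn : 1 ≤ n) :
    ‖∫ ξ in δ..R, symbolExt x (ξ + ((n * Real.pi : ℝ) : ℂ) * Complex.I)‖ ≤
      Real.exp (-x * (n * Real.pi)) * R := by
  have hnpi : 1 ≤ n * Real.pi := by
    have h1 : (1 : ℝ) ≤ n := by exact_mod_cast hn
    nlinarith [Real.pi_gt_three]
  have h := intervalIntegral.norm_integral_le_of_norm_le_const (a := δ) (b := R)
    (f := fun ξ : ℝ => symbolExt x (ξ + ((n * Real.pi : ℝ) : ℂ) * Complex.I))
    (C := Real.exp (-x * (n * Real.pi))) ?_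
  · refine h.trans (mul_le_mul_of_nonneg_left ?_ (Real.exp_nonneg _))
    rw [abs_of_nonneg (by linarith)]
    linarith
  intro ξ hξ
  rw [uIoc_of_le hR] at hξ
  have hξ0 : 0 < ξ := hδ.trans hξ.1
  have him : ((ξ + ((n * Real.pi : ℝ) : ℂ) * Complex.I : ℂ)).im = n * Real.pi := by simp
  rw [norm_symbolExt, him]
  have h1 := norm_tanh_le_one_of_sin_eq_zero hξ0 (Real.sin_nat_mul_pi n)
  have h2 : 1 ≤ ‖(ξ + ((n * Real.pi : ℝ) : ℂ) * Complex.I : ℂ)‖ := by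
    have := Complex.abs_im_le_norm (ξ + ((n * Real.pi : ℝ) : ℂ) * Complex.I : ℂ)
    rw [him] at this
    exact hnpi.trans ((le_abs_self _).trans this)
  have h3 := Real.rpow_le_one (norm_nonneg _) h1 (by norm_num : (0 : ℝ) ≤ 1 / 2)
  have h4 := Real.rpow_le_one_of_one_le_of_nonpos h2 (by norm_num : (-(1 / 2) : ℝ) ≤ 0)
  calc _ ≤ 1 * 1 * Real.exp (-x * (n * Real.pi)) := by gcongr
    _ = _ := by ring

theorem integral_exp_neg_mul {c : ℝ} (hc : c ≠ 0) (a b : ℝ) :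
    ∫ y in a..b, Real.exp (-c * y) = (Real.exp (-c * a) - Real.exp (-c * b)) / c := by
  rw [intervalIntegral.integral_comp_mul_left (fun y => Real.exp y) (neg_ne_zero.2 hc),
    integral_exp, smul_eq_mul]
  field_simp
  ring

/-- The factor $R^{-1/2}$ comes from $|z|^{-1/2}$, and $e^{-x\eta}$ has total mass at most $1/x$.
The bound does not depend on the height `b`, so the height can be sent to infinity before `R`. -/
theorem norm_integral_symbolExt_right_le {x R b : ℝ} (hx : 0 < x) (hR : 1 ≤ R) (hb : 0 ≤ b) :
    ‖∫ η in (0 : ℝ)..b, symbolExt x (R + η * Complex.I)‖ ≤ 2 / x * R ^ (-(1 / 2) : ℝ) := by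
  have hR0 : 0 < R := by linarith
  have hcont : Continuous fun η : ℝ => 2 * R ^ (-(1 / 2) : ℝ) * Real.exp (-x * η) := by fun_prop
  have h := intervalIntegral.norm_integral_le_of_norm_le (a := 0) (b := b)
    (f := fun η : ℝ => symbolExt x (R + η * Complex.I)) (μ := MeasureTheory.volume)
    (g := fun η => 2 * R ^ (-(1 / 2) : ℝ) * Real.exp (-x * η)) hb
    (Eventually.of_forall fun η hη => ?_) (hcont.intervalIntegrable _ _)
  · refine h.trans ?_
    rw [intervalIntegral.integral_const_mul, integral_exp_neg_mul hx.ne', mul_zero,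
      Real.exp_zero]
    have h1 := Real.exp_nonneg (-x * b)
    have h2 : (1 - Real.exp (-x * b)) / x ≤ 1 / x := by gcongr; linarith
    calc _ ≤ 2 * R ^ (-(1 / 2) : ℝ) * (1 / x) := by gcongr
      _ = _ := by ring
  · have him : (R + η * Complex.I : ℂ).im = η := by simp
    rw [norm_symbolExt, him]
    have hz : R ≤ ‖(R + η * Complex.I : ℂ)‖ := by
      have := Complex.abs_re_le_norm (R + η * Complex.I : ℂ)
      have hre : (R + η * Complex.I : ℂ).re = R := by simp
      rw [hre] at this
      exact (le_abs_self R).trans this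
    have h1 : ‖Complex.tanh (R + η * Complex.I)‖ ^ (1 / 2 : ℝ) ≤ 2 := by
      have ha : ‖Complex.tanh (R + η * Complex.I)‖ ^ (1 / 2 : ℝ) ≤ 2 ^ (1 / 2 : ℝ) :=
        Real.rpow_le_rpow (norm_nonneg _) (norm_tanh_le_two hR η) (by norm_num)
      have hb : (2 : ℝ) ^ (1 / 2 : ℝ) ≤ 2 ^ (1 : ℝ) :=
        Real.rpow_le_rpow_of_exponent_le (by norm_num) (by norm_num)
      rw [Real.rpow_one] at hb
      exact ha.trans hb
    have h2 : ‖(R + η * Complex.I : ℂ)‖ ^ (-(1 / 2) : ℝ) ≤ R ^ (-(1 / 2) : ℝ) :=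
      Real.rpow_le_rpow_of_nonpos hR0 hz (by norm_num)
    gcongr

theorem abs_re_integral_symbol_sub_le {x R : ℝ} (hx : 0 < x) (hR : 1 ≤ R) {n : ℕ} (hn : 1 ≤ n) :
    |(∫ ξ in (0 : ℝ)..R, (whithamSymbol ξ : ℂ) * Complex.exp (Complex.I * x * ξ)).re -
      ∫ η in (0 : ℝ)..(n * Real.pi), Real.exp (-x * η) * kernelWeight η| ≤
      Real.exp (-x * (n * Real.pi)) * R + 2 / x * R ^ (-(1 / 2) : ℝ) := by
  have hb : 0 ≤ n * Real.pi := by positivity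
  have hR0 : 0 < R := by linarith
  have h1 := (Complex.continuous_re.tendsto _).comp (tendsto_integral_symbolExt_horizontal x hR0)
  have h2 := (Complex.continuous_re.tendsto _).comp
    ((tendsto_integral_symbolExt_vertical hx.le hb).const_smul Complex.I)
  rw [re_I_mul_integral_symbolExt hx.le hb] at h2
  refine le_of_tendsto (h1.sub h2).abs ?_
  filter_upwards [Ioo_mem_nhdsGT hR0] with δ hδ
  -- Cauchy's theorem on $[\delta,R]\times[0,n\pi]$, which avoids the singularities on the imaginary
  -- axis; afterwards $\delta\to0$.
  have hcauchy := Complex.integral_boundary_rect_eq_zero_of_differentiableOn (symbolExt x) δ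
    (R + ((n * Real.pi : ℝ) : ℂ) * Complex.I) ?_
  · simp only [Complex.ofReal_re, Complex.ofReal_im, Complex.add_re, Complex.add_im,
      Complex.re_ofReal_mul, Complex.im_ofReal_mul, Complex.I_re, Complex.I_im, mul_zero, mul_one,
      add_zero, zero_add, Complex.ofReal_zero, zero_mul] at hcauchy
    have ht := norm_integral_symbolExt_top_le (x := x) hδ.1 hδ.2.le hn
    have hr := norm_integral_symbolExt_right_le hx hR hb
    have e : (∫ ξ in δ..R, symbolExt x ξ) -
        Complex.I • ∫ η in (0 : ℝ)..(n * Real.pi), symbolExt x (δ + η * Complex.I) =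
        (∫ ξ in δ..R, symbolExt x (ξ + ((n * Real.pi : ℝ) : ℂ) * Complex.I)) -
        Complex.I • ∫ η in (0 : ℝ)..(n * Real.pi), symbolExt x (R + η * Complex.I) := by
      linear_combination hcauchy
    simp only [Function.comp_apply]
    rw [← Complex.sub_re, e]
    refine (Complex.abs_re_le_norm _).trans ((norm_sub_le _ _).trans (add_le_add ht ?_))
    rw [norm_smul, Complex.norm_I, one_mul]
    exact hr
  · intro z hz
    refine (differentiableAt_symbolExt_of_re_pos x ?_).differentiableWithinAt
    have := hz.1
    simp only [Complex.ofReal_re, Complex.add_re, Complex.re_ofReal_mul, Complex.I_re, mul_zero,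
      add_zero] at this
    rw [mem_preimage, uIcc_of_le hδ.2.le] at this
    exact hδ.1.trans_le this.1

theorem integrableOn_exp_mul_kernelWeight {x : ℝ} (hx : 0 < x) :
    MeasureTheory.IntegrableOn (fun η => Real.exp (-x * η) * kernelWeight η) (Ioi 0) := by
  have h := (integrableOn_kernelWeight_mul_rpow (β := 1) (by norm_num)).const_mul (1 / x)
  refine MeasureTheory.Integrable.mono' h ?_ ?_
  · exact ((Continuous.measurable (by fun_prop)).mul measurable_kernelWeight).aestronglyMeasurable
  refine (MeasureTheory.ae_restrict_iff' measurableSet_Ioi).2 (Eventually.of_forall fun η hη => ?_)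
  have hη0 : (0 : ℝ) < η := hη
  rw [Real.norm_of_nonneg (mul_nonneg (Real.exp_nonneg _) (kernelWeight_nonneg _)), Real.rpow_neg_one]
  have h1 : Real.exp (-x * η) ≤ 1 / x * η⁻¹ := by
    have h2 := Real.add_one_le_exp (x * η)
    have hp : 0 < x * η := by positivity
    rw [neg_mul, Real.exp_neg, one_div, ← mul_inv]
    exact inv_anti₀ hp (by linarith)
  calc _ ≤ (1 / x * η⁻¹) * kernelWeight η :=
        mul_le_mul_of_nonneg_right h1 (kernelWeight_nonneg _)
    _ = _ := by ring

theorem abs_re_integral_symbol_sub_Ioi_le {x R : ℝ} (hx : 0 < x) (hR : 1 ≤ R) :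
    |(∫ ξ in (0 : ℝ)..R, (whithamSymbol ξ : ℂ) * Complex.exp (Complex.I * x * ξ)).re -
      ∫ η in Ioi (0 : ℝ), Real.exp (-x * η) * kernelWeight η| ≤ 2 / x * R ^ (-(1 / 2) : ℝ) := by
  have hn : Tendsto (fun n : ℕ => (n : ℝ) * Real.pi) atTop atTop :=
    tendsto_natCast_atTop_atTop.atTop_mul_const Real.pi_pos
  have h1 := MeasureTheory.intervalIntegral_tendsto_integral_Ioi 0
    (integrableOn_exp_mul_kernelWeight hx) hn
  have h2 : Tendsto (fun n : ℕ => Real.exp (-x * (n * Real.pi)) * R + 2 / x * R ^ (-(1 / 2) : ℝ))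
      atTop (𝓝 (0 * R + 2 / x * R ^ (-(1 / 2) : ℝ))) := by
    refine Tendsto.add_const _ (Tendsto.mul_const _ ?_)
    refine Real.tendsto_exp_atBot.comp ?_
    exact hn.const_mul_atTop_of_neg (by linarith)
  rw [zero_mul, zero_add] at h2
  refine le_of_tendsto_of_tendsto (h1.const_sub _).abs h2 ?_
  filter_upwards [eventually_ge_atTop 1] with n hn
  exact abs_re_integral_symbol_sub_le hx hR hn

theorem integral_symbol_symm (x : ℝ) {R : ℝ} (hR : 0 ≤ R) :
    ∫ ξ in (-R)..R, (whithamSymbol ξ : ℂ) * Complex.exp (Complex.I * x * ξ) =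
      ((2 * (∫ ξ in (0 : ℝ)..R,
        (whithamSymbol ξ : ℂ) * Complex.exp (Complex.I * x * ξ)).re : ℝ) : ℂ) := by
  set F : ℝ → ℂ := fun ξ => (whithamSymbol ξ : ℂ) * Complex.exp (Complex.I * x * ξ) with hF
  have hi : IntervalIntegrable F MeasureTheory.volume 0 R := integrableOn_symbol_mul_exp x hR
  have hneg : ∀ ξ, F (-ξ) = (starRingEnd ℂ) (F ξ) := by
    intro ξ
    simp only [hF, whithamSymbol_neg, map_mul, Complex.conj_ofReal, ← Complex.exp_conj,
      Complex.conj_I]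
    congr 2
    push_cast
    ring
  have hi' : IntervalIntegrable F MeasureTheory.volume (-R) 0 := by
    have h := (hi.comp_sub_left 0).symm
    simp only [zero_sub, sub_zero] at h
    refine h.mono_fun ?_ (Eventually.of_forall fun ξ => ?_)
    · refine (Measurable.mul (Complex.measurable_ofReal.comp measurable_whithamSymbol)
        (Continuous.measurable ?_)).aestronglyMeasurable
      fun_prop
    · beta_reduce
      rw [hneg, RCLike.norm_conj]
  have e : ∫ ξ in (-R)..0, F ξ = (starRingEnd ℂ) (∫ ξ in (0 : ℝ)..R, F ξ) := by
    have h := intervalIntegral.integral_comp_neg (a := 0) (b := R) F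
    rw [neg_zero] at h
    rw [← h, intervalIntegral.integral_of_le hR, intervalIntegral.integral_of_le hR,
      ← integral_conj]
    simp only [hneg]
  rw [← intervalIntegral.integral_add_adjacent_intervals hi' hi, e, add_comm, Complex.add_conj]

/-- The Whitham kernel is a mixture of decaying exponentials. -/
theorem whithamKernel_of_pos {x : ℝ} (hx : 0 < x) : whithamKernel x =
    1 / Real.pi * ∫ η in Ioi (0 : ℝ), Real.exp (-x * η) * kernelWeight η := by
  set A := ∫ η in Ioi (0 : ℝ), Real.exp (-x * η) * kernelWeight η with hA
  have h1 : Tendsto (fun R : ℝ => (∫ ξ in (0 : ℝ)..R,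
      (whithamSymbol ξ : ℂ) * Complex.exp (Complex.I * x * ξ)).re) atTop (𝓝 A) := by
    rw [tendsto_iff_norm_sub_tendsto_zero]
    have h2 : Tendsto (fun R : ℝ => 2 / x * R ^ (-(1 / 2) : ℝ)) atTop (𝓝 (2 / x * 0)) :=
      (tendsto_rpow_neg_atTop (by norm_num)).const_mul _
    rw [mul_zero] at h2
    refine squeeze_zero' (Eventually.of_forall fun _ => norm_nonneg _) ?_ h2
    filter_upwards [eventually_ge_atTop 1] with R hR
    exact abs_re_integral_symbol_sub_Ioi_le hx hR
  have h3 : Tendsto (fun R : ℝ => (1 / (2 * (Real.pi : ℂ))) *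
      ∫ ξ in (-R)..R, (whithamSymbol ξ : ℂ) * Complex.exp (Complex.I * x * ξ)) atTop
      (𝓝 ((1 / Real.pi * A : ℝ) : ℂ)) := by
    have h4 := (Complex.continuous_ofReal.tendsto _).comp (h1.const_mul (1 / Real.pi))
    refine h4.congr' ?_
    filter_upwards [eventually_ge_atTop 0] with R hR
    rw [integral_symbol_symm x hR]
    simp only [Function.comp_apply]
    push_cast
    field_simp
  rw [whithamKernel, h3.limUnder_eq, Complex.ofReal_re]

theorem whithamKernel_neg (x : ℝ) : whithamKernel (-x) = whithamKernel x := by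
  unfold whithamKernel
  congr 2
  funext R
  congr 1
  have h := intervalIntegral.integral_comp_neg (a := -R) (b := R)
    (fun ξ : ℝ => (whithamSymbol ξ : ℂ) * Complex.exp (Complex.I * x * ξ))
  rw [neg_neg] at h
  rw [← h]
  refine intervalIntegral.integral_congr fun ξ _ => ?_
  simp only [whithamSymbol_neg]
  push_cast
  ring_nf

theorem whithamKernel_of_ne_zero {x : ℝ} (hx : x ≠ 0) : whithamKernel x =
    1 / Real.pi * ∫ η in Ioi (0 : ℝ), Real.exp (-|x| * η) * kernelWeight η := by
  rcases lt_or_gt_of_ne hx with h | h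
  · rw [← whithamKernel_neg, whithamKernel_of_pos (neg_pos.2 h), abs_of_neg h]
  · rw [whithamKernel_of_pos h, abs_of_pos h]

/-! ### The operator as a positive superposition of exponential convolutions -/

theorem integrable_exp_neg_abs {η : ℝ} (hη : 0 < η) :
    MeasureTheory.Integrable fun y : ℝ => Real.exp (-|y| * η) := by
  have h1 : MeasureTheory.IntegrableOn (fun y : ℝ => Real.exp (-|y| * η)) (Ioi 0) := by
    refine (exp_neg_integrableOn_Ioi 0 hη).congr_fun (fun y hy => ?_) measurableSet_Ioi
    have : (0 : ℝ) < y := hy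
    simp only [abs_of_pos this]
    ring_nf
  have h2 : MeasureTheory.IntegrableOn (fun y : ℝ => Real.exp (-|y| * η)) (Iic 0) := by
    rw [integrableOn_Iic_iff_integrableOn_Iio]
    have h := h1.comp_neg
    simpa using h
  rw [← MeasureTheory.integrableOn_univ, ← Iic_union_Ioi (a := (0 : ℝ))]
  exact h2.union h1

theorem integral_exp_neg_abs {η : ℝ} (hη : 0 < η) : ∫ y : ℝ, Real.exp (-|y| * η) = 2 / η := by
  have h := integral_comp_abs (f := fun y => Real.exp (-y * η))
  rw [h]
  have h2 := integral_exp_mul_Ioi (a := -η) (by linarith) 0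
  have e : ∀ y : ℝ, Real.exp (-y * η) = Real.exp (-η * y) := fun y => by ring_nf
  simp only [e, h2]
  simp
  field_simp

/-- Convolution with `exp (-η |x|)`. -/
noncomputable def expConv (η : ℝ) (f : ℝ → ℝ) (x : ℝ) : ℝ := ∫ y, Real.exp (-|x - y| * η) * f y

theorem expConv_eq_integral_sub (η : ℝ) (f : ℝ → ℝ) (x : ℝ) :
    expConv η f x = ∫ z, Real.exp (-|z| * η) * f (x - z) := by
  rw [expConv, ← MeasureTheory.integral_sub_left_eq_self _ _ x]
  simp only [sub_sub_cancel]

theorem whithamL_eq_integral_sub (f : ℝ → ℝ) (x : ℝ) :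
    whithamL f x = ∫ z, whithamKernel z * f (x - z) := by
  rw [whithamL, ← MeasureTheory.integral_sub_left_eq_self _ _ x]
  simp only [sub_sub_cancel]

/-- Integrating first in the space variable gives $2/\eta$, which reduces the claim to integrability
of the weight against $\eta^{-1}$. This justifies every use of Fubini below. -/
theorem integrable_exp_mul_kernelWeight_prod :
    MeasureTheory.Integrable (fun p : ℝ × ℝ => Real.exp (-|p.1| * p.2) * kernelWeight p.2)
      (MeasureTheory.volume.prod (MeasureTheory.volume.restrict (Ioi 0))) := by
  have hmeas : Measurable (fun p : ℝ × ℝ => Real.exp (-|p.1| * p.2) * kernelWeight p.2) :=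
    (Continuous.measurable (by fun_prop)).mul (measurable_kernelWeight.comp measurable_snd)
  rw [MeasureTheory.integrable_prod_iff' hmeas.aestronglyMeasurable]
  constructor
  · refine (MeasureTheory.ae_restrict_iff' measurableSet_Ioi).2 (Eventually.of_forall fun η hη => ?_)
    have hη0 : (0 : ℝ) < η := hη
    exact (integrable_exp_neg_abs hη0).mul_const (kernelWeight η)
  · have h := (integrableOn_kernelWeight_mul_rpow (β := 1) (by norm_num)).const_mul 2
    refine MeasureTheory.Integrable.congr h ?_
    refine (MeasureTheory.ae_restrict_iff' measurableSet_Ioi).2 (Eventually.of_forall fun η hη => ?_)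
    have hη0 : (0 : ℝ) < η := hη
    have e : ∀ y : ℝ, ‖Real.exp (-|y| * η) * kernelWeight η‖ =
        Real.exp (-|y| * η) * kernelWeight η := fun y =>
      Real.norm_of_nonneg (mul_nonneg (Real.exp_nonneg _) (kernelWeight_nonneg _))
    simp only [e]
    rw [MeasureTheory.integral_mul_const, integral_exp_neg_abs hη0, Real.rpow_neg_one]
    ring

theorem whithamKernel_ae_eq : whithamKernel =ᵐ[MeasureTheory.volume] fun x =>
    1 / Real.pi * ∫ η in Ioi (0 : ℝ), Real.exp (-|x| * η) * kernelWeight η := by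
  filter_upwards [MeasureTheory.Measure.ae_ne MeasureTheory.volume (0 : ℝ)] with x hx
  exact whithamKernel_of_ne_zero hx

theorem integrable_whithamKernel : MeasureTheory.Integrable whithamKernel := by
  refine MeasureTheory.Integrable.congr ?_ whithamKernel_ae_eq.symm
  exact (integrable_exp_mul_kernelWeight_prod.integral_prod_left).const_mul _

theorem integrable_whithamKernel_mul {f : ℝ → ℝ} (hf : Measurable f) {C : ℝ}
    (hC : ∀ x, |f x| ≤ C) (x : ℝ) :
    MeasureTheory.Integrable fun z => whithamKernel z * f (x - z) :=
  integrable_whithamKernel.mul_bdd (c := C)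
    (hf.comp (measurable_const.sub measurable_id)).aestronglyMeasurable
    (Eventually.of_forall fun _ => hC _)

theorem kernelWeight_pos {η : ℝ} (hη : η ∈ Ioo (Real.pi / 2) Real.pi) : 0 < kernelWeight η := by
  have h0 : 0 < η := lt_trans (by positivity) hη.1
  refine Real.sqrt_pos.2 (div_pos (neg_pos.2 ?_) h0)
  rw [← Real.tan_sub_pi]
  exact Real.tan_neg_of_neg_of_pi_div_two_lt (by linarith [hη.2]) (by linarith [hη.1])

/-- The tangent is negative on $(\pi/2,\pi)$, so the weight is strictly positive on a set of
positive measure. -/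
theorem setIntegral_mul_kernelWeight_pos {s : Set ℝ} (hs : MeasurableSet s)
    (hsub : Ioo (Real.pi / 2) Real.pi ⊆ s) {g : ℝ → ℝ} (hg : ∀ η ∈ s, 0 < g η)
    (hint : MeasureTheory.IntegrableOn (fun η => g η * kernelWeight η) s) :
    0 < ∫ η in s, g η * kernelWeight η := by
  rw [MeasureTheory.setIntegral_pos_iff_support_of_nonneg_ae _ hint]
  · refine lt_of_lt_of_le ?_ (MeasureTheory.measure_mono
      (s := Ioo (Real.pi / 2) Real.pi) fun η hη => ⟨?_, hsub hη⟩)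
    · rw [Real.volume_Ioo, ENNReal.ofReal_pos]
      linarith [Real.pi_pos]
    · exact (mul_pos (hg η (hsub hη)) (kernelWeight_pos hη)).ne'
  · refine (MeasureTheory.ae_restrict_iff' hs).2 (Eventually.of_forall fun η hη => ?_)
    exact mul_nonneg (hg η hη).le (kernelWeight_nonneg _)

theorem whithamKernel_pos {x : ℝ} (hx : x ≠ 0) : 0 < whithamKernel x := by
  rw [whithamKernel_of_ne_zero hx]
  refine mul_pos (by positivity) (setIntegral_mul_kernelWeight_pos measurableSet_Ioi ?_
    (fun η _ => Real.exp_pos _) (integrableOn_exp_mul_kernelWeight (abs_pos.2 hx)))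
  intro η hη
  exact lt_trans (by positivity) hη.1

theorem whithamKernel_antitoneOn : AntitoneOn whithamKernel (Ioi 0) := by
  intro x hx y hy hxy
  have hx0 : (0 : ℝ) < x := hx
  have hy0 : (0 : ℝ) < y := hy
  rw [whithamKernel_of_pos hx0, whithamKernel_of_pos hy0]
  refine mul_le_mul_of_nonneg_left ?_ (by positivity)
  refine MeasureTheory.setIntegral_mono_on (integrableOn_exp_mul_kernelWeight hy0)
    (integrableOn_exp_mul_kernelWeight hx0) measurableSet_Ioi fun η hη => ?_
  have hη0 : (0 : ℝ) < η := hη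
  refine mul_le_mul_of_nonneg_right (Real.exp_le_exp.2 ?_) (kernelWeight_nonneg _)
  nlinarith

theorem integrable_expConv_prod {f : ℝ → ℝ} (hf : Measurable f) {C : ℝ}
    (hC : ∀ x, |f x| ≤ C) (x : ℝ) :
    MeasureTheory.Integrable
      (fun p : ℝ × ℝ => Real.exp (-|p.1| * p.2) * kernelWeight p.2 * f (x - p.1))
      (MeasureTheory.volume.prod (MeasureTheory.volume.restrict (Ioi 0))) :=
  integrable_exp_mul_kernelWeight_prod.mul_bdd (c := C)
    (hf.comp (measurable_const.sub measurable_fst)).aestronglyMeasurable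
    (Eventually.of_forall fun _ => hC _)

theorem integrableOn_kernelWeight_mul_expConv {f : ℝ → ℝ} (hf : Measurable f) {C : ℝ}
    (hC : ∀ x, |f x| ≤ C) (x : ℝ) :
    MeasureTheory.IntegrableOn (fun η => kernelWeight η * expConv η f x) (Ioi 0) := by
  refine MeasureTheory.Integrable.congr (integrable_expConv_prod hf hC x).integral_prod_right ?_
  refine Eventually.of_forall fun η => ?_
  simp only
  rw [expConv_eq_integral_sub, ← MeasureTheory.integral_const_mul]
  congr 1
  funext z
  ring

theorem whithamL_eq_integral_expConv {f : ℝ → ℝ} (hf : Measurable f) {C : ℝ}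
    (hC : ∀ x, |f x| ≤ C) (x : ℝ) :
    whithamL f x = 1 / Real.pi * ∫ η in Ioi (0 : ℝ), kernelWeight η * expConv η f x := by
  have h := MeasureTheory.integral_integral_swap
    (f := fun z η => Real.exp (-|z| * η) * kernelWeight η * f (x - z))
    (integrable_expConv_prod hf hC x)
  have e1 : ∀ η, kernelWeight η * expConv η f x =
      ∫ z, Real.exp (-|z| * η) * kernelWeight η * f (x - z) := by
    intro η
    rw [expConv_eq_integral_sub, ← MeasureTheory.integral_const_mul]
    congr 1
    funext z
    ring
  simp only [e1]
  rw [← h, whithamL_eq_integral_sub, ← MeasureTheory.integral_const_mul]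
  refine MeasureTheory.integral_congr_ae ?_
  filter_upwards [whithamKernel_ae_eq] with z hz
  rw [hz, MeasureTheory.integral_mul_const]
  ring

theorem whithamL_comp_add (f : ℝ → ℝ) (c x : ℝ) :
    whithamL (fun y => f (y + c)) x = whithamL f (x + c) := by
  rw [whithamL_eq_integral_sub, whithamL_eq_integral_sub]
  congr 1
  funext z
  congr 2
  ring

theorem whithamL_sub {f g : ℝ → ℝ} (hf : Measurable f) (hg : Measurable g) {C D : ℝ}
    (hC : ∀ x, |f x| ≤ C) (hD : ∀ x, |g x| ≤ D) (x : ℝ) :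
    whithamL (fun y => f y - g y) x = whithamL f x - whithamL g x := by
  rw [whithamL_eq_integral_sub, whithamL_eq_integral_sub, whithamL_eq_integral_sub,
    ← MeasureTheory.integral_sub (integrable_whithamKernel_mul hf hC x)
      (integrable_whithamKernel_mul hg hD x)]
  congr 1
  funext z
  ring

theorem whithamL_const_mul (c : ℝ) (f : ℝ → ℝ) (x : ℝ) :
    whithamL (fun y => c * f y) x = c * whithamL f x := by
  rw [whithamL_eq_integral_sub, whithamL_eq_integral_sub, ← MeasureTheory.integral_const_mul]
  congr 1
  funext z
  ring

theorem whithamL_odd {f : ℝ → ℝ} (hf : Function.Odd f) (x : ℝ) :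
    whithamL f (-x) = -whithamL f x := by
  rw [whithamL_eq_integral_sub, whithamL_eq_integral_sub, ← MeasureTheory.integral_neg_eq_self,
    ← MeasureTheory.integral_neg]
  congr 1
  funext z
  rw [whithamKernel_neg, ← mul_neg, ← hf]
  congr 2
  ring

/-! ### Odd functions: the gain from `|y| ^ β` to `|y|` -/

theorem expConv_odd {η : ℝ} {f : ℝ → ℝ} (hodd : Function.Odd f) {x : ℝ}
    (hint : MeasureTheory.Integrable fun y => Real.exp (-|x - y| * η) * f y) :
    expConv η f x =
      ∫ y in Ioi (0 : ℝ), (Real.exp (-|x - y| * η) - Real.exp (-|x + y| * η)) * f y := by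
  rw [expConv, ← intervalIntegral.integral_Iic_add_Ioi hint.integrableOn hint.integrableOn (b := 0)]
  have h := integral_comp_neg_Ioi 0 (fun y => Real.exp (-|x - y| * η) * f y)
  rw [neg_zero] at h
  have hint2 : MeasureTheory.Integrable fun y => Real.exp (-|x - (-y)| * η) * f (-y) :=
    hint.comp_neg
  rw [← h, ← MeasureTheory.integral_add hint2.integrableOn hint.integrableOn]
  congr 1
  funext y
  rw [hodd y, sub_neg_eq_add]
  ring

theorem integrable_exp_neg_abs_sub {η : ℝ} (hη : 0 < η) (x : ℝ) :
    MeasureTheory.Integrable fun y : ℝ => Real.exp (-|x - y| * η) :=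
  (integrable_exp_neg_abs hη).comp_sub_left x

theorem integrable_exp_neg_abs_sub_mul {η : ℝ} (hη : 0 < η) {f : ℝ → ℝ} (hf : Measurable f) {C : ℝ}
    (hC : ∀ x, |f x| ≤ C) (x : ℝ) :
    MeasureTheory.Integrable fun y : ℝ => Real.exp (-|x - y| * η) * f y :=
  (integrable_exp_neg_abs_sub hη x).mul_bdd (c := C) hf.aestronglyMeasurable
    (Eventually.of_forall fun _ => hC _)

theorem exp_sub_exp_nonneg {η x y : ℝ} (hη : 0 ≤ η) (hx : 0 ≤ x) (hy : 0 ≤ y) :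
    0 ≤ Real.exp (-|x - y| * η) - Real.exp (-|x + y| * η) := by
  refine sub_nonneg.2 (Real.exp_le_exp.2 (mul_le_mul_of_nonneg_right (neg_le_neg ?_) hη))
  rw [abs_of_nonneg (add_nonneg hx hy), abs_le]
  constructor <;> linarith

theorem integral_Ioi_comp_add (g : ℝ → ℝ) (a c : ℝ) :
    ∫ y in Ioi a, g (y + c) = ∫ y in Ioi (a + c), g y := by
  have h := (MeasureTheory.measurePreserving_add_right MeasureTheory.volume c).setIntegral_preimage_emb
    (measurableEmbedding_addRight c) g (Ioi (a + c))
  simpa using h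

/-- After translation this is a difference of two tails of $e^{-\eta|z|}$, that is, its integral
over $[-x,x]$, where the integrand is at most $1$. -/
theorem integral_exp_sub_exp_le {η x : ℝ} (hη : 0 < η) (hx : 0 ≤ x) :
    ∫ y in Ioi (0 : ℝ), (Real.exp (-|x - y| * η) - Real.exp (-|x + y| * η)) ≤ 2 * x := by
  set g : ℝ → ℝ := fun z => Real.exp (-|z| * η) with hg
  have hgi : MeasureTheory.Integrable g := integrable_exp_neg_abs hη
  have e1 : ∀ y, Real.exp (-|x - y| * η) = g (y + -x) := fun y => by
    simp only [hg, ← sub_eq_add_neg, abs_sub_comm x y]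
  have e2 : ∀ y, Real.exp (-|x + y| * η) = g (y + x) := fun y => by
    simp only [hg, add_comm]
  simp only [e1, e2]
  rw [MeasureTheory.integral_sub (hgi.comp_add_right (-x)).integrableOn
    (hgi.comp_add_right x).integrableOn, integral_Ioi_comp_add, integral_Ioi_comp_add, zero_add,
    zero_add, intervalIntegral.integral_Ioi_sub_Ioi hgi.integrableOn (by linarith)]
  have h := intervalIntegral.norm_integral_le_of_norm_le_const (a := -x) (b := x) (f := g)
    (C := 1) fun z _ => ?_
  · rw [one_mul, abs_of_nonneg (by linarith)] at h
    exact (Real.le_norm_self _).trans (h.trans (by linarith))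
  · rw [Real.norm_of_nonneg (Real.exp_nonneg _)]
    refine Real.exp_le_one_iff.2 ?_
    nlinarith [abs_nonneg z]

theorem integrable_exp_neg_abs_mul_self {η : ℝ} (hη : 0 < η) :
    MeasureTheory.Integrable fun z : ℝ => Real.exp (-|z| * η) * z := by
  have hb := (integrable_exp_neg_abs (half_pos hη)).const_mul (2 / η)
  refine hb.mono' (Continuous.aestronglyMeasurable (by fun_prop)) (Eventually.of_forall fun z => ?_)
  rw [norm_mul, Real.norm_of_nonneg (Real.exp_nonneg _), Real.norm_eq_abs]
  have e : Real.exp (-|z| * η) = Real.exp (-|z| * (η / 2)) * Real.exp (-(|z| * (η / 2))) := by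
    rw [← Real.exp_add]
    ring_nf
  have h1 : Real.exp (-(|z| * (η / 2))) * |z| ≤ 2 / η := by
    have h2 := Real.add_one_le_exp (|z| * (η / 2))
    rw [Real.exp_neg, inv_mul_le_iff₀ (Real.exp_pos _), mul_div_assoc', le_div_iff₀ hη]
    nlinarith
  rw [e, mul_assoc]
  calc _ ≤ Real.exp (-|z| * (η / 2)) * (2 / η) := mul_le_mul_of_nonneg_left h1 (Real.exp_nonneg _)
    _ = _ := mul_comm _ _

theorem integrable_exp_neg_abs_sub_mul_self {η : ℝ} (hη : 0 < η) (x : ℝ) :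
    MeasureTheory.Integrable fun y : ℝ => Real.exp (-|x - y| * η) * y := by
  have h := ((integrable_exp_neg_abs hη).mul_const x).sub (integrable_exp_neg_abs_mul_self hη)
  refine (h.comp_sub_left x).congr (Eventually.of_forall fun y => ?_)
  simp only [Pi.sub_apply]
  ring

theorem expConv_id {η : ℝ} (hη : 0 < η) (x : ℝ) : expConv η (fun y => y) x = 2 / η * x := by
  have h0 : ∫ z, Real.exp (-|z| * η) * z = 0 := by
    have h := MeasureTheory.integral_neg_eq_self (fun z => Real.exp (-|z| * η) * z)
      MeasureTheory.volume
    simp only [abs_neg, mul_neg, MeasureTheory.integral_neg] at h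
    linarith
  rw [expConv_eq_integral_sub]
  simp only [mul_sub]
  rw [MeasureTheory.integral_sub ((integrable_exp_neg_abs hη).mul_const x)
    (integrable_exp_neg_abs_mul_self hη), h0, MeasureTheory.integral_mul_const,
    integral_exp_neg_abs hη, sub_zero]

/-- The inequality $t^\beta\le1+t$ at the scale $t=\eta y$ of the exponential. It reduces the power
to the zeroth and first moments, which are explicit. -/
theorem rpow_le_split {η y β : ℝ} (hη : 0 < η) (hy : 0 < y) (hβ0 : 0 ≤ β) (hβ1 : β ≤ 1) :
    y ^ β ≤ η ^ (-β) + η ^ (1 - β) * y := by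
  have h1 : y ^ β = η ^ (-β) * (η * y) ^ β := by
    rw [Real.mul_rpow hη.le hy.le, ← mul_assoc, ← Real.rpow_add hη]
    simp
  have h2 : (η * y) ^ β ≤ 1 + η * y := by
    have hp : 0 < η * y := by positivity
    rcases le_total (η * y) 1 with h | h
    · have := Real.rpow_le_one hp.le h hβ0
      linarith
    · have := Real.rpow_le_rpow_of_exponent_le h hβ1
      rw [Real.rpow_one] at this
      linarith
  have h3 : η ^ (1 - β) = η ^ (-β) * η := by
    rw [sub_eq_neg_add, Real.rpow_add hη, Real.rpow_one]
  rw [h1, h3]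
  have := Real.rpow_nonneg hη.le (-β)
  nlinarith [mul_le_mul_of_nonneg_left h2 this]

/-- The folded kernel `p` has mass at most $2x$ and first moment exactly $2x/\eta$. After
`rpow_le_split` each of the two terms contributes at most $2Bx\eta^{-\beta}$. -/
theorem abs_expConv_le {η β B x : ℝ} {f : ℝ → ℝ} (hη : 0 < η) (hβ0 : 0 ≤ β) (hβ1 : β ≤ 1)
    (hx : 0 ≤ x) (hf : Measurable f) {C : ℝ} (hC : ∀ y, |f y| ≤ C) (hodd : Function.Odd f)
    (hB : ∀ y, |f y| ≤ B * |y| ^ β) :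
    |expConv η f x| ≤ 4 * B * x * η ^ (-β) := by
  have hB0 : 0 ≤ B := by
    have := (abs_nonneg _).trans (hB 1)
    simpa using this
  set p : ℝ → ℝ := fun y => Real.exp (-|x - y| * η) - Real.exp (-|x + y| * η) with hp
  have hpi : MeasureTheory.Integrable p := by
    refine (integrable_exp_neg_abs_sub hη x).sub ?_
    have h := (integrable_exp_neg_abs hη).comp_add_left x
    exact h
  have hpy : MeasureTheory.Integrable fun y => p y * y := by
    have h1 := integrable_exp_neg_abs_sub_mul_self hη x
    have h2 := h1.comp_neg.neg
    refine (h1.sub h2).congr (Eventually.of_forall fun y => ?_)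
    simp only [hp, Pi.sub_apply, Pi.neg_apply, sub_neg_eq_add]
    ring
  have hid : ∫ y in Ioi (0 : ℝ), p y * y = 2 / η * x := by
    rw [← expConv_id hη, expConv_odd (f := fun y => y) (fun y => rfl) (integrable_exp_neg_abs_sub_mul_self hη x)]
  rw [expConv_odd hodd (integrable_exp_neg_abs_sub_mul hη hf hC x), ← Real.norm_eq_abs]
  have hbound : MeasureTheory.IntegrableOn
      (fun y => B * η ^ (-β) * p y + B * η ^ (1 - β) * (p y * y)) (Ioi 0) :=
    ((hpi.const_mul _).add (hpy.const_mul _)).integrableOn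
  refine (MeasureTheory.norm_integral_le_of_norm_le hbound ?_).trans ?_
  · refine (MeasureTheory.ae_restrict_iff' measurableSet_Ioi).2 (Eventually.of_forall fun y hy => ?_)
    have hy0 : (0 : ℝ) < y := hy
    have hp0 : 0 ≤ p y := exp_sub_exp_nonneg hη.le hx hy0.le
    rw [norm_mul, Real.norm_of_nonneg hp0, Real.norm_eq_abs]
    calc p y * |f y| ≤ p y * (B * y ^ β) := by
          refine mul_le_mul_of_nonneg_left ?_ hp0
          have := hB y
          rwa [abs_of_pos hy0] at this
      _ ≤ p y * (B * (η ^ (-β) + η ^ (1 - β) * y)) := by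
          gcongr
          exact rpow_le_split hη hy0 hβ0 hβ1
      _ = _ := by ring
  · rw [MeasureTheory.integral_add (hpi.const_mul _).integrableOn (hpy.const_mul _).integrableOn,
      MeasureTheory.integral_const_mul, MeasureTheory.integral_const_mul, hid]
    have h1 := integral_exp_sub_exp_le hη hx
    have e : η ^ (1 - β) = η ^ (-β) * η := by
      rw [sub_eq_neg_add, Real.rpow_add hη, Real.rpow_one]
    have h2 : B * η ^ (1 - β) * (2 / η * x) = 2 * B * x * η ^ (-β) := by
      rw [e]
      field_simp
    rw [h2]
    have h3 : B * η ^ (-β) * ∫ y in Ioi (0 : ℝ), p y ≤ B * η ^ (-β) * (2 * x) :=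
      mul_le_mul_of_nonneg_left h1 (mul_nonneg hB0 (Real.rpow_nonneg hη.le _))
    linarith

/-- Convolution with the Whitham kernel turns odd functions that are `O(|y| ^ β)`, `β > 1 / 2`,
into functions that are `O(|y|)`. -/
theorem abs_whithamL_le {β : ℝ} (hβ : 1 / 2 < β) (hβ1 : β ≤ 1) : ∃ A : ℝ, 0 < A ∧
    ∀ (f : ℝ → ℝ) (B C : ℝ), Measurable f → (∀ y, |f y| ≤ C) → Function.Odd f →
      (∀ y, |f y| ≤ B * |y| ^ β) → ∀ x, |whithamL f x| ≤ A * B * |x| := by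
  set J := ∫ η in Ioi (0 : ℝ), kernelWeight η * η ^ (-β) with hJ
  have hJ0 : 0 ≤ J := MeasureTheory.setIntegral_nonneg measurableSet_Ioi fun η hη =>
    mul_nonneg (kernelWeight_nonneg _) (Real.rpow_nonneg (le_of_lt hη) _)
  -- The summand `1` only makes positivity immediate from `0 ≤ J`.
  refine ⟨1 / Real.pi * (4 * J) + 1, by positivity, ?_⟩
  intro f B C hf hC hodd hB
  have hB0 : 0 ≤ B := by
    have := (abs_nonneg _).trans (hB 1)
    simpa using this
  have key : ∀ x, 0 ≤ x → |whithamL f x| ≤ (1 / Real.pi * (4 * J) + 1) * B * |x| := by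
    intro x hx
    rw [whithamL_eq_integral_expConv hf hC, abs_mul, abs_of_pos (by positivity : 0 < 1 / Real.pi),
      abs_of_nonneg hx]
    have hbound := (integrableOn_kernelWeight_mul_rpow hβ).const_mul (4 * B * x)
    have h : ‖∫ η in Ioi (0 : ℝ), kernelWeight η * expConv η f x‖ ≤ 4 * B * x * J := by
      rw [hJ, ← MeasureTheory.integral_const_mul]
      refine MeasureTheory.norm_integral_le_of_norm_le hbound ?_
      refine (MeasureTheory.ae_restrict_iff' measurableSet_Ioi).2 (Eventually.of_forall ?_)
      intro η hη
      rw [norm_mul, Real.norm_of_nonneg (kernelWeight_nonneg _), Real.norm_eq_abs]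
      have := abs_expConv_le hη (by linarith) hβ1 hx hf hC hodd hB
      calc _ ≤ kernelWeight η * (4 * B * x * η ^ (-β)) :=
            mul_le_mul_of_nonneg_left this (kernelWeight_nonneg _)
        _ = _ := by ring
    calc 1 / Real.pi * _ ≤ 1 / Real.pi * (4 * B * x * J) :=
          mul_le_mul_of_nonneg_left h (by positivity)
      _ ≤ 1 / Real.pi * (4 * B * x * J) + B * x := by
          have := mul_nonneg hB0 hx
          linarith
      _ = _ := by ring
  intro x
  rcases le_total 0 x with hx | hx
  · exact key x hx
  · have h := key (-x) (by linarith)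
    rwa [whithamL_odd hodd, abs_neg, abs_neg] at h

/-! ### The Dirichlet Green function and positivity -/

/-- The Green function of `(η² - ∂²) / (2 η)` on `(0, H)` with Dirichlet boundary conditions. -/
noncomputable def dirichletGreen (η H x y : ℝ) : ℝ :=
  Real.exp (-|x - y| * η) - Real.exp (-|x + y| * η) -
    2 * Real.sinh (η * x) * Real.sinh (η * y) * Real.exp (-(η * H)) / Real.sinh (η * H)

theorem dirichletGreen_comm (η H x y : ℝ) : dirichletGreen η H x y = dirichletGreen η H y x := by
  rw [dirichletGreen, dirichletGreen, abs_sub_comm, add_comm]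
  ring

/-- The product of the two homogeneous solutions vanishing at $0$ and at $H$; sign and lower bounds
can be read off from it. -/
theorem dirichletGreen_of_le {η H x y : ℝ} (hη : 0 < η) (hH : 0 < H) (hy : 0 ≤ y) (hyx : y ≤ x) :
    dirichletGreen η H x y =
      2 * Real.sinh (η * y) * Real.sinh (η * (H - x)) / Real.sinh (η * H) := by
  have hs : Real.sinh (η * H) ≠ 0 := (Real.sinh_pos_iff.2 (mul_pos hη hH)).ne'
  have e0 : Real.sinh (η * (H - x)) =
      Real.sinh (η * H) * Real.cosh (η * x) - Real.cosh (η * H) * Real.sinh (η * x) := by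
    rw [mul_sub, Real.sinh_sub]
  have e1 : Real.exp (-|x - y| * η) =
      (Real.cosh (η * x) - Real.sinh (η * x)) * (Real.cosh (η * y) + Real.sinh (η * y)) := by
    rw [abs_of_nonneg (by linarith), Real.cosh_sub_sinh, Real.cosh_add_sinh, ← Real.exp_add]
    ring_nf
  have e2 : Real.exp (-|x + y| * η) =
      (Real.cosh (η * x) - Real.sinh (η * x)) * (Real.cosh (η * y) - Real.sinh (η * y)) := by
    rw [abs_of_nonneg (by linarith), Real.cosh_sub_sinh, Real.cosh_sub_sinh, ← Real.exp_add]
    ring_nf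
  rw [dirichletGreen, e0, e1, e2, ← Real.cosh_sub_sinh (η * H)]
  field_simp
  ring

theorem continuous_dirichletGreen (η H x : ℝ) : Continuous (dirichletGreen η H x) := by
  have e : dirichletGreen η H x = fun y => Real.exp (-|x - y| * η) - Real.exp (-|x + y| * η) -
    2 * Real.sinh (η * x) * Real.sinh (η * y) * Real.exp (-(η * H)) / Real.sinh (η * H) := rfl
  rw [e]
  have := Real.continuous_sinh
  fun_prop

/-- Oddness folds the line onto $(0,\infty)$. For $y>H$ the folded kernel is $2\sinh(\eta x)e^{-\eta
y}$, so the tail enters only through the number `B`, which the symmetries of `f` express by its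
values on $(0,H)$. -/
theorem expConv_eq_integral_green {η H x C : ℝ} {f : ℝ → ℝ} (hη : 0 < η) (hH : 0 < H)
    (hx : 0 ≤ x) (hxH : x ≤ H) (hf : Continuous f) (hC : ∀ y, |f y| ≤ C)
    (hodd : Function.Odd f) (hper : Function.Periodic f (2 * H)) :
    expConv η f x = ∫ y in (0 : ℝ)..H, dirichletGreen η H x y * f y := by
  have hs : 0 < Real.sinh (η * H) := Real.sinh_pos_iff.2 (mul_pos hη hH)
  have hexp : ∀ a : ℝ, MeasureTheory.IntegrableOn (fun y => Real.exp (-η * y) * f y) (Ioi a) :=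
    fun a => (exp_neg_integrableOn_Ioi a hη).mul_bdd (c := C) hf.aestronglyMeasurable
      (Eventually.of_forall fun _ => hC _)
  set A := ∫ y in Ioi (0 : ℝ), Real.exp (-η * y) * f y with hA
  set B := ∫ y in Ioi H, Real.exp (-η * y) * f y with hB
  set D := ∫ y in (0 : ℝ)..H, Real.exp (-η * y) * f y with hD
  set E := ∫ y in (0 : ℝ)..H, Real.exp (η * y) * f y with hE
  set S := ∫ y in (0 : ℝ)..H, Real.sinh (η * y) * f y with hS
  have hcont1 : Continuous fun y => Real.exp (-η * y) * f y := by fun_prop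
  have hcont2 : Continuous fun y => Real.exp (η * y) * f y := by fun_prop
  have hADB : A = D + B := (intervalIntegral.integral_interval_add_Ioi (hexp 0) (hexp H)).symm
  have hES : E - D = 2 * S := by
    rw [hE, hD, hS, ← intervalIntegral.integral_sub (hcont2.intervalIntegrable _ _)
      (hcont1.intervalIntegrable _ _), ← intervalIntegral.integral_const_mul]
    refine intervalIntegral.integral_congr fun y _ => ?_
    simp only [Real.sinh_eq]
    ring_nf
  have hshift : ∫ y in Ioi (2 * H), Real.exp (-η * y) * f y = Real.exp (-η * (2 * H)) * A := by
    have h := integral_Ioi_comp_add (fun y => Real.exp (-η * y) * f y) 0 (2 * H)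
    rw [zero_add] at h
    rw [← h, hA, ← MeasureTheory.integral_const_mul]
    refine MeasureTheory.integral_congr_ae (Eventually.of_forall fun y => ?_)
    simp only [hper y, mul_add, Real.exp_add]
    ring
  have hrefl : ∫ y in H..(2 * H), Real.exp (-η * y) * f y = -(Real.exp (-η * (2 * H)) * E) := by
    have h := intervalIntegral.integral_comp_sub_left (a := 0) (b := H)
      (fun y => Real.exp (-η * y) * f y) (2 * H)
    have e : 2 * H - H = H := by ring
    rw [sub_zero, e] at h
    rw [← h, hE, ← intervalIntegral.integral_const_mul, ← intervalIntegral.integral_neg]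
    refine intervalIntegral.integral_congr fun y _ => ?_
    have h1 : f (2 * H - y) = -f y := by rw [hper.sub_eq', hodd]
    simp only [h1]
    rw [mul_sub, sub_eq_add_neg, Real.exp_add]
    ring_nf
  -- Reflection in $H$ treats $[H,2H]$ and a shift by one period treats $(2H,\infty)$. As $A=D+B$,
  -- this is a linear equation for `B`.
  have hBeq : B = -(Real.exp (-η * (2 * H)) * E) + Real.exp (-η * (2 * H)) * A := by
    rw [← hrefl, ← hshift, hB]
    exact (intervalIntegral.integral_interval_add_Ioi (hexp H) (hexp (2 * H))).symm
  have hBS : B = -(S * Real.exp (-(η * H)) / Real.sinh (η * H)) := by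
    rw [eq_neg_iff_add_eq_zero, add_div' _ _ _ hs.ne', div_eq_zero_iff]
    left
    have h2 : Real.sinh (η * H) = (Real.exp (η * H) - Real.exp (-(η * H))) / 2 := Real.sinh_eq _
    have h3 : Real.exp (η * H) * Real.exp (-(η * H)) = 1 := by
      rw [← Real.exp_add]; simp
    have h4 : Real.exp (-η * (2 * H)) = Real.exp (-(η * H)) * Real.exp (-(η * H)) := by
      rw [← Real.exp_add]; ring_nf
    have h5 : B * (1 - Real.exp (-η * (2 * H))) = -(Real.exp (-η * (2 * H)) * (2 * S)) := by
      rw [← hES]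
      rw [hADB] at hBeq
      linear_combination hBeq
    rw [h4] at h5
    rw [h2]
    linear_combination (Real.exp (η * H) / 2) * h5 +
      (B * Real.exp (-(η * H)) / 2 - S * Real.exp (-(η * H))) * h3
  rw [expConv_odd hodd (integrable_exp_neg_abs_sub_mul hη hf.measurable hC x)]
  set p : ℝ → ℝ := fun y => Real.exp (-|x - y| * η) - Real.exp (-|x + y| * η) with hp
  have hpcont : Continuous p := by fun_prop
  have hpi : MeasureTheory.Integrable fun y => p y * f y :=
    ((integrable_exp_neg_abs_sub hη x).sub ((integrable_exp_neg_abs hη).comp_add_left x)).mul_bdd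
      (c := C) hf.aestronglyMeasurable (Eventually.of_forall fun _ => hC _)
  rw [← intervalIntegral.integral_interval_add_Ioi (b := H) hpi.integrableOn hpi.integrableOn]
  have htail : ∫ y in Ioi H, p y * f y = 2 * Real.sinh (η * x) * B := by
    rw [hB, ← MeasureTheory.integral_const_mul]
    refine MeasureTheory.setIntegral_congr_fun measurableSet_Ioi fun y hy => ?_
    have hy0 : H < y := hy
    simp only [hp]
    rw [abs_of_nonpos (by linarith), abs_of_nonneg (by linarith), Real.sinh_eq]
    have e1 : Real.exp (- -(x - y) * η) = Real.exp (η * x) * Real.exp (-η * y) := by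
      rw [← Real.exp_add]; ring_nf
    have e2 : Real.exp (-(x + y) * η) = Real.exp (-(η * x)) * Real.exp (-η * y) := by
      rw [← Real.exp_add]; ring_nf
    rw [e1, e2]
    ring
  have hpf : Continuous fun y => p y * f y := by fun_prop
  have hsf : Continuous fun y => 2 * Real.sinh (η * x) * Real.exp (-(η * H)) / Real.sinh (η * H) *
      (Real.sinh (η * y) * f y) := by
    have := Real.continuous_sinh
    fun_prop
  have hgreen : ∫ y in (0 : ℝ)..H, dirichletGreen η H x y * f y =
      (∫ y in (0 : ℝ)..H, p y * f y) -
        2 * Real.sinh (η * x) * Real.exp (-(η * H)) / Real.sinh (η * H) * S := by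
    rw [hS, ← intervalIntegral.integral_const_mul, ← intervalIntegral.integral_sub
      (hpf.intervalIntegrable _ _) (hsf.intervalIntegrable _ _)]
    refine intervalIntegral.integral_congr fun y _ => ?_
    simp only [hp, dirichletGreen]
    ring
  rw [htail, hgreen, hBS]
  ring

theorem dirichletGreen_nonneg {η H x y : ℝ} (hη : 0 < η) (hH : 0 < H) (hx : x ∈ Icc 0 H)
    (hy : y ∈ Icc 0 H) : 0 ≤ dirichletGreen η H x y := by
  have hs : 0 < Real.sinh (η * H) := Real.sinh_pos_iff.2 (mul_pos hη hH)
  wlog hyx : y ≤ x generalizing x y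
  · rw [dirichletGreen_comm]
    exact this hy hx (le_of_not_ge hyx)
  rw [dirichletGreen_of_le hη hH hy.1 hyx]
  have h1 : 0 ≤ Real.sinh (η * y) := Real.sinh_nonneg_iff.2 (mul_nonneg hη.le hy.1)
  have h2 : 0 ≤ Real.sinh (η * (H - x)) :=
    Real.sinh_nonneg_iff.2 (mul_nonneg hη.le (by linarith [hx.2]))
  positivity

theorem expConv_nonneg {η H x C : ℝ} {f : ℝ → ℝ} (hη : 0 < η) (hH : 0 < H)
    (hx : x ∈ Icc 0 H) (hf : Continuous f) (hC : ∀ y, |f y| ≤ C)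
    (hodd : Function.Odd f) (hper : Function.Periodic f (2 * H)) (h0 : ∀ y ∈ Icc 0 H, 0 ≤ f y) :
    0 ≤ expConv η f x := by
  rw [expConv_eq_integral_green hη hH hx.1 hx.2 hf hC hodd hper]
  exact intervalIntegral.integral_nonneg hH.le fun y hy =>
    mul_nonneg (dirichletGreen_nonneg hη hH hx hy) (h0 y hy)

/-- All frequencies contribute nonnegatively, so those outside `J` may be dropped. On `J` a minorant
of the Green function that is a product in `η` and `y` decouples the two integrals. -/
theorem le_whithamL_of_le_green {H x C : ℝ} {f w ρ : ℝ → ℝ} {J : Set ℝ} (hH : 0 < H)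
    (hx : x ∈ Icc 0 H) (hf : Continuous f) (hC : ∀ y, |f y| ≤ C)
    (hodd : Function.Odd f) (hper : Function.Periodic f (2 * H)) (h0 : ∀ y ∈ Icc 0 H, 0 ≤ f y)
    (hJ : MeasurableSet J) (hJ0 : J ⊆ Ioi 0)
    (hw : MeasureTheory.IntegrableOn (fun η => w η * kernelWeight η) J)
    (hρ : IntervalIntegrable (fun y => ρ y * f y) MeasureTheory.volume 0 H)
    (hle : ∀ η ∈ J, ∀ y ∈ Icc 0 H, w η * ρ y ≤ dirichletGreen η H x y) :
    1 / Real.pi * (∫ η in J, w η * kernelWeight η) * (∫ y in (0 : ℝ)..H, ρ y * f y) ≤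
      whithamL f x := by
  rw [whithamL_eq_integral_expConv hf.measurable hC, mul_assoc]
  refine mul_le_mul_of_nonneg_left ?_ (by positivity)
  have hi := integrableOn_kernelWeight_mul_expConv hf.measurable hC x
  have h1 : ∫ η in J, kernelWeight η * expConv η f x ≤
      ∫ η in Ioi (0 : ℝ), kernelWeight η * expConv η f x := by
    refine MeasureTheory.setIntegral_mono_set hi ?_ hJ0.eventuallyLE
    refine (MeasureTheory.ae_restrict_iff' measurableSet_Ioi).2 (Eventually.of_forall fun η hη => ?_)
    exact mul_nonneg (kernelWeight_nonneg _) (expConv_nonneg hη hH hx hf hC hodd hper h0)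
  refine le_trans ?_ h1
  rw [← MeasureTheory.integral_mul_const]
  refine MeasureTheory.setIntegral_mono_on (hw.mul_const _) (hi.mono_set hJ0) hJ fun η hη => ?_
  have hη0 : 0 < η := hJ0 hη
  rw [expConv_eq_integral_green hη0 hH hx.1 hx.2 hf hC hodd hper, mul_comm (w η), mul_assoc]
  refine mul_le_mul_of_nonneg_left ?_ (kernelWeight_nonneg _)
  rw [← intervalIntegral.integral_const_mul]
  refine intervalIntegral.integral_mono_on hH.le (hρ.const_mul _)
    (((continuous_dirichletGreen η H x).mul hf).intervalIntegrable _ _) fun y hy => ?_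
  rw [← mul_assoc]
  exact mul_le_mul_of_nonneg_right (hle η hη y hy) (h0 y hy)

/-! ### The lattice distance and strict positivity -/

/-- The distance from `x` to the lattice `H ℤ`, divided by `H`. -/
noncomputable def latticeDist (H x : ℝ) : ℝ := |x / H - round (x / H)|

theorem latticeDist_nonneg (H x : ℝ) : 0 ≤ latticeDist H x := abs_nonneg _

theorem latticeDist_le_one (H x : ℝ) : latticeDist H x ≤ 1 :=
  (abs_sub_round _).trans (by norm_num)

theorem latticeDist_le {H : ℝ} (hH : 0 < H) (x : ℝ) (k : ℤ) :
    latticeDist H x ≤ |x - k * H| / H := by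
  have h := round_le (x / H) k
  have e : x / H - k = (x - k * H) / H := by field_simp
  rw [e, abs_div, abs_of_pos hH] at h
  exact h

theorem exists_latticeDist_eq {H : ℝ} (hH : 0 < H) (x : ℝ) :
    ∃ k : ℤ, |x - k * H| = H * latticeDist H x := by
  refine ⟨round (x / H), ?_⟩
  rw [latticeDist, ← abs_of_pos hH, ← abs_mul, abs_of_pos hH]
  congr 1
  field_simp

theorem latticeDist_le_left {H x : ℝ} (hH : 0 < H) (hx : 0 ≤ x) : H * latticeDist H x ≤ x := by
  have h := latticeDist_le hH x 0
  rw [le_div_iff₀ hH] at h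
  simp only [Int.cast_zero, zero_mul, sub_zero, abs_of_nonneg hx] at h
  linarith

theorem latticeDist_le_right {H x : ℝ} (hH : 0 < H) (hx : x ≤ H) :
    H * latticeDist H x ≤ H - x := by
  have h := latticeDist_le hH x 1
  rw [le_div_iff₀ hH] at h
  simp only [Int.cast_one, one_mul] at h
  rw [abs_of_nonpos (by linarith)] at h
  linarith

theorem latticeDist_pos {H x : ℝ} (hH : 0 < H) (hx : x ∈ Ioo 0 H) : 0 < latticeDist H x := by
  refine abs_pos.2 fun h => ?_
  have h1 : 0 < x / H := div_pos hx.1 hH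
  have h2 : x / H < 1 := (div_lt_one hH).2 hx.2
  have h3 : x / H = round (x / H) := by linarith
  rw [h3] at h1 h2
  have h4 : (0 : ℤ) < round (x / H) := by exact_mod_cast h1
  have h5 : round (x / H) < (1 : ℤ) := by exact_mod_cast h2
  omega

theorem continuous_latticeDist {H : ℝ} (hH : 0 < H) : Continuous (latticeDist H) := by
  refine (LipschitzWith.of_le_add_mul (Real.toNNReal H⁻¹) fun x y => ?_).continuous
  obtain ⟨k, hk⟩ := exists_latticeDist_eq hH y
  refine (latticeDist_le hH x k).trans ?_
  have e : latticeDist H y = |y - k * H| / H := by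
    rw [hk]
    field_simp
  rw [e, Real.coe_toNNReal _ (by positivity), Real.dist_eq, inv_mul_eq_div, ← add_div]
  refine div_le_div_of_nonneg_right ?_ hH.le
  have e2 : x - k * H = (y - k * H) + (x - y) := by ring
  rw [e2]
  exact abs_add_le _ _

/-- Convolution with the Whitham kernel is strictly positivity improving on odd periodic
functions that are nonnegative on a half-period. -/
theorem exists_whithamL_ge_latticeDist {H : ℝ} (hH : 0 < H) : ∃ c : ℝ, 0 < c ∧
    ∀ (f : ℝ → ℝ) (C : ℝ), Continuous f → (∀ y, |f y| ≤ C) → Function.Odd f →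
      Function.Periodic f (2 * H) → (∀ y ∈ Icc 0 H, 0 ≤ f y) → ∀ x ∈ Icc 0 H,
        c * latticeDist H x * (∫ y in (0 : ℝ)..H, latticeDist H y * f y) ≤ whithamL f x := by
  -- The first band carrying weight. There $\eta\ge1$ gives $\sinh(\eta y)\ge y$, and $\eta\le\pi$
  -- bounds the denominator $\sinh(\eta H)$ by $\sinh(\pi H)$.
  set J := Ioc (Real.pi / 2) Real.pi with hJ
  have hJ0 : J ⊆ Ioi 0 := fun η hη => lt_trans (by positivity) hη.1
  set k := 2 * H ^ 2 / Real.sinh (Real.pi * H) with hk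
  have hsp : 0 < Real.sinh (Real.pi * H) := Real.sinh_pos_iff.2 (mul_pos Real.pi_pos hH)
  have hk0 : 0 < k := by positivity
  have hint : MeasureTheory.IntegrableOn (fun η => k * kernelWeight η) J := by
    have h := ((integrableOn_exp_mul_kernelWeight one_pos).mono_set hJ0).const_mul
      (k * Real.exp Real.pi)
    refine h.mono' ((measurable_kernelWeight.const_mul _).aestronglyMeasurable) ?_
    refine (MeasureTheory.ae_restrict_iff' measurableSet_Ioc).2 (Eventually.of_forall fun η hη => ?_)
    rw [norm_mul, Real.norm_of_nonneg hk0.le, Real.norm_of_nonneg (kernelWeight_nonneg _)]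
    have h1 : 1 ≤ Real.exp Real.pi * Real.exp (-1 * η) := by
      rw [← Real.exp_add]
      exact Real.one_le_exp (by linarith [hη.2])
    calc k * kernelWeight η = k * 1 * kernelWeight η := by ring
      _ ≤ k * (Real.exp Real.pi * Real.exp (-1 * η)) * kernelWeight η := by
          have := kernelWeight_nonneg η
          gcongr
      _ = _ := by ring
  have hpos := setIntegral_mul_kernelWeight_pos (g := fun _ => k) measurableSet_Ioc
    (Ioo_subset_Ioc_self) (fun _ _ => hk0) hint
  refine ⟨1 / Real.pi * ∫ η in J, k * kernelWeight η, by positivity, ?_⟩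
  intro f C hf hC hodd hper h0 x hx
  have h := le_whithamL_of_le_green (w := fun _ => k)
    (ρ := fun y => latticeDist H x * latticeDist H y) hH hx hf hC hodd hper h0 measurableSet_Ioc
    hJ0 hint ((((continuous_latticeDist hH).const_mul _).mul hf).intervalIntegrable _ _) ?_
  · refine le_trans (le_of_eq ?_) h
    simp only [mul_assoc]
    rw [intervalIntegral.integral_const_mul]
  intro η hη y hy
  have hη0 : 0 < η := hJ0 hη
  have hη1 : 1 ≤ η := by
    have := hη.1
    linarith [Real.two_le_pi]
  wlog hyx : y ≤ x generalizing x y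
  · rw [dirichletGreen_comm, mul_comm (latticeDist H x)]
    exact this y hy x hx (le_of_not_ge hyx)
  rw [dirichletGreen_of_le hη0 hH hy.1 hyx, hk]
  have h1 : H * latticeDist H y ≤ Real.sinh (η * y) := by
    refine (latticeDist_le_left hH hy.1).trans ?_
    have : η * y ≤ Real.sinh (η * y) := Real.self_le_sinh_iff.2 (mul_nonneg hη0.le hy.1)
    nlinarith [hy.1]
  have h2 : H * latticeDist H x ≤ Real.sinh (η * (H - x)) := by
    refine (latticeDist_le_right hH hx.2).trans ?_
    have h3 : 0 ≤ H - x := by linarith [hx.2]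
    have : η * (H - x) ≤ Real.sinh (η * (H - x)) := Real.self_le_sinh_iff.2 (mul_nonneg hη0.le h3)
    nlinarith
  have h4 : Real.sinh (η * H) ≤ Real.sinh (Real.pi * H) :=
    Real.sinh_le_sinh.2 (mul_le_mul_of_nonneg_right hη.2 hH.le)
  have h5 : 0 < Real.sinh (η * H) := Real.sinh_pos_iff.2 (mul_pos hη0 hH)
  have h6 := latticeDist_nonneg H x
  have h7 := latticeDist_nonneg H y
  calc 2 * H ^ 2 / Real.sinh (Real.pi * H) * (latticeDist H x * latticeDist H y)
      = 2 * (H * latticeDist H y) * (H * latticeDist H x) / Real.sinh (Real.pi * H) := by ring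
    _ ≤ 2 * Real.sinh (η * y) * Real.sinh (η * (H - x)) / Real.sinh (η * H) := by
        have h8 : 0 ≤ H * latticeDist H y := by positivity
        have h9 : 0 ≤ H * latticeDist H x := by positivity
        have h10 := h8.trans h1
        have h11 := h9.trans h2
        gcongr

/-! ### The kernel singularity near the origin -/

theorem periodic_sqrt_neg_tan : Function.Periodic (fun η => √(-Real.tan η)) Real.pi := by
  intro η
  simp only [Real.tan_add_pi]

theorem intervalIntegrable_sqrt_neg_tan (a b : ℝ) :
    IntervalIntegrable (fun η => √(-Real.tan η)) MeasureTheory.volume a b := by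
  refine (intervalIntegrable_sqrt_abs_tan a b).mono_fun (measurable_tan.neg.sqrt).aestronglyMeasurable
    (Eventually.of_forall fun η => ?_)
  beta_reduce
  rw [Real.norm_of_nonneg (Real.sqrt_nonneg _), Real.norm_of_nonneg (Real.sqrt_nonneg _)]
  exact Real.sqrt_le_sqrt (neg_le_abs _)

theorem integral_sqrt_neg_tan_pos : 0 < ∫ η in (0 : ℝ)..Real.pi, √(-Real.tan η) := by
  rw [intervalIntegral.integral_of_le Real.pi_pos.le]
  have e : ∀ η ∈ Ioc 0 Real.pi, √(-Real.tan η) = √η * kernelWeight η := by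
    intro η hη
    rw [kernelWeight, ← Real.sqrt_mul hη.1.le, mul_div_cancel₀ _ hη.1.ne']
  rw [MeasureTheory.setIntegral_congr_fun measurableSet_Ioc e]
  refine setIntegral_mul_kernelWeight_pos measurableSet_Ioc ?_
    (fun η hη => Real.sqrt_pos.2 hη.1) ?_
  · intro η hη
    exact ⟨lt_trans (by positivity) hη.1, hη.2.le⟩
  · refine MeasureTheory.IntegrableOn.congr_fun ?_ e measurableSet_Ioc
    exact (intervalIntegrable_iff_integrableOn_Ioc_of_le Real.pi_pos.le).1
      (intervalIntegrable_sqrt_neg_tan _ _)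

theorem sinh_sub_div_sinh_ge {s t : ℝ} (ht : t ≤ s) (hs : 0 < s) :
    Real.exp (-t) * (1 - Real.exp (-2 * (s - t))) ≤ Real.sinh (s - t) / Real.sinh s := by
  have h0 : 0 < Real.sinh s := Real.sinh_pos_iff.2 hs
  rw [le_div_iff₀ h0]
  have h1 : Real.sinh s ≤ Real.exp s / 2 := by
    rw [Real.sinh_eq]
    have := Real.exp_pos (-s)
    linarith
  have h2 : 0 ≤ 1 - Real.exp (-2 * (s - t)) := by
    rw [sub_nonneg]
    exact Real.exp_le_one_iff.2 (by linarith)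
  calc _ ≤ Real.exp (-t) * (1 - Real.exp (-2 * (s - t))) * (Real.exp s / 2) := by gcongr
    _ = Real.sinh (s - t) := by
        have e1 : Real.exp (s - t) = Real.exp (-t) * Real.exp s := by
          rw [← Real.exp_add]; ring_nf
        have e2 : Real.exp (-(s - t)) = Real.exp (-t) * Real.exp s * Real.exp (-2 * (s - t)) := by
          rw [← Real.exp_add, ← Real.exp_add]; ring_nf
        rw [Real.sinh_eq, e1, e2]
        ring

/-- One factor of the product form is at least $\eta a$ by $\sinh t\ge t$, the other is nearly
$e^{-\eta x}$. The bound is of order one when $\eta$ is comparable to $1/a$. -/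
theorem dirichletGreen_ge_near_zero {η H a x y : ℝ} (hη : 1 ≤ η) (hH : 0 < H) (ha : 0 < a)
    (haH : a ≤ H / 2) (hx : x ∈ Icc (a / 2) a) (hy : y ∈ Icc (a / 2) a) :
    (1 - Real.exp (-H)) * (a * (η * Real.exp (-(η * a)))) ≤ dirichletGreen η H x y := by
  wlog hyx : y ≤ x generalizing x y
  · rw [dirichletGreen_comm]
    exact this hy hx (le_of_not_ge hyx)
  have hη0 : 0 < η := by linarith
  have hy0 : 0 ≤ y := by linarith [hy.1]
  rw [dirichletGreen_of_le hη0 hH hy0 hyx]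
  have h1 : η * a ≤ 2 * Real.sinh (η * y) := by
    have : η * y ≤ Real.sinh (η * y) := Real.self_le_sinh_iff.2 (mul_nonneg hη0.le hy0)
    nlinarith [hy.1]
  have h2 := sinh_sub_div_sinh_ge (s := η * H) (t := η * x) (by nlinarith [hx.2]) (by positivity)
  rw [← mul_sub] at h2
  have h3 : Real.exp (-(η * a)) * (1 - Real.exp (-H)) ≤
      Real.exp (-(η * x)) * (1 - Real.exp (-2 * (η * (H - x)))) := by
    have e1 : Real.exp (-(η * a)) ≤ Real.exp (-(η * x)) :=
      Real.exp_le_exp.2 (by nlinarith [hx.2])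
    have e2 : Real.exp (-2 * (η * (H - x))) ≤ Real.exp (-H) := by
      refine Real.exp_le_exp.2 ?_
      nlinarith [hx.2]
    have e3 : Real.exp (-H) ≤ 1 := Real.exp_le_one_iff.2 (by linarith)
    have e4 : 0 ≤ 1 - Real.exp (-H) := by linarith
    gcongr
  have h4 : 0 ≤ Real.exp (-(η * a)) * (1 - Real.exp (-H)) := by
    have e3 : Real.exp (-H) ≤ 1 := Real.exp_le_one_iff.2 (by linarith)
    exact mul_nonneg (Real.exp_nonneg _) (by linarith)
  calc _ = (η * a) * (Real.exp (-(η * a)) * (1 - Real.exp (-H))) := by ring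
    _ ≤ (2 * Real.sinh (η * y)) * (Real.sinh (η * (H - x)) / Real.sinh (η * H)) := by
        have h5 : 0 ≤ η * a := by positivity
        have := h5.trans h1
        gcongr
        exact h3.trans h2
    _ = _ := by ring

/-- The singularity of the Whitham kernel at the origin seen on odd periodic functions. -/
theorem exists_whithamL_ge_near_zero {H : ℝ} (hH : 0 < H) : ∃ c : ℝ, 0 < c ∧
    ∀ (f : ℝ → ℝ) (C : ℝ), Continuous f → (∀ y, |f y| ≤ C) → Function.Odd f →
      Function.Periodic f (2 * H) → (∀ y ∈ Icc 0 H, 0 ≤ f y) →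
      ∀ a, 0 < a → a ≤ H / 2 → ∀ x ∈ Icc (a / 2) a,
        c / √a * (∫ y in (a / 2)..a, f y) ≤ whithamL f x := by
  set I := ∫ η in (0 : ℝ)..Real.pi, √(-Real.tan η) with hI
  have hIpos : 0 < I := integral_sqrt_neg_tan_pos
  have hpi := Real.pi_pos
  have hc1 : 0 < 1 - Real.exp (-H) := by
    have : Real.exp (-H) < 1 := Real.exp_lt_one_iff.2 (by linarith)
    linarith
  refine ⟨1 / Real.pi * ((1 - Real.exp (-H)) * Real.exp (-(4 * Real.pi * H)) * (H * √H) * I),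
    by positivity, ?_⟩
  intro f C hf hC hodd hper h0 a ha haH x hx
  -- The relevant frequencies have order $1/a$; an integer `n` makes the window `J` consist of
  -- exactly `n` periods of the tangent.
  obtain ⟨n, hn1, hn2⟩ : ∃ n : ℕ, H / a ≤ n ∧ (n : ℝ) ≤ 2 * (H / a) := by
    refine ⟨⌈H / a⌉₊, Nat.le_ceil _, ?_⟩
    have h1 : 2 ≤ H / a := by
      rw [le_div_iff₀ ha]
      linarith
    have h2 := Nat.ceil_lt_add_one (by positivity : 0 ≤ H / a)
    linarith
  have hHa : 2 ≤ H / a := by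
    rw [le_div_iff₀ ha]
    linarith
  have hn0 : (1 : ℝ) ≤ n := by linarith
  have hna : n * a ≤ 2 * H := by
    have := mul_le_mul_of_nonneg_right hn2 ha.le
    rwa [mul_assoc, div_mul_cancel₀ _ ha.ne'] at this
  have hnpi : 1 ≤ n * Real.pi := by nlinarith [Real.pi_gt_three]
  set J := Ioc (n * Real.pi) (2 * (n * Real.pi)) with hJ
  have hJle : n * Real.pi ≤ 2 * (n * Real.pi) := by linarith
  have hJ0 : J ⊆ Ioi 0 := fun η hη => lt_trans (by linarith) hη.1
  -- On `J` one has $\eta\ge n\pi$ and $\eta a\le2\pi na\le4\pi H$, so `w` minorises the Green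
  -- function there. It is bounded below independently of `a`.
  set w := (1 - Real.exp (-H)) * (a * ((n * Real.pi) * Real.exp (-(4 * Real.pi * H)))) with hw
  have hw0 : 0 < w := by positivity
  have hqlow : ∀ η ∈ J, √(-Real.tan η) / √(2 * (n * Real.pi)) ≤ kernelWeight η := by
    intro η hη
    have hη0 : 0 < η := hJ0 hη
    rw [kernelWeight, Real.sqrt_div' _ hη0.le]
    refine div_le_div_of_nonneg_left (Real.sqrt_nonneg _) (Real.sqrt_pos.2 hη0) ?_
    exact Real.sqrt_le_sqrt hη.2
  have hqi : MeasureTheory.IntegrableOn kernelWeight J := by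
    have h := (intervalIntegrable_iff_integrableOn_Ioc_of_le hJle).1
      (intervalIntegrable_sqrt_neg_tan (n * Real.pi) (2 * (n * Real.pi)))
    refine h.mono' measurable_kernelWeight.aestronglyMeasurable ?_
    refine (MeasureTheory.ae_restrict_iff' measurableSet_Ioc).2 (Eventually.of_forall fun η hη => ?_)
    rw [Real.norm_of_nonneg (kernelWeight_nonneg _), kernelWeight,
      Real.sqrt_div' _ (hJ0 hη).le]
    refine div_le_self (Real.sqrt_nonneg _) (Real.one_le_sqrt.2 ?_)
    linarith [hη.1]
  -- Each of the `n` periods contributes `I`, and $\sqrt\eta$ is at most its value at the right end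
  -- of `J`. The result has order $\sqrt n$, that is $a^{-1/2}$.
  have hqint : n * I / √(2 * (n * Real.pi)) ≤ ∫ η in J, kernelWeight η := by
    have h1 : ∫ η in J, √(-Real.tan η) = n * I := by
      have h := periodic_sqrt_neg_tan.intervalIntegral_add_zsmul_eq n (n * Real.pi)
        intervalIntegrable_sqrt_neg_tan
      have h2 := periodic_sqrt_neg_tan.intervalIntegral_add_eq (n * Real.pi) 0
      rw [zero_add] at h2
      rw [h2, zsmul_eq_mul, zsmul_eq_mul, Int.cast_natCast, ← two_mul,
        intervalIntegral.integral_of_le hJle] at h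
      exact h
    rw [← h1, ← MeasureTheory.integral_div]
    refine MeasureTheory.setIntegral_mono_on ?_ hqi measurableSet_Ioc hqlow
    exact ((intervalIntegrable_iff_integrableOn_Ioc_of_le hJle).1
      (intervalIntegrable_sqrt_neg_tan _ _)).div_const _
  have hsub : Ioc (a / 2) a ⊆ Ioc 0 H := Ioc_subset_Ioc (by linarith) (by linarith)
  have hxH : x ∈ Icc 0 H := ⟨by linarith [hx.1], by linarith [hx.2]⟩
  have hind : ∀ y, (Ioc (a / 2) a).indicator (fun _ => (1 : ℝ)) y * f y =
      (Ioc (a / 2) a).indicator f y := by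
    intro y
    by_cases hy : y ∈ Ioc (a / 2) a <;> simp [hy]
  have hρf : ∫ y in (0 : ℝ)..H, (Ioc (a / 2) a).indicator (fun _ => (1 : ℝ)) y * f y =
      ∫ y in (a / 2)..a, f y := by
    simp only [hind]
    rw [intervalIntegral.integral_of_le hH.le, intervalIntegral.integral_of_le (by linarith),
      MeasureTheory.setIntegral_indicator measurableSet_Ioc, inter_eq_self_of_subset_right hsub]
  have h := le_whithamL_of_le_green (w := fun _ => w)
    (ρ := (Ioc (a / 2) a).indicator (fun _ => (1 : ℝ))) hH
    hxH hf hC hodd hper h0 measurableSet_Ioc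
    hJ0 (hqi.const_mul w) ?_ ?_
  · rw [hρf, MeasureTheory.integral_const_mul] at h
    refine le_trans (mul_le_mul_of_nonneg_right ?_ ?_) h
    · have h1 : (1 - Real.exp (-H)) * Real.exp (-(4 * Real.pi * H)) * (H * √H) * I / √a ≤
          w * (n * I / √(2 * (n * Real.pi))) := by
        have e1 : √(2 * (n * Real.pi)) = √2 * (√n * √Real.pi) := by
          rw [Real.sqrt_mul (by norm_num), Real.sqrt_mul (by positivity)]
        have hsn : √(H / a) ≤ √n := Real.sqrt_le_sqrt hn1
        have hsn0 : 0 < √(n : ℝ) := Real.sqrt_pos.2 (by linarith)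
        have e2 : w * (n * I / √(2 * (n * Real.pi))) = (1 - Real.exp (-H)) *
            Real.exp (-(4 * Real.pi * H)) * ((n * a) * √n * (√Real.pi / √2)) * I := by
          rw [hw, e1]
          have s1 := Real.sq_sqrt (by linarith : (0 : ℝ) ≤ n)
          have s2 := Real.sq_sqrt hpi.le
          have p1 : √Real.pi ≠ 0 := (Real.sqrt_pos.2 hpi).ne'
          have p2 : √(2 : ℝ) ≠ 0 := by positivity
          field_simp
          rw [s1, s2]
        have e3 : 1 ≤ √Real.pi / √2 := by
          rw [le_div_iff₀ (by positivity), one_mul]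
          exact Real.sqrt_le_sqrt (by linarith [Real.pi_gt_three])
        have e4 : H ≤ n * a := by
          rw [div_le_iff₀ ha] at hn1
          exact hn1
        have e5 : H * √H / √a ≤ (n * a) * √n * (√Real.pi / √2) := by
          calc H * √H / √a = H * √(H / a) * 1 := by rw [Real.sqrt_div hH.le]; ring
            _ ≤ _ := by gcongr
        rw [e2]
        calc _ = (1 - Real.exp (-H)) * Real.exp (-(4 * Real.pi * H)) * (H * √H / √a) * I := by ring
          _ ≤ _ := by gcongr
      calc _ = 1 / Real.pi *
            ((1 - Real.exp (-H)) * Real.exp (-(4 * Real.pi * H)) * (H * √H) * I / √a) := by ring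
        _ ≤ 1 / Real.pi * (w * ∫ η in J, kernelWeight η) := by
            refine mul_le_mul_of_nonneg_left (h1.trans ?_) (by positivity)
            exact mul_le_mul_of_nonneg_left hqint hw0.le
    · exact intervalIntegral.integral_nonneg (by linarith) fun y hy =>
        h0 y ⟨by linarith [hy.1], by linarith [hy.2]⟩
  · simp only [hind]
    rw [intervalIntegrable_iff_integrableOn_Ioc_of_le hH.le]
    exact ((hf.intervalIntegrable 0 H).1).indicator measurableSet_Ioc
  · intro η hη y hy
    have hη0 : 0 < η := hJ0 hη
    by_cases hya : y ∈ Ioc (a / 2) a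
    · rw [indicator_of_mem hya, mul_one]
      refine le_trans ?_ (dirichletGreen_ge_near_zero (by linarith [hη.1]) hH ha haH hx
        ⟨hya.1.le, hya.2⟩)
      have h1 : Real.exp (-(4 * Real.pi * H)) ≤ Real.exp (-(η * a)) := by
        refine Real.exp_le_exp.2 (neg_le_neg ?_)
        calc η * a ≤ 2 * (n * Real.pi) * a := mul_le_mul_of_nonneg_right hη.2 ha.le
          _ = 2 * Real.pi * (n * a) := by ring
          _ ≤ 2 * Real.pi * (2 * H) := by gcongr
          _ = _ := by ring
      have h2 := hη.1.le
      rw [hw]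
      gcongr
    · rw [indicator_of_notMem hya, mul_zero]
      exact dirichletGreen_nonneg hη0 hH hxH hy

/-- An odd $2H$-periodic function is odd about every point of $H\mathbb Z$, so `abs_whithamL_le`
applies after translating the nearest lattice point to the origin. -/
theorem abs_whithamL_le_latticeDist {H β : ℝ} (hH : 0 < H) (hβ : 1 / 2 < β) (hβ1 : β ≤ 1) :
    ∃ A : ℝ, 0 < A ∧ ∀ (f : ℝ → ℝ) (B C : ℝ), Continuous f → (∀ y, |f y| ≤ C) →
      Function.Odd f → Function.Periodic f (2 * H) → 0 ≤ B →
      (∀ y, |f y| ≤ B * latticeDist H y ^ β) →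
      ∀ x, |whithamL f x| ≤ A * B * latticeDist H x := by
  obtain ⟨A, hA, hL⟩ := abs_whithamL_le hβ hβ1
  refine ⟨A * H⁻¹ ^ β * H, by positivity, ?_⟩
  intro f B C hf hC hodd hper hB0 hB x
  obtain ⟨k, hk⟩ := exists_latticeDist_eq hH x
  have h := hL (fun y => f (y + k * H)) (B * H⁻¹ ^ β) C
    (hf.comp (continuous_add_const _)).measurable (fun y => hC _) ?_ ?_ (x - k * H)
  · rw [whithamL_comp_add, sub_add_cancel, hk] at h
    exact h.trans (le_of_eq (by ring))
  · intro y
    have e : -y + k * H = -(y + k * H - k * (2 * H)) := by ring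
    beta_reduce
    rw [e, hodd, hper.sub_int_mul_eq]
  · intro y
    refine (hB _).trans ?_
    rw [mul_assoc]
    refine mul_le_mul_of_nonneg_left ?_ hB0
    rw [← Real.mul_rpow (by positivity) (abs_nonneg _)]
    refine Real.rpow_le_rpow (latticeDist_nonneg _ _) ?_ (by linarith)
    refine (latticeDist_le hH _ k).trans (le_of_eq ?_)
    rw [add_sub_cancel_right, inv_mul_eq_div]

/-! ### Reflection differences -/

/-- The difference of the values of `g` at the two points at distance `h` from `a`. -/
def reflDiff (g : ℝ → ℝ) (a h : ℝ) : ℝ := g (a - h) - g (a + h)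

/-- This symmetry is used throughout: an estimate obtained in one variable through $L$ transfers to
the other. -/
theorem reflDiff_comm {g : ℝ → ℝ} (hg : Function.Even g) (a h : ℝ) :
    reflDiff g a h = reflDiff g h a := by
  rw [reflDiff, reflDiff, ← hg (a - h), neg_sub, add_comm]

theorem reflDiff_odd {g : ℝ → ℝ} (hg : Function.Even g) (h : ℝ) :
    Function.Odd fun a => reflDiff g a h := by
  intro a
  simp only [reflDiff]
  rw [← hg (-a - h), ← hg (-a + h)]
  ring_nf

theorem reflDiff_periodic {g : ℝ → ℝ} {T : ℝ} (hg : Function.Periodic g T) (h : ℝ) :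
    Function.Periodic (fun a => reflDiff g a h) T := by
  intro a
  simp only [reflDiff]
  rw [add_sub_right_comm, hg, add_right_comm, hg]

theorem continuous_reflDiff {g : ℝ → ℝ} (hg : Continuous g) :
    Continuous fun p : ℝ × ℝ => reflDiff g p.1 p.2 := by
  unfold reflDiff
  fun_prop

theorem continuous_reflDiff_left {g : ℝ → ℝ} (hg : Continuous g) (h : ℝ) :
    Continuous fun a => reflDiff g a h := by
  unfold reflDiff
  fun_prop

theorem abs_reflDiff_le {g : ℝ → ℝ} {C : ℝ} (hC : ∀ x, |g x| ≤ C) (a h : ℝ) :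
    |reflDiff g a h| ≤ C + C :=
  (abs_sub _ _).trans (add_le_add (hC _) (hC _))

theorem whithamL_reflDiff {g : ℝ → ℝ} {C : ℝ} (hg : Continuous g) (hC : ∀ x, |g x| ≤ C)
    (a h : ℝ) :
    whithamL (fun x => reflDiff g x h) a = whithamL g (a - h) - whithamL g (a + h) := by
  have h1 := whithamL_sub (f := fun x => g (x + -h)) (g := fun x => g (x + h)) (C := C) (D := C)
    (by fun_prop) (by fun_prop) (fun x => hC _) (fun x => hC _) a
  rw [whithamL_comp_add, whithamL_comp_add] at h1
  exact h1

/-- Subtract the equation at the two points; the difference of squares factors. The nonlinear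
equation becomes linear in the reflection difference, with a coefficient that is nonnegative when
$\varphi\le\mu/2$. -/
theorem IsWhithamSolution.reflDiff_eq {P μ : ℝ} {φ : ℝ → ℝ} (hφ : IsWhithamSolution P μ φ)
    (a h : ℝ) : (μ - φ (a - h) - φ (a + h)) * reflDiff φ a h =
      whithamL (fun x => reflDiff φ x h) a := by
  obtain ⟨C, hC⟩ := hφ.bounded
  rw [whithamL_reflDiff hφ.continuous hC]
  have h1 := hφ.equation (a - h)
  have h2 := hφ.equation (a + h)
  simp only [reflDiff]
  linear_combination h2 - h1

/-- By symmetry $h\le a$. If $a+h$ lies beyond $H$ it is reflected to $2H-(a+h)$, which is still to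
the right of $a-h$ because $a\le H$. -/
theorem reflDiff_nonneg_of_antitoneOn {g : ℝ → ℝ} {H : ℝ} (heven : Function.Even g)
    (hper : Function.Periodic g (2 * H)) (hanti : AntitoneOn g (Icc 0 H)) {a h : ℝ}
    (ha : a ∈ Icc 0 H) (hh : h ∈ Icc 0 H) : 0 ≤ reflDiff g a h := by
  wlog hle : h ≤ a generalizing a h
  · rw [reflDiff_comm heven]
    exact this hh ha (le_of_not_ge hle)
  rw [reflDiff, sub_nonneg]
  rcases le_total (a + h) H with hs | hs
  · exact hanti ⟨by linarith, by linarith [hh.1]⟩ ⟨by linarith [ha.1, hh.1], hs⟩ (by linarith [hh.1])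
  · have e : g (a + h) = g (2 * H - (a + h)) := by
      rw [hper.sub_eq', heven]
    rw [e]
    exact hanti ⟨by linarith, by linarith [ha.2, hh.1]⟩
      ⟨by linarith [ha.2, hh.2], by linarith⟩ (by linarith [ha.2])

theorem antitoneOn_of_reflDiff_nonneg {g : ℝ → ℝ} {H : ℝ}
    (h0 : ∀ a ∈ Icc 0 H, ∀ h ∈ Icc 0 H, 0 ≤ reflDiff g a h) : AntitoneOn g (Icc 0 H) := by
  intro u hu v hv huv
  have h := h0 ((u + v) / 2) ⟨by linarith [hu.1, hv.1], by linarith [hu.2, hv.2]⟩ ((v - u) / 2)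
    ⟨by linarith, by linarith [hu.1, hv.2, hv.1]⟩
  rw [reflDiff, sub_nonneg] at h
  have e1 : (u + v) / 2 - (v - u) / 2 = u := by ring
  have e2 : (u + v) / 2 + (v - u) / 2 = v := by ring
  rwa [e1, e2] at h

theorem exists_reflDiff_ne_zero {g : ℝ → ℝ} {H : ℝ} (hH : 0 < H)
    (hper : Function.Periodic g (2 * H)) (hnc : ¬ ∃ c : ℝ, ∀ x, g x = c) :
    ∃ a ∈ Ioo 0 H, reflDiff g a a ≠ 0 := by
  by_contra! hcon
  refine hnc ⟨g 0, fun x => ?_⟩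
  obtain ⟨y, hy, hxy⟩ := hper.exists_mem_Ico (by linarith) x 0
  rw [hxy]
  rcases hy.1.eq_or_lt with h | h
  · rw [h]
  have h1 := hcon (y / 2) ⟨by linarith, by linarith [hy.2]⟩
  rw [reflDiff, sub_self, add_halves, sub_eq_zero] at h1
  exact h1.symm

/-- Strict positivity of $L$ gives $F(a,h)\ge\frac{c}{D_m}W(a)E(h)$ with $E(h)=\int_0^H
W(y)F(y,h)\,dy$. Using the same bound with the variables exchanged inside $E$ gives
$E(h)\ge\frac{c}{D_m}W(h)T$, where $T=\int_0^H WE$. Nonconstancy makes $T$ positive. -/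
theorem exists_reflDiff_ge {H Dm : ℝ} {g : ℝ → ℝ} {D : ℝ → ℝ → ℝ} (hH : 0 < H)
    (hg : Continuous g) (hb : ∃ C, ∀ x, |g x| ≤ C) (heven : Function.Even g)
    (hper : Function.Periodic g (2 * H)) (hnc : ¬ ∃ c : ℝ, ∀ x, g x = c)
    (heq : ∀ a h, D a h * reflDiff g a h = whithamL (fun x => reflDiff g x h) a)
    (hD : ∀ a h, D a h ≤ Dm)
    (h0 : ∀ a ∈ Icc 0 H, ∀ h ∈ Icc 0 H, 0 ≤ reflDiff g a h) :
    ∃ c : ℝ, 0 < c ∧ ∀ a ∈ Icc 0 H, ∀ h ∈ Icc 0 H,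
      c * latticeDist H a * latticeDist H h ≤ reflDiff g a h := by
  obtain ⟨C, hC⟩ := hb
  obtain ⟨c, hc, hL⟩ := exists_whithamL_ge_latticeDist hH
  wlog hDm : 0 < Dm generalizing Dm
  · exact this (Dm := 1) (fun a h => (hD a h).trans (by linarith)) one_pos
  set E : ℝ → ℝ := fun h => ∫ y in (0 : ℝ)..H, latticeDist H y * reflDiff g y h with hE
  have hWc := continuous_latticeDist hH
  have hEc : Continuous E := by
    refine intervalIntegral.continuous_parametric_intervalIntegral_of_continuous' ?_ 0 H
    exact (hWc.comp continuous_snd).mul ((continuous_reflDiff hg).comp continuous_swap)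
  have hint : ∀ h, Continuous fun y => latticeDist H y * reflDiff g y h := fun h =>
    hWc.mul (continuous_reflDiff_left hg h)
  have hE0 : ∀ h ∈ Icc 0 H, 0 ≤ E h := fun h hh =>
    intervalIntegral.integral_nonneg hH.le fun y hy =>
      mul_nonneg (latticeDist_nonneg _ _) (h0 y hy h hh)
  have hF : ∀ a ∈ Icc 0 H, ∀ h ∈ Icc 0 H, c / Dm * latticeDist H a * E h ≤ reflDiff g a h := by
    intro a ha h hh
    have h1 := hL (fun x => reflDiff g x h) (C + C) (continuous_reflDiff_left hg h)
      (fun y => abs_reflDiff_le hC y h) (reflDiff_odd heven h) (reflDiff_periodic hper h)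
      (fun y hy => h0 y hy h hh) a ha
    rw [← heq] at h1
    have h2 := mul_le_mul_of_nonneg_right (hD a h) (h0 a ha h hh)
    have h3 : c * latticeDist H a * E h ≤ Dm * reflDiff g a h := h1.trans h2
    calc c / Dm * latticeDist H a * E h = (c * latticeDist H a * E h) / Dm := by ring
      _ ≤ reflDiff g a h := by
          rw [div_le_iff₀ hDm]
          linarith
  set T := ∫ y in (0 : ℝ)..H, latticeDist H y * E y with hT
  have hEh : ∀ h ∈ Icc 0 H, c / Dm * latticeDist H h * T ≤ E h := by
    intro h hh
    rw [hT, ← intervalIntegral.integral_const_mul]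
    refine intervalIntegral.integral_mono_on hH.le
      ((continuous_const.mul (hWc.mul hEc)).intervalIntegrable _ _)
      ((hint h).intervalIntegrable _ _) fun y hy => ?_
    have h1 := hF h hh y hy
    rw [reflDiff_comm heven] at h1
    have h2 := mul_le_mul_of_nonneg_left h1 (latticeDist_nonneg H y)
    linarith
  -- The diagonal value is $g(0)-g(2a)$, so a nonconstant profile has a nonzero one. Continuity then
  -- gives $E(a)>0$, and again $T>0$.
  obtain ⟨a, ha, hne⟩ := exists_reflDiff_ne_zero hH hper hnc
  have ha' := Ioo_subset_Icc_self ha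
  have hEa : 0 < E a := by
    refine intervalIntegral.integral_pos hH (hint a).continuousOn (fun y hy => ?_) ⟨a, ha', ?_⟩
    · exact mul_nonneg (latticeDist_nonneg _ _) (h0 y (Ioc_subset_Icc_self hy) a ha')
    · exact mul_pos (latticeDist_pos hH ha) (lt_of_le_of_ne (h0 a ha' a ha') hne.symm)
  have hTpos : 0 < T := by
    refine intervalIntegral.integral_pos hH (hWc.mul hEc).continuousOn (fun y hy => ?_) ⟨a, ha', ?_⟩
    · exact mul_nonneg (latticeDist_nonneg _ _) (hE0 y (Ioc_subset_Icc_self hy))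
    · exact mul_pos (latticeDist_pos hH ha) hEa
  refine ⟨c / Dm * (c / Dm) * T, by positivity, ?_⟩
  intro a ha h hh
  refine le_trans ?_ (hF a ha h hh)
  have h1 := mul_le_mul_of_nonneg_left (hEh h hh)
    (mul_nonneg (div_pos hc hDm).le (latticeDist_nonneg H a))
  linarith

/-! ### Monotone waves -/

namespace IsMonotoneWave

variable {P μ : ℝ} {φ : ℝ → ℝ}

theorem periodic_two_mul (hφ : IsMonotoneWave P μ φ) : Function.Periodic φ (2 * (P / 2)) := by
  rw [mul_div_cancel₀ _ (two_ne_zero' ℝ)]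
  exact hφ.solution.periodic

theorem antitoneOn (hP : 0 < P) (hφ : IsMonotoneWave P μ φ) : AntitoneOn φ (Icc 0 (P / 2)) := by
  have h1 : AntitoneOn φ (Ioo 0 (P / 2)) := by
    intro u hu v hv huv
    rw [← hφ.even u, ← hφ.even v]
    exact hφ.monotone ⟨by linarith [hv.2], by linarith [hv.1]⟩
      ⟨by linarith [hu.2], by linarith [hu.1]⟩ (by linarith)
  have hcont := hφ.solution.continuous
  intro u hu v hv huv
  -- Contracting slightly towards the midpoint $P/4$ moves the closed interval into the open one and
  -- preserves order, so the endpoints are reached by continuity.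
  have hlim : ∀ x : ℝ, Tendsto (fun t : ℝ => φ (x + t * (P / 4 - x))) (𝓝[>] 0) (𝓝 (φ x)) := by
    intro x
    have hc : Continuous fun t : ℝ => φ (x + t * (P / 4 - x)) := by fun_prop
    have h := (hc.tendsto 0).mono_left (nhdsWithin_le_nhds (s := Ioi 0))
    simpa using h
  have hmem : ∀ x ∈ Icc 0 (P / 2), ∀ t ∈ Ioo (0 : ℝ) 1, x + t * (P / 4 - x) ∈ Ioo 0 (P / 2) := by
    intro x hx t ht
    constructor <;> nlinarith [hx.1, hx.2, ht.1, ht.2, mul_pos ht.1 hP]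
  refine le_of_tendsto_of_tendsto (hlim v) (hlim u) ?_
  filter_upwards [Ioo_mem_nhdsGT one_pos] with t ht
  exact h1 (hmem u hu t ht) (hmem v hv t ht) (by nlinarith [ht.2])

theorem reflDiff_nonneg (hP : 0 < P) (hφ : IsMonotoneWave P μ φ) {a h : ℝ}
    (ha : a ∈ Icc 0 (P / 2)) (hh : h ∈ Icc 0 (P / 2)) : 0 ≤ reflDiff φ a h :=
  reflDiff_nonneg_of_antitoneOn hφ.even hφ.periodic_two_mul (hφ.antitoneOn hP) ha hh

theorem reflDiff_pos (hP : 0 < P) (hφ : IsMonotoneWave P μ φ) {a h : ℝ}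
    (ha : a ∈ Ioo 0 (P / 2)) (hh : h ∈ Ioo 0 (P / 2)) : 0 < reflDiff φ a h := by
  have hH : 0 < P / 2 := by positivity
  obtain ⟨C, hC⟩ := hφ.solution.bounded
  obtain ⟨c, hc, h⟩ := exists_reflDiff_ge (D := fun a h => μ - φ (a - h) - φ (a + h))
    (Dm := μ + C + C) hH hφ.solution.continuous hφ.solution.bounded hφ.even hφ.periodic_two_mul
    hφ.nonconstant hφ.solution.reflDiff_eq
    (fun a h => by linarith [(abs_le.1 (hC (a - h))).1, (abs_le.1 (hC (a + h))).1])
    (fun a ha h hh => hφ.reflDiff_nonneg hP ha hh)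
  refine lt_of_lt_of_le ?_ (h a (Ioo_subset_Icc_self ha) _ (Ioo_subset_Icc_self hh))
  have := latticeDist_pos hH ha
  have := latticeDist_pos hH hh
  positivity

theorem mem_Icc_apply (hP : 0 < P) (hφ : IsMonotoneWave P μ φ) (x : ℝ) :
    φ x ∈ Icc (φ (P / 2)) (φ 0) := by
  obtain ⟨y, hy, hxy⟩ := hφ.periodic_two_mul.exists_mem_Ico (by linarith) x (-(P / 2))
  have hy' : |y| ∈ Icc 0 (P / 2) := ⟨abs_nonneg y, abs_le.2 ⟨hy.1, by linarith [hy.2]⟩⟩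
  have e : φ x = φ |y| := by
    rcases abs_choice y with h | h <;> rw [h, hxy]
    exact (hφ.even y).symm
  rw [e]
  exact ⟨hφ.antitoneOn hP hy' (right_mem_Icc.2 (by linarith)) hy'.2,
    hφ.antitoneOn hP (left_mem_Icc.2 (by linarith)) hy' hy'.1⟩

theorem apply_half_lt_apply_zero (hP : 0 < P) (hφ : IsMonotoneWave P μ φ) :
    φ (P / 2) < φ 0 := by
  by_contra! h
  exact hφ.nonconstant ⟨φ 0, fun x => le_antisymm (hφ.mem_Icc_apply hP x).2
    (h.trans (hφ.mem_Icc_apply hP x).1)⟩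

end IsMonotoneWave

/-! ### The square root bound and the lower bound on the speed -/

theorem integral_whithamKernel_pos : 0 < ∫ z, whithamKernel z := by
  rw [MeasureTheory.integral_pos_iff_support_of_nonneg_ae _ integrable_whithamKernel]
  · refine lt_of_lt_of_le ?_ (MeasureTheory.measure_mono
      (s := Ioi (0 : ℝ)) fun z hz => (whithamKernel_pos (ne_of_gt hz)).ne')
    simp
  · filter_upwards [MeasureTheory.Measure.ae_ne MeasureTheory.volume (0 : ℝ)] with z hz
    exact (whithamKernel_pos hz).le

theorem sub_whithamL {f : ℝ → ℝ} (hf : Measurable f) {C : ℝ} (hC : ∀ x, |f x| ≤ C) (M x : ℝ) :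
    (∫ z, whithamKernel z) * M - whithamL f x = ∫ z, whithamKernel z * (M - f (x - z)) := by
  rw [whithamL_eq_integral_sub, ← MeasureTheory.integral_mul_const,
    ← MeasureTheory.integral_sub (integrable_whithamKernel.mul_const M)
      (integrable_whithamKernel_mul hf hC x)]
  congr 1
  funext z
  ring

/-- For small $h$ and $x\in[a/2,a]$, the coefficient of $F(x,h)$ is at most $\mu-2\varphi(a+h)$ by
monotonicity, while $LF\ge\frac{c}{\sqrt a}\int_{a/2}^aF$. Integrating in $x$ puts the same positive
integral on both sides. Its size is irrelevant, so the constant does not depend on the wave. -/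
theorem exists_sqrt_le_half_sub_of_le {P : ℝ} (hP : 0 < P) : ∃ C : ℝ, 0 < C ∧
    ∀ (μ : ℝ) (φ : ℝ → ℝ), IsMonotoneWave P μ φ → ∀ a, 0 < a → a ≤ P / 4 →
      C * √a ≤ μ / 2 - φ a := by
  have hH : 0 < P / 2 := by positivity
  obtain ⟨c, hc, hL⟩ := exists_whithamL_ge_near_zero hH
  refine ⟨c / 4, by positivity, ?_⟩
  intro μ φ hφ a ha haP
  have hanti := hφ.antitoneOn hP
  obtain ⟨C, hC⟩ := hφ.solution.bounded
  have key : ∀ h ∈ Ioo 0 (a / 2), c / 2 * √a ≤ μ - 2 * φ (a + h) := by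
    intro h hh
    have hhP : h ∈ Ioo 0 (P / 2) := ⟨hh.1, by linarith [hh.2]⟩
    have hcont := continuous_reflDiff_left hφ.solution.continuous h
    set I := ∫ y in (a / 2)..a, reflDiff φ y h with hI
    have hIpos : 0 < I := by
      refine intervalIntegral.intervalIntegral_pos_of_pos_on (hcont.intervalIntegrable _ _) ?_
        (by linarith)
      intro y hy
      exact hφ.reflDiff_pos hP ⟨by linarith [hy.1], by linarith [hy.2]⟩ hhP
    have hpt : ∀ x ∈ Icc (a / 2) a, c / √a * I ≤ (μ - 2 * φ (a + h)) * reflDiff φ x h := by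
      intro x hx
      refine (hL (fun x => reflDiff φ x h) (C + C) hcont (fun y => abs_reflDiff_le hC y h)
        (reflDiff_odd hφ.even h) (reflDiff_periodic hφ.periodic_two_mul h)
        (fun y hy => hφ.reflDiff_nonneg hP hy (Ioo_subset_Icc_self hhP)) a ha (by linarith) x
        hx).trans ?_
      rw [← hφ.solution.reflDiff_eq]
      refine mul_le_mul_of_nonneg_right ?_
        (hφ.reflDiff_nonneg hP ⟨by linarith [hx.1], by linarith [hx.2]⟩ (Ioo_subset_Icc_self hhP))
      have hm : a + h ∈ Icc 0 (P / 2) := ⟨by linarith [hh.1], by linarith [hh.2]⟩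
      have h1 := hanti (a := x - h) ⟨by linarith [hx.1, hh.2], by linarith [hx.2, hh.1]⟩ hm
        (by linarith [hx.2, hh.1])
      have h2 := hanti (a := x + h) ⟨by linarith [hx.1, hh.1], by linarith [hx.2, hh.2]⟩ hm
        (by linarith [hx.2])
      linarith
    have h3 : (a - a / 2) * (c / √a * I) ≤ (μ - 2 * φ (a + h)) * I := by
      have h5 : ∫ _x in (a / 2)..a, c / √a * I ≤
          ∫ x in (a / 2)..a, (μ - 2 * φ (a + h)) * reflDiff φ x h :=
        intervalIntegral.integral_mono_on (by linarith) (continuous_const.intervalIntegrable _ _)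
          ((continuous_const.mul hcont).intervalIntegrable _ _) hpt
      rwa [intervalIntegral.integral_const, smul_eq_mul, intervalIntegral.integral_const_mul] at h5
    refine le_of_mul_le_mul_right (le_trans (le_of_eq ?_) h3) hIpos
    have hs := Real.sq_sqrt ha.le
    have hs0 : √a ≠ 0 := (Real.sqrt_pos.2 ha).ne'
    field_simp
    rw [hs]
    ring
  -- The integral that was cancelled tends to zero with `h`, but the inequality left after
  -- cancelling it passes to the limit.
  have hlim : Tendsto (fun h => μ - 2 * φ (a + h)) (𝓝[>] 0) (𝓝 (μ - 2 * φ (a + 0))) := by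
    have hcont := hφ.solution.continuous
    have : Continuous fun h => μ - 2 * φ (a + h) := by fun_prop
    exact (this.tendsto 0).mono_left nhdsWithin_le_nhds
  rw [add_zero] at hlim
  have h4 := ge_of_tendsto hlim
    (eventually_of_mem (Ioo_mem_nhdsGT (by linarith : (0 : ℝ) < a / 2)) key)
  linarith

/-- The square root lower bound for the distance of a monotone wave to its largest possible
height. -/
theorem exists_sqrt_le_half_sub {P : ℝ} (hP : 0 < P) : ∃ C : ℝ, 0 < C ∧
    ∀ (μ : ℝ) (φ : ℝ → ℝ), IsMonotoneWave P μ φ → ∀ a ∈ Ioc 0 (P / 2),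
      C * √a ≤ μ / 2 - φ a := by
  obtain ⟨C, hC, h⟩ := exists_sqrt_le_half_sub_of_le hP
  refine ⟨C / 2, by positivity, ?_⟩
  intro μ φ hφ a ha
  rcases le_total a (P / 4) with h1 | h1
  · have h2 := h μ φ hφ a ha.1 h1
    have := Real.sqrt_nonneg a
    nlinarith
  · have h2 := h μ φ hφ (P / 4) (by positivity) le_rfl
    have h3 := hφ.antitoneOn hP ⟨by positivity, by linarith⟩ (Ioc_subset_Icc_self ha) h1
    have h4 : √a / 2 ≤ √(P / 4) := by
      rw [div_le_iff₀ (by norm_num)]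
      refine Real.sqrt_le_iff.2 ⟨by positivity, ?_⟩
      rw [mul_pow, Real.sq_sqrt (by positivity)]
      linarith [ha.2]
    nlinarith

/-- Only $\mu<\kappa=\int K$ needs an argument. At the crest, $\kappa
M-L\varphi(0)=M(M+\kappa-\mu)\le\kappa\mu/2$, while positivity of $K$ bounds the left side below by
$k(M-\varphi(P/4))$. So $\varphi(P/4)$ is within $O(\mu)$ of the crest $M\ge0$, whereas the square
root bound keeps $\mu/2-\varphi(P/4)$ above a fixed constant. -/
theorem exists_le_speed {P : ℝ} (hP : 0 < P) : ∃ c : ℝ, 0 < c ∧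
    ∀ (μ : ℝ) (φ : ℝ → ℝ), IsMonotoneWave P μ φ → c ≤ μ := by
  obtain ⟨C, hC, hsqrt⟩ := exists_sqrt_le_half_sub hP
  set κ := ∫ z, whithamKernel z with hκ
  have hκ0 : 0 < κ := integral_whithamKernel_pos
  set k := whithamKernel (P / 2) * (P / 4) with hk
  have hk0 : 0 < k := mul_pos (whithamKernel_pos (by positivity)) (by positivity)
  set l := C * √(P / 4) with hl
  have hl0 : 0 < l := by positivity
  refine ⟨min κ (l / (1 / 2 + κ / (2 * k))), by positivity, ?_⟩
  intro μ φ hφ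
  rcases le_or_gt κ μ with hμ | hμ
  · exact (min_le_left _ _).trans hμ
  refine (min_le_right _ _).trans ?_
  obtain ⟨B, hB⟩ := hφ.solution.bounded
  have hmeas := hφ.solution.continuous.measurable
  set M := φ 0 with hM
  set m := φ (P / 2) with hm
  have hmM : m < M := hφ.apply_half_lt_apply_zero hP
  have hnn : ∀ᵐ z, 0 ≤ whithamKernel z := by
    filter_upwards [MeasureTheory.Measure.ae_ne MeasureTheory.volume (0 : ℝ)] with z hz
    exact (whithamKernel_pos hz).le
  have hmax : 0 ≤ κ * M - whithamL φ 0 := by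
    rw [sub_whithamL hmeas hB]
    refine MeasureTheory.integral_nonneg_of_ae ?_
    filter_upwards [hnn] with z hz
    exact mul_nonneg hz (sub_nonneg.2 (hφ.mem_Icc_apply hP _).2)
  have hmin : κ * m - whithamL φ (P / 2) ≤ 0 := by
    rw [sub_whithamL hmeas hB]
    refine MeasureTheory.integral_nonpos_of_ae ?_
    filter_upwards [hnn] with z hz
    exact mul_nonpos_of_nonneg_of_nonpos hz (sub_nonpos.2 (hφ.mem_Icc_apply hP _).1)
  have hlow : k * (M - φ (P / 4)) ≤ κ * M - whithamL φ 0 := by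
    rw [sub_whithamL hmeas hB]
    have hint : MeasureTheory.Integrable fun z => whithamKernel z * (M - φ (0 - z)) := by
      have h := (integrable_whithamKernel.mul_const M).sub (integrable_whithamKernel_mul hmeas hB 0)
      refine h.congr (Eventually.of_forall fun z => ?_)
      simp only [Pi.sub_apply]
      ring
    have h1 : ∫ z in Ioc (P / 4) (P / 2), whithamKernel z * (M - φ (0 - z)) ≤
        ∫ z, whithamKernel z * (M - φ (0 - z)) := by
      refine MeasureTheory.setIntegral_le_integral hint ?_
      filter_upwards [hnn] with z hz
      exact mul_nonneg hz (sub_nonneg.2 (hφ.mem_Icc_apply hP _).2)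
    refine le_trans ?_ h1
    have h2 : ∫ _z in Ioc (P / 4) (P / 2), whithamKernel (P / 2) * (M - φ (P / 4)) =
        k * (M - φ (P / 4)) := by
      rw [MeasureTheory.setIntegral_const, Real.volume_real_Ioc_of_le (by linarith), smul_eq_mul, hk]
      ring
    rw [← h2]
    refine MeasureTheory.setIntegral_mono_on (MeasureTheory.integrableOn_const (by simp)) hint.integrableOn measurableSet_Ioc
      fun z hz => ?_
    have hz0 : 0 < z := lt_trans (by positivity) hz.1
    have h3 := whithamKernel_antitoneOn (mem_Ioi.2 hz0) (mem_Ioi.2 (by positivity : 0 < P / 2)) hz.2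
    have h4 := hφ.antitoneOn hP (a := P / 4) ⟨by positivity, by linarith⟩ ⟨hz0.le, hz.2⟩ hz.1.le
    rw [zero_sub, hφ.even z]
    have h5 := (hφ.mem_Icc_apply hP (P / 4)).2
    exact mul_le_mul h3 (by linarith) (by linarith) (whithamKernel_pos hz0.ne').le
  have e0 := hφ.solution.equation 0
  have e1 := hφ.solution.equation (P / 2)
  rw [← hM] at e0
  rw [← hm] at e1
  have hMμ : M ≤ μ / 2 := hφ.le_half 0
  -- At the trough $m(m+\kappa-\mu)\le0$; if $m<\mu-\kappa<0$, both factors would be negative.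
  have hm0 : μ - κ ≤ m := by
    by_contra! h
    nlinarith
  -- At the crest $M(M+\kappa-\mu)\ge0$, and the second factor is positive because
  -- $M>m\ge\mu-\kappa$.
  have hM0 : 0 ≤ M := by
    by_contra! h
    have : 0 < M + (κ - μ) := by linarith
    nlinarith
  have hM1 : κ * M - whithamL φ 0 ≤ κ * (μ / 2) := by nlinarith
  have h6 := hsqrt μ φ hφ (P / 4) ⟨by positivity, by linarith⟩
  rw [← hl] at h6
  have h7 : M - φ (P / 4) ≤ κ * (μ / 2) / k := by
    rw [le_div_iff₀ hk0]
    linarith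
  rw [div_le_iff₀ (by positivity)]
  calc l ≤ μ / 2 - φ (P / 4) := h6
    _ ≤ μ / 2 + κ * (μ / 2) / k := by linarith
    _ = μ * (1 / 2 + κ / (2 * k)) := by
        field_simp

/-! ### The regularity bootstrap -/

theorem rpow_mul_rpow_of_add_eq {x s t u : ℝ} (hx : 0 ≤ x) (hs : 0 < s) (ht : 0 < t)
    (h : s + t = u) : x ^ s * x ^ t = x ^ u := by
  rw [← Real.rpow_add_of_nonneg hx hs.le ht.le, h]

theorem min_le_rpow_mul_rpow {x y s t : ℝ} (hx : 0 ≤ x) (hy : 0 ≤ y) (hs : 0 < s) (ht : 0 < t)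
    (hst : s + t = 1) : min x y ≤ x ^ s * y ^ t := by
  rcases le_total x y with h | h
  · rw [min_eq_left h]
    calc x = x ^ s * x ^ t := by rw [rpow_mul_rpow_of_add_eq hx hs ht hst, Real.rpow_one]
      _ ≤ _ := by gcongr
  · rw [min_eq_right h]
    calc y = y ^ s * y ^ t := by rw [rpow_mul_rpow_of_add_eq hy hs ht hst, Real.rpow_one]
      _ ≤ _ := by gcongr

/-- Regularity bootstrap: a reflection difference that is `O(W(a) ^ α)`, `α > 1 / 2`, and that
solves the linear equation `D F = L F` up to an error `O(W(a) W(h))` is itself `O(W(a) W(h))`,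
where `W` is the distance to the lattice. -/
theorem exists_reflDiff_le {H α δ : ℝ} (hH : 0 < H) (hα : 1 / 2 < α) (hα1 : α ≤ 1) (hδ : 0 < δ) :
    ∃ A : ℝ, 0 < A ∧ ∀ (r : ℝ → ℝ) (D : ℝ → ℝ → ℝ) (N : ℝ), Continuous r → (∃ C, ∀ x, |r x| ≤ C) →
      Function.Even r → Function.Periodic r (2 * H) → 0 ≤ N → (∀ a h, δ ≤ D a h) →
      (∀ a h, |D a h * reflDiff r a h - whithamL (fun x => reflDiff r x h) a| ≤
        N * latticeDist H a * latticeDist H h) →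
      (∀ a h, |reflDiff r a h| ≤ N * latticeDist H a ^ α) →
      ∀ a h, |reflDiff r a h| ≤ A * N * latticeDist H a * latticeDist H h := by
  obtain ⟨A₁, hA₁, hL₁⟩ := abs_whithamL_le_latticeDist hH hα hα1
  obtain ⟨A₂, hA₂, hL₂⟩ := abs_whithamL_le_latticeDist (β := 5 / 8) hH (by norm_num) (by norm_num)
  obtain ⟨A₃, hA₃, hL₃⟩ := abs_whithamL_le_latticeDist (β := 3 / 4) hH (by norm_num) (by norm_num)
  set B₁ := (A₁ * 1 + 1) / δ with hB₁
  set B₂ := (A₂ * B₁ + 1) / δ with hB₂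
  set B₃ := (A₂ * B₂ + 1) / δ with hB₃
  set B₄ := (A₃ * B₃ + 1) / δ with hB₄
  have p₁ : 0 < B₁ := by positivity
  have p₂ : 0 < B₂ := by positivity
  have p₃ : 0 < B₃ := by positivity
  refine ⟨B₄, by positivity, ?_⟩
  intro r D N hr hb heven hper hN hD herr hinit
  obtain ⟨C, hC⟩ := hb
  set W := latticeDist H with hW
  have hW0 : ∀ x, 0 ≤ W x := latticeDist_nonneg H
  have hW1 : ∀ x, W x ≤ 1 := latticeDist_le_one H
  have hWp : ∀ (s : ℝ) (x : ℝ), s ≤ 1 → 0 < s → W x ≤ W x ^ s := by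
    intro s x hs hs0
    have := Real.rpow_le_rpow_of_exponent_ge_of_imp (hW0 x) (hW1 x) hs (fun _ h => by linarith)
    rwa [Real.rpow_one] at this
  -- One round: for fixed `h`, applying $L$ raises $W(a)^\beta$ to $W(a)$, and division by
  -- $D\ge\delta$ returns to $F$. The factor `V h` is carried along and must dominate `W h` to
  -- absorb the error.
  have step : ∀ (β A B : ℝ) (V : ℝ → ℝ),
      (∀ (f : ℝ → ℝ) (B C : ℝ), Continuous f → (∀ y, |f y| ≤ C) →
        Function.Odd f → Function.Periodic f (2 * H) → 0 ≤ B →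
        (∀ y, |f y| ≤ B * W y ^ β) → ∀ x, |whithamL f x| ≤ A * B * W x) →
      0 ≤ B → (∀ h, W h ≤ V h) → (∀ a h, |reflDiff r a h| ≤ N * B * V h * W a ^ β) →
      ∀ a h, |reflDiff r a h| ≤ N * ((A * B + 1) / δ) * V h * W a := by
    intro β A B V hL hB hV hF a h
    have hV0 := (hW0 h).trans (hV h)
    have h1 := hL (fun x => reflDiff r x h) (N * B * V h) (C + C) (continuous_reflDiff_left hr h)
      (fun y => abs_reflDiff_le hC y h) (reflDiff_odd heven h) (reflDiff_periodic hper h)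
      (by positivity) (fun y => hF y h) a
    have h2 := herr a h
    have h3 : |D a h * reflDiff r a h| ≤ A * (N * B * V h) * W a + N * W a * W h := by
      have e : D a h * reflDiff r a h = whithamL (fun x => reflDiff r x h) a +
        (D a h * reflDiff r a h - whithamL (fun x => reflDiff r x h) a) := by ring
      rw [e]
      exact (abs_add_le _ _).trans (add_le_add h1 h2)
    rw [abs_mul, abs_of_pos (hδ.trans_le (hD a h))] at h3
    have h4 : δ * |reflDiff r a h| ≤ D a h * |reflDiff r a h| :=
      mul_le_mul_of_nonneg_right (hD a h) (abs_nonneg _)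
    have h5 : N * W a * W h ≤ N * W a * V h :=
      mul_le_mul_of_nonneg_left (hV h) (mul_nonneg hN (hW0 a))
    calc |reflDiff r a h| = (δ * |reflDiff r a h|) / δ := by field_simp
      _ ≤ (A * (N * B * V h) * W a + N * W a * V h) / δ := by
          gcongr
          linarith
      _ = _ := by ring
  have hsymm : ∀ a h, |reflDiff r a h| = |reflDiff r h a| := fun a h => by
    rw [reflDiff_comm heven]
  have s₁ : ∀ a h, |reflDiff r a h| ≤ N * B₁ * 1 * W a := by
    refine step α A₁ 1 (fun _ => 1) hL₁ zero_le_one hW1 fun a h => ?_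
    simpa using hinit a h
  -- By symmetry the bound holds with $\min(W(a),W(h))$, which can be split between the variables.
  -- The power of $W(a)$ must stay above $1/2$ for the next round; the rest goes to $W(h)$.
  have t₁ : ∀ a h, |reflDiff r a h| ≤ N * B₁ * W h ^ (3 / 8 : ℝ) * W a ^ (5 / 8 : ℝ) := by
    intro a h
    have h1 := s₁ a h
    have h2 := s₁ h a
    rw [← hsymm] at h2
    have h3 : |reflDiff r a h| ≤ N * B₁ * 1 * min (W a) (W h) := by
      rcases min_choice (W a) (W h) with h | h <;> rw [h] <;> assumption
    refine h3.trans ?_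
    have h4 := min_le_rpow_mul_rpow (s := 5 / 8) (t := 3 / 8) (hW0 a) (hW0 h) (by norm_num)
      (by norm_num) (by norm_num)
    calc N * B₁ * 1 * min (W a) (W h) ≤ N * B₁ * 1 * (W a ^ (5 / 8 : ℝ) * W h ^ (3 / 8 : ℝ)) := by
          gcongr
      _ = _ := by ring
  have s₂ : ∀ a h, |reflDiff r a h| ≤ N * B₂ * W h ^ (3 / 8 : ℝ) * W a :=
    step (5 / 8) A₂ B₁ (fun h => W h ^ (3 / 8 : ℝ)) hL₂ p₁.le
      (fun h => hWp _ h (by norm_num) (by norm_num)) t₁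
  -- Interpolation between $W(a)W(h)^{3/8}$ and its mirror image: the exponent in `a` is kept at
  -- $5/8$, and the exponent in `h` doubles.
  have t₂ : ∀ a h, |reflDiff r a h| ≤ N * B₂ * W h ^ (3 / 4 : ℝ) * W a ^ (5 / 8 : ℝ) := by
    intro a h
    have h1 := s₂ a h
    have h2 := s₂ h a
    rw [← hsymm] at h2
    have x0 := hW0 a
    have y0 := hW0 h
    rcases le_total (W a) (W h) with hle | hle
    · refine h1.trans ?_
      have e1 : W a = W a ^ (3 / 8 : ℝ) * W a ^ (5 / 8 : ℝ) := by
        rw [rpow_mul_rpow_of_add_eq x0 (u := 1) (by norm_num) (by norm_num) (by norm_num),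
          Real.rpow_one]
      have e2 : W h ^ (3 / 8 : ℝ) * W h ^ (3 / 8 : ℝ) = W h ^ (3 / 4 : ℝ) :=
        rpow_mul_rpow_of_add_eq y0 (by norm_num) (by norm_num) (by norm_num)
      calc N * B₂ * W h ^ (3 / 8 : ℝ) * W a
          = N * B₂ * W h ^ (3 / 8 : ℝ) * (W a ^ (3 / 8 : ℝ) * W a ^ (5 / 8 : ℝ)) := by rw [← e1]
        _ ≤ N * B₂ * W h ^ (3 / 8 : ℝ) * (W h ^ (3 / 8 : ℝ) * W a ^ (5 / 8 : ℝ)) := by gcongr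
        _ = _ := by rw [← e2]; ring
    · refine h2.trans ?_
      have e1 : W h = W h ^ (1 / 4 : ℝ) * W h ^ (3 / 4 : ℝ) := by
        rw [rpow_mul_rpow_of_add_eq y0 (u := 1) (by norm_num) (by norm_num) (by norm_num),
          Real.rpow_one]
      have e2 : W a ^ (3 / 8 : ℝ) * W a ^ (1 / 4 : ℝ) = W a ^ (5 / 8 : ℝ) :=
        rpow_mul_rpow_of_add_eq x0 (by norm_num) (by norm_num) (by norm_num)
      calc N * B₂ * W a ^ (3 / 8 : ℝ) * W h
          = N * B₂ * W a ^ (3 / 8 : ℝ) * (W h ^ (1 / 4 : ℝ) * W h ^ (3 / 4 : ℝ)) := by rw [← e1]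
        _ ≤ N * B₂ * W a ^ (3 / 8 : ℝ) * (W a ^ (1 / 4 : ℝ) * W h ^ (3 / 4 : ℝ)) := by gcongr
        _ = _ := by rw [← e2]; ring
  have s₃ : ∀ a h, |reflDiff r a h| ≤ N * B₃ * W h ^ (3 / 4 : ℝ) * W a :=
    step (5 / 8) A₂ B₂ (fun h => W h ^ (3 / 4 : ℝ)) hL₂ p₂.le
      (fun h => hWp _ h (by norm_num) (by norm_num)) t₂
  -- Since $3/4>1/2$, exchanging the variables now gives the full power of $W(h)$ and still allows a
  -- last round in `a`.
  have t₃ : ∀ a h, |reflDiff r a h| ≤ N * B₃ * W h * W a ^ (3 / 4 : ℝ) := by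
    intro a h
    rw [hsymm]
    exact (s₃ h a).trans (le_of_eq (by ring))
  intro a h
  exact (step (3 / 4) A₃ B₃ W hL₃ p₃.le (fun h => le_rfl) t₃ a h).trans (le_of_eq (by ring))

/-! ### Stability of monotone profiles in the Hölder space -/

theorem abs_whithamL_le_mul_of_abs_le {f : ℝ → ℝ} {C : ℝ} (hC : ∀ x, |f x| ≤ C) (x : ℝ) :
    |whithamL f x| ≤ (∫ z, |whithamKernel z|) * C := by
  rw [whithamL_eq_integral_sub, ← MeasureTheory.integral_mul_const, ← Real.norm_eq_abs (∫ _, _)]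
  refine MeasureTheory.norm_integral_le_of_norm_le (integrable_whithamKernel.abs.mul_const C)
    (Eventually.of_forall fun z => ?_)
  rw [norm_mul, Real.norm_eq_abs, Real.norm_eq_abs]
  exact mul_le_mul_of_nonneg_left (hC _) (abs_nonneg _)

namespace HolderEven

variable {P α : ℝ}

theorem sub_apply (f g : HolderEven P α) (x : ℝ) : (f - g) x = f x - g x := rfl

theorem continuous (f : HolderEven P α) : Continuous f := f.2.1

theorem bounded (f : HolderEven P α) : ∃ C, ∀ x, |f x| ≤ C := f.2.2.1

theorem even (f : HolderEven P α) : Function.Even f := f.2.2.2.2.1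

theorem periodic (f : HolderEven P α) : Function.Periodic f (2 * (P / 2)) := by
  rw [mul_div_cancel₀ _ (two_ne_zero' ℝ)]
  exact f.2.2.2.1

theorem abs_apply_le_norm (f : HolderEven P α) (x : ℝ) : |f x| ≤ ‖f‖ := by
  rw [norm_def]
  have h1 := le_ciSup (bddAbove_abs f) x
  have h2 := Real.iSup_nonneg (quot_nonneg f)
  linarith

theorem abs_sub_le_norm_mul (hα : 0 < α) (f : HolderEven P α) (x y : ℝ) :
    |f x - f y| ≤ ‖f‖ * |x - y| ^ α := by
  rcases eq_or_ne x y with h | h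
  · simp [h, Real.zero_rpow hα.ne']
  have hp : 0 < |x - y| ^ α := Real.rpow_pos_of_pos (abs_pos.2 (sub_ne_zero.2 h)) _
  rw [← div_le_iff₀ hp, norm_def]
  have h1 := le_ciSup (bddAbove_quot f) (x, y)
  have h2 : (0 : ℝ) ≤ ⨆ x : ℝ, |f x| := Real.iSup_nonneg fun _ => abs_nonneg _
  simp only at h1
  linarith

/-- Reflection in the lattice point $kP/2$ nearest to $a$ sends $a+h$ to a point at distance
$2|a-kP/2|=P\,W(a)$ from $a-h$, whatever $h$ is. Hölder continuity thus starts the bootstrap. -/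
theorem abs_reflDiff_le_latticeDist (hP : 0 < P) (hα : 0 < α) (r : HolderEven P α) (a h : ℝ) :
    |reflDiff r a h| ≤ ‖r‖ * P ^ α * latticeDist (P / 2) a ^ α := by
  obtain ⟨k, hk⟩ := exists_latticeDist_eq (half_pos hP) a
  have e : r (a + h) = r (k * (2 * (P / 2)) - (a + h)) := by
    rw [r.periodic.int_mul_sub_eq, r.even]
  rw [reflDiff, e]
  refine (r.abs_sub_le_norm_mul hα _ _).trans (le_of_eq ?_)
  have e2 : a - h - (k * (2 * (P / 2)) - (a + h)) = 2 * (a - k * (P / 2)) := by ring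
  rw [e2, abs_mul, hk, abs_two, ← mul_assoc, mul_div_cancel₀ _ (two_ne_zero' ℝ),
    Real.mul_rpow hP.le (latticeDist_nonneg _ _), mul_assoc]

theorem exists_le_sub_of_lt (hP : 0 < P) (f : HolderEven P α) {m : ℝ} (h : ∀ x, f x < m) :
    ∃ δ : ℝ, 0 < δ ∧ ∀ x, f x ≤ m - δ := by
  obtain ⟨x₀, -, hx₀⟩ := isCompact_Icc.exists_isMaxOn (nonempty_Icc.2 hP.le) f.continuous.continuousOn
  refine ⟨m - f x₀, sub_pos.2 (h x₀), fun x => ?_⟩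
  obtain ⟨y, hy, hxy⟩ := f.periodic.exists_mem_Ico (by linarith) x 0
  rw [hxy, sub_sub_cancel]
  exact hx₀ ⟨hy.1, by linarith [hy.2]⟩

theorem reflDiff_sub (f g : HolderEven P α) (a h : ℝ) :
    reflDiff (f - g : HolderEven P α) a h = reflDiff f a h - reflDiff g a h := by
  simp only [reflDiff, sub_apply]
  ring

theorem tendsto_apply {ι : Type*} {l : Filter ι} {f : ι → HolderEven P α} {g : HolderEven P α}
    (h : Tendsto f l (𝓝 g)) (x : ℝ) : Tendsto (fun i => f i x) l (𝓝 (g x)) := by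
  rw [tendsto_iff_norm_sub_tendsto_zero] at h ⊢
  refine squeeze_zero (fun i => norm_nonneg _) (fun i => ?_) h
  exact (f i - g).abs_apply_le_norm x

theorem whithamL_reflDiff_sub (f g : HolderEven P α) (a h : ℝ) :
    whithamL (fun x => reflDiff (f - g : HolderEven P α) x h) a =
      whithamL (fun x => reflDiff f x h) a - whithamL (fun x => reflDiff g x h) a := by
  obtain ⟨C, hC⟩ := f.bounded
  obtain ⟨D, hD⟩ := g.bounded
  rw [← whithamL_sub (continuous_reflDiff_left f.continuous h).measurable
    (continuous_reflDiff_left g.continuous h).measurable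
    (fun x => abs_reflDiff_le hC x h) (fun x => abs_reflDiff_le hD x h)]
  simp only [reflDiff_sub]

theorem tendsto_whithamL_reflDiff {ι : Type*} {l : Filter ι} {f : ι → HolderEven P α}
    {g : HolderEven P α} (h : Tendsto f l (𝓝 g)) (a b : ℝ) :
    Tendsto (fun i => whithamL (fun x => reflDiff (f i) x b) a) l
      (𝓝 (whithamL (fun x => reflDiff g x b) a)) := by
  rw [tendsto_iff_norm_sub_tendsto_zero] at h ⊢
  have h2 := (h.add h).const_mul (∫ z, |whithamKernel z|)
  rw [add_zero, mul_zero] at h2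
  refine squeeze_zero (fun i => norm_nonneg _) (fun i => ?_) h2
  rw [← whithamL_reflDiff_sub, Real.norm_eq_abs]
  exact abs_whithamL_le_mul_of_abs_le
    (fun x => abs_reflDiff_le (fun y => (f i - g).abs_apply_le_norm y) x b) a

/-- Profiles that decrease on a half-period are stable under perturbation along the equation
satisfied by the reflection differences of solutions. -/
theorem eventually_reflDiff_nonneg {ι : Type*} {l : Filter ι} [l.NeBot] (hP : 0 < P)
    (hα : 1 / 2 < α) (hα1 : α < 1) {g φ : ι → HolderEven P α} {μ : ι → ℝ} {g₀ φ₀ : HolderEven P α}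
    {μ₀ : ℝ} (hg : Tendsto g l (𝓝 g₀)) (hφ : Tendsto φ l (𝓝 φ₀)) (hμ : Tendsto μ l (𝓝 μ₀))
    (hlt : ∀ x, φ₀ x < μ₀ / 2)
    (heq : ∀ᶠ i in l, ∀ a h, (μ i - φ i (a - h) - φ i (a + h)) * reflDiff (g i) a h =
      whithamL (fun x => reflDiff (g i) x h) a)
    (h0 : ∀ a ∈ Icc 0 (P / 2), ∀ h ∈ Icc 0 (P / 2), 0 ≤ reflDiff g₀ a h)
    (hnc : ¬ ∃ c : ℝ, ∀ x, g₀ x = c) :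
    ∀ᶠ i in l, (∀ a ∈ Icc 0 (P / 2), ∀ h ∈ Icc 0 (P / 2), 0 ≤ reflDiff (g i) a h) ∧
      ¬ ∃ c : ℝ, ∀ x, g i x = c := by
  have hH : 0 < P / 2 := half_pos hP
  have heq₀ : ∀ a h, (μ₀ - φ₀ (a - h) - φ₀ (a + h)) * reflDiff g₀ a h =
      whithamL (fun x => reflDiff g₀ x h) a := by
    intro a h
    have h1 : Tendsto (fun i => (μ i - φ i (a - h) - φ i (a + h)) * reflDiff (g i) a h) l
        (𝓝 ((μ₀ - φ₀ (a - h) - φ₀ (a + h)) * reflDiff g₀ a h)) :=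
      ((hμ.sub (tendsto_apply hφ _)).sub (tendsto_apply hφ _)).mul
        ((tendsto_apply hg _).sub (tendsto_apply hg _))
    refine tendsto_nhds_unique (h1.congr' ?_) (tendsto_whithamL_reflDiff hg a h)
    filter_upwards [heq] with i hi
    exact hi a h
  obtain ⟨δ, hδ, hφδ⟩ := φ₀.exists_le_sub_of_lt hP hlt
  obtain ⟨C, hC⟩ := φ₀.bounded
  -- Nonnegativity alone is not stable, since $F$ vanishes where either variable meets the lattice.
  -- The quantitative bound by $W(a)W(h)$ can be perturbed.
  obtain ⟨c, hc, hlow⟩ := exists_reflDiff_ge (D := fun a h => μ₀ - φ₀ (a - h) - φ₀ (a + h))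
    (Dm := μ₀ + C + C) hH g₀.continuous g₀.bounded g₀.even g₀.periodic hnc heq₀
    (fun a h => by linarith [(abs_le.1 (hC (a - h))).1, (abs_le.1 (hC (a + h))).1]) h0
  obtain ⟨A, hA, hup⟩ := exists_reflDiff_le hH hα hα1.le hδ
  have hα0 : 0 < α := by linarith
  set N₀ := ‖g₀‖ * P ^ α with hN₀
  have hN₀0 : 0 ≤ N₀ := by positivity
  -- The bootstrap without error term. It is needed because the error for `g i - g₀` is a change of
  -- coefficient multiplied by the limiting reflection difference.
  have hF₀ : ∀ a h, |reflDiff g₀ a h| ≤ A * N₀ * latticeDist (P / 2) a * latticeDist (P / 2) h := by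
    refine hup g₀ (fun a h => μ₀ - φ₀ (a - h) - φ₀ (a + h)) N₀ g₀.continuous g₀.bounded g₀.even
      g₀.periodic hN₀0 (fun a h => by linarith [hφδ (a - h), hφδ (a + h)]) (fun a h => ?_)
      (fun a h => g₀.abs_reflDiff_le_latticeDist hP hα0 a h)
    rw [heq₀, sub_self, abs_zero]
    exact mul_nonneg (mul_nonneg hN₀0 (latticeDist_nonneg _ _)) (latticeDist_nonneg _ _)
  set e : ι → ℝ := fun i => |μ i - μ₀| + (‖φ i - φ₀‖ + ‖φ i - φ₀‖) with he
  have he0 : Tendsto e l (𝓝 0) := by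
    have h1 : Tendsto (fun i => ‖φ i - φ₀‖) l (𝓝 0) := tendsto_iff_norm_sub_tendsto_zero.1 hφ
    have h2 : Tendsto (fun i => |μ i - μ₀|) l (𝓝 0) := tendsto_iff_norm_sub_tendsto_zero.1 hμ
    have h3 := h2.add (h1.add h1)
    simpa using h3
  -- One quantity covering both inputs of the bootstrap for the difference: its initial Hölder bound
  -- and the error in the equation. It tends to zero.
  set N : ι → ℝ := fun i => ‖g i - g₀‖ * P ^ α + e i * (A * N₀) with hN
  have hN0 : Tendsto (fun i => A * N i) l (𝓝 0) := by
    have h1 : Tendsto (fun i => ‖g i - g₀‖) l (𝓝 0) := tendsto_iff_norm_sub_tendsto_zero.1 hg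
    have h2 := ((h1.mul_const (P ^ α)).add (he0.mul_const (A * N₀))).const_mul A
    simpa using h2
  filter_upwards [heq, he0.eventually (gt_mem_nhds hδ), hN0.eventually (gt_mem_nhds (half_pos hc))]
    with i hi hie hiN
  have hei : 0 ≤ e i := by positivity
  have hDdiff : ∀ a h, |(μ i - φ i (a - h) - φ i (a + h)) - (μ₀ - φ₀ (a - h) - φ₀ (a + h))| ≤ e i := by
    intro a h
    have h1 := (φ i - φ₀).abs_apply_le_norm (a - h)
    have h2 := (φ i - φ₀).abs_apply_le_norm (a + h)
    rw [sub_apply] at h1 h2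
    have e1 : (μ i - φ i (a - h) - φ i (a + h)) - (μ₀ - φ₀ (a - h) - φ₀ (a + h)) =
        (μ i - μ₀) - ((φ i (a - h) - φ₀ (a - h)) + (φ i (a + h) - φ₀ (a + h))) := by ring
    rw [e1]
    exact (abs_sub _ _).trans (add_le_add le_rfl ((abs_add_le _ _).trans (add_le_add h1 h2)))
  have hN1 : 0 ≤ N i := by positivity
  have hr := hup (g i - g₀ : HolderEven P α) (fun a h => μ i - φ i (a - h) - φ i (a + h)) (N i)
    (g i - g₀).continuous (g i - g₀).bounded (g i - g₀).even (g i - g₀).periodic hN1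
    (fun a h => ?_) (fun a h => ?_) (fun a h => ?_)
  · have hge : ∀ a ∈ Icc 0 (P / 2), ∀ h ∈ Icc 0 (P / 2),
        c / 2 * latticeDist (P / 2) a * latticeDist (P / 2) h ≤ reflDiff (g i) a h := by
      intro a ha h hh
      have h1 := hlow a ha h hh
      have h2 := (abs_le.1 (hr a h)).1
      rw [reflDiff_sub] at h2
      have h3 : A * N i * (latticeDist (P / 2) a * latticeDist (P / 2) h) ≤
          c / 2 * (latticeDist (P / 2) a * latticeDist (P / 2) h) :=
        mul_le_mul_of_nonneg_right hiN.le
          (mul_nonneg (latticeDist_nonneg _ _) (latticeDist_nonneg _ _))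
      linarith
    refine ⟨fun a ha h hh => le_trans ?_ (hge a ha h hh), ?_⟩
    · exact mul_nonneg (mul_nonneg (half_pos hc).le (latticeDist_nonneg _ _))
        (latticeDist_nonneg _ _)
    · rintro ⟨k, hk⟩
      have hm : P / 4 ∈ Ioo 0 (P / 2) := ⟨by linarith, by linarith⟩
      have h1 := hge _ (Ioo_subset_Icc_self hm) _ (Ioo_subset_Icc_self hm)
      rw [reflDiff, hk, hk, sub_self] at h1
      have h2 := latticeDist_pos hH hm
      have h3 : 0 < c / 2 * latticeDist (P / 2) (P / 4) * latticeDist (P / 2) (P / 4) := by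
        positivity
      linarith
  · linarith [(abs_le.1 (hDdiff a h)).1, hφδ (a - h), hφδ (a + h)]
  · rw [whithamL_reflDiff_sub, reflDiff_sub, ← hi a h, ← heq₀ a h]
    have e1 : (μ i - φ i (a - h) - φ i (a + h)) * (reflDiff (g i) a h - reflDiff g₀ a h) -
        ((μ i - φ i (a - h) - φ i (a + h)) * reflDiff (g i) a h -
          (μ₀ - φ₀ (a - h) - φ₀ (a + h)) * reflDiff g₀ a h) =
        -(((μ i - φ i (a - h) - φ i (a + h)) - (μ₀ - φ₀ (a - h) - φ₀ (a + h))) *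
          reflDiff g₀ a h) := by ring
    rw [e1, abs_neg, abs_mul]
    have hw := mul_nonneg (latticeDist_nonneg (P / 2) a) (latticeDist_nonneg (P / 2) h)
    calc _ ≤ e i * (A * N₀ * latticeDist (P / 2) a * latticeDist (P / 2) h) :=
          mul_le_mul (hDdiff a h) (hF₀ a h) (abs_nonneg _) hei
      _ = (e i * (A * N₀)) * (latticeDist (P / 2) a * latticeDist (P / 2) h) := by ring
      _ ≤ N i * (latticeDist (P / 2) a * latticeDist (P / 2) h) := by
          refine mul_le_mul_of_nonneg_right ?_ hw
          have : 0 ≤ ‖g i - g₀‖ * P ^ α := by positivity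
          linarith
      _ = _ := by ring
  · refine ((g i - g₀).abs_reflDiff_le_latticeDist hP hα0 a h).trans ?_
    refine mul_le_mul_of_nonneg_right ?_ (Real.rpow_nonneg (latticeDist_nonneg _ _) _)
    have : 0 ≤ e i * (A * N₀) := by positivity
    linarith

end HolderEven

/-! ### Monotone profiles along analytic curves -/

namespace HolderEven

variable {P α : ℝ}

theorem neg_apply (f : HolderEven P α) (x : ℝ) : (-f) x = -f x := rfl

/-- Nonconstant profiles that decrease on `(0, P / 2)`, in terms of reflection differences. -/
def IsDecreasing (g : HolderEven P α) : Prop :=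
  (∀ a ∈ Icc 0 (P / 2), ∀ h ∈ Icc 0 (P / 2), 0 ≤ reflDiff g a h) ∧ ¬ ∃ c : ℝ, ∀ x, g x = c

/-- Nonconstant profiles that are monotone on `(0, P / 2)`. -/
def IsMonotone (g : HolderEven P α) : Prop := g.IsDecreasing ∨ (-g).IsDecreasing

theorem IsDecreasing.of_affine {f g : HolderEven P α} {k c : ℝ} (hc : 0 < c)
    (h : ∀ x, f x = k + c * g x) (hg : g.IsDecreasing) : f.IsDecreasing := by
  refine ⟨fun a ha b hb => ?_, ?_⟩
  · have e : reflDiff f a b = c * reflDiff g a b := by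
      simp only [reflDiff, h]
      ring
    rw [e]
    exact mul_nonneg hc.le (hg.1 a ha b hb)
  · rintro ⟨d, hd⟩
    refine hg.2 ⟨(d - k) / c, fun x => ?_⟩
    rw [eq_div_iff hc.ne', ← hd x, h]
    ring

theorem IsMonotone.of_affine {f g : HolderEven P α} {k c : ℝ} (hc : c ≠ 0)
    (h : ∀ x, f x = k + c * g x) (hg : g.IsMonotone) : f.IsMonotone := by
  rcases lt_or_gt_of_ne hc with hc | hc
  · refine hg.symm.imp (fun hg => hg.of_affine (k := k) (neg_pos.2 hc) fun x => ?_)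
      (fun hg => hg.of_affine (k := -k) (neg_pos.2 hc) fun x => ?_)
    · rw [h, neg_apply]
      ring
    · rw [neg_apply, h]
      ring
  · refine hg.imp (fun hg => hg.of_affine hc h) (fun hg => hg.of_affine (k := -k) hc fun x => ?_)
    rw [neg_apply, neg_apply, h]
    ring

theorem IsMonotone.not_const {g : HolderEven P α} (hg : g.IsMonotone) :
    ¬ ∃ c : ℝ, ∀ x, g x = c := by
  rcases hg with hg | hg
  · exact hg.2
  · rintro ⟨c, hc⟩
    exact hg.2 ⟨-c, fun x => by rw [neg_apply, hc]⟩

theorem isDecreasing_of_tendsto {ι : Type*} {l : Filter ι} {g : ι → HolderEven P α}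
    {g₀ : HolderEven P α} (hg : Tendsto g l (𝓝 g₀)) (h : ∃ᶠ i in l, (g i).IsDecreasing)
    (hnc : ¬ ∃ c : ℝ, ∀ x, g₀ x = c) : g₀.IsDecreasing := by
  refine ⟨fun a ha b hb => ?_, hnc⟩
  exact ge_of_tendsto_of_frequently ((tendsto_apply hg (a - b)).sub (tendsto_apply hg (a + b)))
    (h.mono fun i hi => hi.1 a ha b hb)

/-- One of the two directions recurs along the filter, and weak inequalities survive the limit; only
nonconstancy has to be assumed. -/
theorem isMonotone_of_tendsto {ι : Type*} {l : Filter ι} {g : ι → HolderEven P α}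
    {g₀ : HolderEven P α} (hg : Tendsto g l (𝓝 g₀)) (h : ∃ᶠ i in l, (g i).IsMonotone)
    (hnc : ¬ ∃ c : ℝ, ∀ x, g₀ x = c) : g₀.IsMonotone := by
  rcases frequently_or_distrib.1 h with h | h
  · exact Or.inl (isDecreasing_of_tendsto hg h hnc)
  · refine Or.inr (isDecreasing_of_tendsto hg.neg h ?_)
    rintro ⟨c, hc⟩
    exact hnc ⟨-c, fun x => by rw [← hc, neg_apply, neg_neg]⟩

theorem eventually_isMonotone {ι : Type*} {l : Filter ι} [l.NeBot] (hP : 0 < P)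
    (hα : 1 / 2 < α) (hα1 : α < 1) {g φ : ι → HolderEven P α} {μ : ι → ℝ} {g₀ φ₀ : HolderEven P α}
    {μ₀ : ℝ} (hg : Tendsto g l (𝓝 g₀)) (hφ : Tendsto φ l (𝓝 φ₀)) (hμ : Tendsto μ l (𝓝 μ₀))
    (hlt : ∀ x, φ₀ x < μ₀ / 2)
    (heq : ∀ᶠ i in l, ∀ a h, (μ i - φ i (a - h) - φ i (a + h)) * reflDiff (g i) a h =
      whithamL (fun x => reflDiff (g i) x h) a)
    (h0 : g₀.IsMonotone) : ∀ᶠ i in l, (g i).IsMonotone := by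
  rcases h0 with h0 | h0
  · exact (eventually_reflDiff_nonneg hP hα hα1 hg hφ hμ hlt heq h0.1 h0.2).mono
      fun i hi => Or.inl hi
  · refine (eventually_reflDiff_nonneg hP hα hα1 hg.neg hφ hμ hlt ?_ h0.1 h0.2).mono
      fun i hi => Or.inr hi
    filter_upwards [heq] with i hi a h
    have e : ∀ x, reflDiff (-g i : HolderEven P α) x h = -1 * reflDiff (g i) x h := fun x => by
      simp only [reflDiff, neg_apply]
      ring
    simp only [e]
    rw [whithamL_const_mul, ← hi]
    ring

theorem IsDecreasing.isMonotoneWave {μ : ℝ} {f : HolderEven P α} (hf : f.IsDecreasing)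
    (hs : IsWhithamSolution P μ f) (hlt : ∀ x, f x < μ / 2) : IsMonotoneWave P μ f where
  solution := hs
  even := f.even
  nonconstant := hf.2
  monotone := by
    intro x hx y hy hxy
    rw [← f.even x, ← f.even y]
    exact antitoneOn_of_reflDiff_nonneg hf.1 ⟨by linarith [hy.2], by linarith [hy.1]⟩
      ⟨by linarith [hx.2], by linarith [hx.1]⟩ (by linarith)
  le_half x := (hlt x).le

end HolderEven

theorem IsWhithamSolution.comp_add {P μ : ℝ} {φ : ℝ → ℝ} (hφ : IsWhithamSolution P μ φ) (c : ℝ) :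
    IsWhithamSolution P μ fun x => φ (x + c) where
  continuous := hφ.continuous.comp (continuous_id.add continuous_const)
  bounded := hφ.bounded.imp fun _ h x => h _
  periodic x := by
    simp only [add_right_comm x P c]
    exact hφ.periodic _
  equation x := by
    rw [whithamL_comp_add]
    exact hφ.equation _

namespace HolderEven

variable {P α : ℝ}

/-- An even periodic profile is also even about $P/2$. Shifting by half a period moves the crest of
an increasing profile to the origin and leaves the speed unchanged. -/
theorem IsDecreasing.isMonotoneWave_comp_add {μ : ℝ} {f : HolderEven P α}
    (hf : (-f).IsDecreasing) (hs : IsWhithamSolution P μ f) (hlt : ∀ x, f x < μ / 2) :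
    IsMonotoneWave P μ fun x => f (x + P / 2) where
  solution := hs.comp_add _
  even x := by
    have e : -x + P / 2 = -(x + P / 2) + 2 * (P / 2) := by ring
    simp only [e, f.periodic _, f.even _]
  nonconstant := by
    rintro ⟨c, hc⟩
    refine hf.2 ⟨-c, fun x => ?_⟩
    rw [neg_apply, ← hc (x - P / 2), sub_add_cancel]
  monotone := by
    intro x hx y hy hxy
    have h := antitoneOn_of_reflDiff_nonneg hf.1 (a := x + P / 2) (b := y + P / 2)
      ⟨by linarith [hx.1], by linarith [hx.2]⟩ ⟨by linarith [hy.1], by linarith [hy.2]⟩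
      (by linarith)
    rw [neg_apply, neg_apply] at h
    exact neg_le_neg_iff.1 h
  le_half x := (hlt _).le

/-- Evaluation at the origin. -/
noncomputable def evalZero : HolderEven P α →L[ℝ] ℝ :=
  LinearMap.mkContinuous
    { toFun := fun f => f 0, map_add' := fun _ _ => rfl, map_smul' := fun _ _ => rfl } 1
    fun f => by
      rw [one_mul]
      exact f.abs_apply_le_norm 0

theorem evalZero_apply (f : HolderEven P α) : evalZero f = f 0 := rfl

/-- The constant function `1`. -/
def one (P α : ℝ) : HolderEven P α :=
  ⟨fun _ => 1, continuous_const, ⟨1, by simp⟩, fun _ => rfl, fun _ => rfl, ⟨0, by simp⟩⟩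

theorem one_apply (x : ℝ) : one P α x = 1 := rfl

/-- Along an analytic curve of solutions, monotonicity propagates from an accumulation point to a
punctured neighbourhood. -/
theorem eventually_isMonotone_of_frequently (hP : 0 < P) (hα : 1 / 2 < α) (hα1 : α < 1)
    {q : ℝ → HolderEven P α × ℝ} (hq : AnalyticAt ℝ q 0)
    (hmem : ∀ᶠ t in 𝓝 0, q t ∈ whithamSolutionSet P α)
    (h : ∃ᶠ t in 𝓝[≠] 0, (q t).1.IsMonotone) : ∀ᶠ t in 𝓝[≠] 0, (q t).1.IsMonotone := by
  have hq1 : AnalyticAt ℝ (fun t => (q t).1) 0 :=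
    analyticAt_fst.comp hq
  -- Working modulo constants is essential, since the curve may pass through a constant solution at
  -- $t=0$.
  have hF : AnalyticAt ℝ (fun t => (q t).1 - evalZero (q t).1 • one P α) 0 :=
    hq1.sub (((evalZero.analyticAt _).comp hq1).smul analyticAt_const)
  have hne : ¬ ∀ᶠ t in 𝓝 0, (q t).1 - evalZero (q t).1 • one P α = 0 := by
    intro h0
    obtain ⟨t, ht, ht0⟩ := (h.and_eventually (h0.filter_mono nhdsWithin_le_nhds)).exists
    refine ht.not_const ⟨(q t).1 0, fun x => ?_⟩
    rw [sub_eq_zero.1 ht0, smul_apply, smul_apply]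
    rfl
  -- Extracting the leading power leaves a profile with nonzero limit. The sign of $t^n$ may change
  -- across $0$, so increasing and decreasing profiles are treated together.
  obtain ⟨n, g, hg, hg0, hpow⟩ := hF.exists_eventuallyEq_pow_smul_nonzero_iff.2 hne
  have hform : ∀ᶠ t in 𝓝[≠] (0 : ℝ), t ^ n ≠ 0 ∧
      (∀ x, (q t).1 x = (q t).1 0 + t ^ n * g t x) ∧ q t ∈ whithamSolutionSet P α := by
    filter_upwards [hpow.filter_mono nhdsWithin_le_nhds, hmem.filter_mono nhdsWithin_le_nhds,
      self_mem_nhdsWithin] with t ht hm ht0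
    refine ⟨pow_ne_zero n ht0, fun x => ?_, hm⟩
    rw [sub_zero, sub_eq_iff_eq_add] at ht
    have h1 : (q t).1 x = (t ^ n • g t + evalZero (q t).1 • one P α) x := by rw [← ht]
    rw [add_apply, smul_apply, smul_apply, one_apply, evalZero_apply] at h1
    rw [h1]
    ring
  have hglim : Tendsto g (𝓝[≠] 0) (𝓝 (g 0)) := hg.continuousAt.tendsto.mono_left nhdsWithin_le_nhds
  have hg00 : g 0 0 = 0 := by
    refine tendsto_nhds_unique (tendsto_apply hglim 0) (tendsto_const_nhds.congr' ?_)
    filter_upwards [hform] with t ht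
    have h1 := ht.2.1 0
    have h2 : t ^ n * g t 0 = 0 := by linarith
    exact ((mul_eq_zero.1 h2).resolve_left ht.1).symm
  -- All profiles vanish at $x=0$ by the normalisation, so a constant limit would be zero.
  have hnc : ¬ ∃ c : ℝ, ∀ x, g 0 x = c := by
    rintro ⟨c, hc⟩
    refine hg0 (ext_fun fun x => ?_)
    rw [hc, ← hc 0, hg00, zero_apply]
  have hmono : (g 0).IsMonotone := by
    refine isMonotone_of_tendsto hglim ((h.and_eventually hform).mono ?_) hnc
    rintro t ⟨ht, ht0, hx, -⟩
    refine ht.of_affine (k := -((t ^ n)⁻¹ * (q t).1 0)) (inv_ne_zero ht0) fun x => ?_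
    rw [hx x, mul_add, inv_mul_cancel_left₀ ht0]
    ring
  have hqlim : Tendsto q (𝓝[≠] 0) (𝓝 (q 0)) := hq.continuousAt.tendsto.mono_left nhdsWithin_le_nhds
  -- The rescaled profiles satisfy the same linear relation, with coefficients from the solutions
  -- themselves. For this reason the stability lemma keeps `g` and `φ` apart.
  have hev := eventually_isMonotone hP hα hα1 hglim ((continuous_fst.tendsto _).comp hqlim)
    ((continuous_snd.tendsto _).comp hqlim) hmem.self_of_nhds.1 ?_ hmono
  · filter_upwards [hev, hform] with t ht hf
    exact ht.of_affine hf.1 hf.2.1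
  · filter_upwards [hform] with t ht a b
    obtain ⟨ht0, hx, -, hs⟩ := ht
    have e : ∀ x, reflDiff (g t) x b = (t ^ n)⁻¹ * reflDiff (q t).1 x b := fun x => by
      simp only [reflDiff]
      rw [hx (x - b), hx (x + b)]
      field_simp
      ring
    simp only [e]
    rw [whithamL_const_mul, ← hs.reflDiff_eq]
    simp only [Function.comp_apply]
    ring

end HolderEven

/-! ### Monotonicity and speed along the global curve -/

/-- A continuous injective function on an interval is a local homeomorphism onto its image. -/
theorem eventually_nhdsNE_of_comp {ρ : ℝ → ℝ} (hc : ContinuousOn ρ (Ioo (-1) 1))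
    (hi : InjOn ρ (Ioo (-1) 1)) {p : ℝ → Prop} (h : ∀ᶠ t in 𝓝[≠] 0, p (ρ t)) :
    ∀ᶠ s in 𝓝[≠] (ρ 0), p s := by
  obtain ⟨r, hr, hr'⟩ := Metric.nhdsWithin_basis_ball.eventually_iff.1 h
  set d := min r 1 / 2 with hd
  have hd0 : 0 < d := by positivity
  have hdr : d < r := by
    have := min_le_left r 1
    have : 0 < min r 1 := by positivity
    linarith
  have hd1 : d < 1 := by linarith [min_le_right r 1]
  have hsub : Icc (-d) d ⊆ Ioo (-1) 1 := fun t ht => ⟨by linarith [ht.1], by linarith [ht.2]⟩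
  have hc' := hc.mono hsub
  have himg : ρ '' Icc (-d) d ∈ 𝓝 (ρ 0) := by
    have m1 : -d ∈ Icc (-d) d := ⟨le_rfl, by linarith⟩
    have m2 : d ∈ Icc (-d) d := ⟨by linarith, le_rfl⟩
    have m0 : (0 : ℝ) ∈ Icc (-d) d := ⟨by linarith, hd0.le⟩
    rcases hc'.strictMonoOn_of_injOn_Icc' (by linarith) (hi.mono hsub) with hm | hm
    · exact mem_of_superset (Icc_mem_nhds (hm m1 m0 (by linarith)) (hm m0 m2 hd0))
        (intermediate_value_Icc (by linarith) hc')
    · exact mem_of_superset (Icc_mem_nhds (hm m0 m2 hd0) (hm m1 m0 (by linarith)))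
        (intermediate_value_Icc' (by linarith) hc')
  filter_upwards [nhdsWithin_le_nhds himg, self_mem_nhdsWithin] with s hs hs0
  obtain ⟨t, ht, rfl⟩ := hs
  refine hr' ⟨?_, fun h0 => hs0 (by rw [mem_singleton_iff.1 h0]; rfl)⟩
  rw [Metric.mem_ball, dist_zero_right, Real.norm_eq_abs]
  exact (abs_le.2 ht).trans_lt hdr

namespace IsGlobalBifurcationCurve

variable {P α : ℝ} {γ : ℝ → HolderEven P α × ℝ}

theorem eventually_isMonotone_of_frequently (hP : 0 < P) (hα : 1 / 2 < α) (hα1 : α < 1)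
    (hγ : IsGlobalBifurcationCurve P α γ) {s : ℝ} (hs : 0 < s)
    (h : ∃ᶠ s' in 𝓝[≠] s, (γ s').1.IsMonotone) : ∀ᶠ s' in 𝓝[≠] s, (γ s').1.IsMonotone := by
  obtain ⟨ρ, hc, hi, rfl, hmaps, han⟩ := hγ.reparam s hs
  have h0 : (0 : ℝ) ∈ Ioo (-1 : ℝ) 1 := by norm_num
  refine eventually_nhdsNE_of_comp hc hi ?_
  refine HolderEven.eventually_isMonotone_of_frequently hP hα hα1 (han 0 h0) ?_ ?_
  · filter_upwards [isOpen_Ioo.mem_nhds h0] with t ht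
    exact hγ.mem _ (le_of_lt (hmaps ht))
  · intro hcon
    exact h (eventually_nhdsNE_of_comp hc hi hcon)

/-- The rescaled profiles $s^{-1}\varphi(s)$ converge to the cosine, whose reflection difference
$2\sin(2\pi a/P)\sin(2\pi h/P)$ is nonnegative on the half-period square. Stability is applied to
them, with coefficients from the curve near the trivial solution. -/
theorem eventually_isMonotone_zero (hP : 0 < P) (hα : 1 / 2 < α) (hα1 : α < 1)
    (hγ : IsGlobalBifurcationCurve P α γ) : ∀ᶠ s in 𝓝[>] 0, (γ s).1.IsMonotone := by
  obtain ⟨ε, l, hl, heq⟩ := hγ.extends_local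
  obtain ⟨v, hv, hder⟩ := hl.direction
  have hγ0 : γ 0 = l 0 := heq 0 ⟨le_rfl, hl.pos⟩
  have hγlim : Tendsto γ (𝓝[>] 0) (𝓝 (γ 0)) :=
    (hγ.continuousOn 0 self_mem_Ici).tendsto.mono_left (nhdsWithin_mono _ Ioi_subset_Ici_self)
  have hlim : Tendsto (fun s => s⁻¹ • (γ s).1) (𝓝[>] 0) (𝓝 v) := by
    have h1 := hasDerivAt_iff_tendsto_slope_zero.1 hder
    have h2 := h1.mono_left (nhdsWithin_mono (0 : ℝ) fun s (hs : 0 < s) => hs.ne')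
    refine h2.congr' ?_
    filter_upwards [Ioo_mem_nhdsGT hl.pos] with s hs
    rw [zero_add, hl.start, sub_zero, heq s ⟨hs.1.le, hs.2⟩]
  have hmono : v.IsMonotone := by
    left
    refine ⟨fun a ha b hb => ?_, ?_⟩
    · have e : reflDiff v a b =
          2 * Real.sin (2 * Real.pi * a / P) * Real.sin (2 * Real.pi * b / P) := by
        have e1 : 2 * Real.pi * (a - b) / P = 2 * Real.pi * a / P - 2 * Real.pi * b / P := by ring
        have e2 : 2 * Real.pi * (a + b) / P = 2 * Real.pi * a / P + 2 * Real.pi * b / P := by ring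
        rw [reflDiff, hv, hv, e1, e2, Real.cos_sub, Real.cos_add]
        ring
      have hsin : ∀ a ∈ Icc 0 (P / 2), 0 ≤ Real.sin (2 * Real.pi * a / P) := by
        intro a ha
        have := Real.pi_pos
        refine Real.sin_nonneg_of_nonneg_of_le_pi (div_nonneg (mul_nonneg (by positivity) ha.1) hP.le) ?_
        rw [div_le_iff₀ hP]
        nlinarith [ha.2]
      rw [e]
      exact mul_nonneg (mul_nonneg zero_le_two (hsin a ha)) (hsin b hb)
    · rintro ⟨c, hc⟩
      have h1 := (hc 0).trans (hc (P / 2)).symm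
      rw [hv, hv] at h1
      have e : 2 * Real.pi * (P / 2) / P = Real.pi := by field_simp
      rw [e] at h1
      norm_num at h1
  have hev := HolderEven.eventually_isMonotone hP hα hα1 hlim ((continuous_fst.tendsto _).comp hγlim)
    ((continuous_snd.tendsto _).comp hγlim) (hγ.mem 0 le_rfl).1 ?_ hmono
  · filter_upwards [hev, self_mem_nhdsWithin] with s hs hs0
    refine hs.of_affine (k := 0) (ne_of_gt hs0) fun x => ?_
    rw [HolderEven.smul_apply, mul_inv_cancel_left₀ (ne_of_gt hs0), zero_add]
  · filter_upwards [self_mem_nhdsWithin] with s hs a b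
    have e : ∀ x, reflDiff (s⁻¹ • (γ s).1 : HolderEven P α) x b =
        s⁻¹ * reflDiff (γ s).1 x b := fun x => by
      simp only [reflDiff, HolderEven.smul_apply]
      ring
    simp only [e]
    rw [whithamL_const_mul, ← (hγ.mem s (le_of_lt hs)).2.reflDiff_eq]
    simp only [Function.comp_apply]
    ring

/-- Each parameter has a punctured neighbourhood on which either all profiles are monotone or none
is. Both alternatives are open and they exclude each other, so connectedness of $(0,\infty)$ extends
the first one from near $0$ to the whole half-line. -/
theorem eventually_isMonotone (hP : 0 < P) (hα : 1 / 2 < α) (hα1 : α < 1)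
    (hγ : IsGlobalBifurcationCurve P α γ) {s : ℝ} (hs : 0 < s) :
    ∀ᶠ s' in 𝓝[≠] s, (γ s').1.IsMonotone := by
  by_contra hcon
  have hev : ∀ t, 0 < t → (∀ᶠ s' in 𝓝[≠] t, (γ s').1.IsMonotone) ∨
      ∀ᶠ s' in 𝓝[≠] t, ¬ (γ s').1.IsMonotone := by
    intro t ht
    by_cases h : ∃ᶠ s' in 𝓝[≠] t, (γ s').1.IsMonotone
    · exact Or.inl (hγ.eventually_isMonotone_of_frequently hP hα hα1 ht h)
    · exact Or.inr (not_frequently.1 h)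
  obtain ⟨r, hr, hr'⟩ := mem_nhdsGT_iff_exists_Ioo_subset.1
    (hγ.eventually_isMonotone_zero hP hα hα1)
  have hr0 : (0 : ℝ) < r := hr
  have hmem : r / 2 ∈ Ioo 0 r := ⟨by linarith, by linarith⟩
  have hstart : ∀ᶠ s' in 𝓝[≠] (r / 2), (γ s').1.IsMonotone := by
    filter_upwards [nhdsWithin_le_nhds (isOpen_Ioo.mem_nhds hmem)] with t ht
    exact hr' ht
  obtain ⟨t, -, ht1, ht2⟩ := isPreconnected_Ioi (a := (0 : ℝ)) _ _
    (isOpen_setOfPred_eventually_nhdsWithin (p := fun s' => (γ s').1.IsMonotone))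
    (isOpen_setOfPred_eventually_nhdsWithin (p := fun s' => ¬ (γ s').1.IsMonotone))
    (fun t ht => hev t ht) ⟨r / 2, hmem.1, hstart⟩ ⟨s, hs, (hev s hs).resolve_left hcon⟩
  obtain ⟨x, hx, hx'⟩ := (Filter.Eventually.and (mem_ofPred_eq.mp ht1) (mem_ofPred_eq.mp ht2)).exists
  exact hx' hx

/-- Exceptional parameters, where the profile may be constant, are approached from the right through
monotone waves; continuity of the speed carries the bound over. -/
theorem le_speed (hP : 0 < P) (hα : 1 / 2 < α) (hα1 : α < 1)
    (hγ : IsGlobalBifurcationCurve P α γ) {c : ℝ}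
    (hc : ∀ (μ : ℝ) (φ : ℝ → ℝ), IsMonotoneWave P μ φ → c ≤ μ) {s : ℝ} (hs : 0 ≤ s) :
    c ≤ (γ s).2 := by
  have hmono : ∀ t, 0 ≤ t → (γ t).1.IsMonotone → c ≤ (γ t).2 := by
    intro t ht h
    obtain ⟨hlt, hsol⟩ := hγ.mem t ht
    rcases h with h | h
    · exact hc _ _ (h.isMonotoneWave hsol hlt)
    · exact hc _ _ (h.isMonotoneWave_comp_add hsol hlt)
  have hlim : Tendsto (fun t => (γ t).2) (𝓝[>] s) (𝓝 (γ s).2) :=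
    (continuous_snd.tendsto _).comp ((hγ.continuousOn s hs).tendsto.mono_left
      (nhdsWithin_mono _ fun t ht => hs.trans (le_of_lt ht)))
  refine ge_of_tendsto hlim ?_
  have hev : ∀ᶠ t in 𝓝[>] s, (γ t).1.IsMonotone := by
    rcases hs.eq_or_lt with rfl | hs
    · exact hγ.eventually_isMonotone_zero hP hα hα1
    · exact (hγ.eventually_isMonotone hP hα hα1 hs).filter_mono
        (nhdsWithin_mono _ fun t ht => ne_of_gt ht)
  filter_upwards [hev, self_mem_nhdsWithin] with t ht hst
  exact hmono t (hs.trans (le_of_lt hst)) ht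

end IsGlobalBifurcationCurve

theorem lemma4p2 (P : ℝ) (hP : 0 < P) :
    (∃ lam : ℝ, 0 < lam ∧
      ∀ (μ : ℝ) (φ : ℝ → ℝ), IsMonotoneWave P μ φ → μ / 2 - φ (P / 2) ≥ lam) ∧
    (∃ C : ℝ, 0 < C ∧
      ∀ (μ : ℝ) (φ : ℝ → ℝ), IsMonotoneWave P μ φ →
        ∀ x₀ : ℝ, x₀ < 0 → ∀ x ∈ Icc (-(P / 2)) x₀,
          μ / 2 - φ x ≥ C * |x₀| ^ (1 / 2 : ℝ)) ∧
    (∃ c : ℝ, 0 < c ∧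
      ∀ α : ℝ, 1 / 2 < α → α < 1 →
        ∀ γ : ℝ → HolderEven P α × ℝ, IsGlobalBifurcationCurve P α γ →
          ∀ s : ℝ, 0 ≤ s → (γ s).2 ≥ c) := by
  have hH : 0 < P / 2 := half_pos hP
  obtain ⟨C, hC, hsqrt⟩ := exists_sqrt_le_half_sub hP
  obtain ⟨c, hc, hspeed⟩ := exists_le_speed hP
  refine ⟨⟨C * √(P / 2), by positivity, fun μ φ hφ => hsqrt μ φ hφ _ ⟨hH, le_rfl⟩⟩,
    ⟨C, hC, fun μ φ hφ x₀ hx₀ x hx => ?_⟩,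
    ⟨c, hc, fun α hα hα1 γ hγ s hs => hγ.le_speed hP hα hα1 hspeed hs⟩⟩
  -- By evenness it suffices to work at $-x\ge-x_0>0$, where the profile is no larger than at
  -- $-x_0$.
  have h1 := hsqrt μ φ hφ (-x₀) ⟨by linarith, by linarith [hx.1, hx.2]⟩
  have h2 := hφ.antitoneOn hP (a := -x₀) (b := -x) ⟨by linarith, by linarith [hx.1, hx.2]⟩
    ⟨by linarith [hx.2], by linarith [hx.1]⟩ (by linarith [hx.2])
  rw [hφ.even x] at h2
  rw [abs_of_neg hx₀, ← Real.sqrt_eq_rpow]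
  linarith
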